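/- Work in the ring $\mathbb{Q}[[p_1,p_2,p_3,\dots]]$ of (degreewise completed) symmetric functions in the power sums $p_k$ ($\deg p_k=k$), or in $\mathbb{Q}[t][[p_1,p_2,\dots]]$ when a parameter $t$ occurs. Let $\circ$ denote plethysm, $f\circ g=f(p_1\circ g,p_2\circ g,\dots)$ for $g$ without constant term, where $p_k\circ -$ is the ring endomorphism with $p_k\circ p_j=p_{kj}$ and $p_k\circ t=t^k$. For $f$ without constant term put $$\Sigma_t f=-\tfrac1t f(-tp_1,-t^2p_2,-t^3p_3,\dots),$$ and put $\Sigma f=-f(-p_1,-p_2,-p_3,\dots)$. Let $$\mathrm{Assoc}=\frac{p_1}{1-p_1},\qquad \mathrm{Comm}=\exp\Big(\sum_{k\ge1}\frac{p_k}{k}\Big)-1,$$ let $\mathrm{Lie}=\sum_{n\ge1}\mathrm{ch}(\mathrm{Lie}(n))$, where $\mathrm{Lie}(n)$ is the $\mathfrak{S}_n$-module given by the multilinear part of the free Lie algebra over $\mathbb{Q}$ on $n$ generators, and let $\mathrm{PreLie}=\sum_{n\ge1}\mathrm{ch}(\mathrm{PreLie}(n))$, where $\mathrm{PreLie}(n)$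 is the permutation representation of $\mathfrak{S}_n$ on the rooted trees with vertex set $\{1,\dots,n\}$; here $\mathrm{ch}$ is the Frobenius characteristic. Let $\mathsf{HAL}^{pa}$ be the unique symmetric function with parameter $t$ and without constant term such that $$\mathsf{HAL}^{pa}=p_1\cdot\big([\Sigma_t\mathrm{Assoc}]\circ\mathrm{Comm}\circ[p_1-t\,\mathsf{HAL}^{pa}]\big),$$ and put $$\mathsf{HAL}^{p}=p_1\cdot\big([\Sigma_t\mathrm{Lie}]\circ\mathrm{Comm}\circ[p_1-t\,\mathsf{HAL}^{pa}]\big),\quad \mathsf{HAL}^{a}=[\mathrm{Comm}-p_1]\circ[p_1-t\,\mathsf{HAL}^{pa}],\quad \mathsf{HAL}=\mathsf{HAL}^{p}+\mathsf{HAL}^{a}-\mathsf{HAL}^{pa}.$$ Let $\overline{\mathsf{HAL}}$ be the specialization of $\mathsf{HAL}$ at $t=1$. **Proposition.** One has $$\mathrm{Comm}\circ\Sigma\,\mathrm{PreLie}=p_1-\big(p_1\,\partial_{p_1}\overline{\mathsf{HAL}}-\overline{\mathsf{HAL}}\big).$$ Moreover, this Euler characteristic describes, at the level of symmetric functions, the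 generators of the free pre-Lie algebras as Lie algebras: a symmetric function $G$ without constant term satisfies $\mathrm{Lie}\circ G=\mathrm{PreLie}$ if and only if $\Sigma G=\mathrm{Comm}\circ\Sigma\,\mathrm{PreLie}$. -/

import Mathlib

namespace PreLieHAL

open MvPowerSeries

noncomputable section

/-! ### Symmetric functions

The ring of (degreewise completed) symmetric functions with coefficients in a `ℚ`-algebra `R` is
`R[[p₁, p₂, p₃, …]]`, where `p_k` is the `k`-th power sum, of degree `k`. -/

/-- Symmetric functions with coefficients in `R`, as power series in the power sums `p_k`. -/
abbrev SymFun (R : Type) [CommRing R] : Type := MvPowerSeries ℕ+ R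

/-- The power sum `p_k`. -/
abbrev p {R : Type} [CommRing R] (k : ℕ+) : SymFun R := X k

/-- The degree of a monomial in the power sums, where `p_k` has degree `k`. -/
abbrev degree (m : ℕ+ →₀ ℕ) : ℕ := Finsupp.weight (fun k : ℕ+ => (k : ℕ)) m

/-- The plethysm `g ↦ p_k ∘ g`: it sends `p_j` to `p_{kj}` and acts on the coefficients by the
ring endomorphism `ψ k`. -/
def adams {R : Type} [CommRing R] (ψ : ℕ+ → R →+* R) (k : ℕ+) (g : SymFun R) : SymFun R :=
  rename (mulLeftEmbedding k) (map (ψ k) g)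

/-- The plethysm `f ∘ g`, i.e. `f(p₁ ∘ g, p₂ ∘ g, …)`, meaningful when `g` has no constant term. -/
def plethysmWith {R : Type} [CommRing R] (ψ : ℕ+ → R →+* R) (f g : SymFun R) : SymFun R :=
  subst (fun k => adams ψ k g) f

/-- Plethysm of symmetric functions over `ℚ`. -/
def plethysm (f g : SymFun ℚ) : SymFun ℚ := plethysmWith (fun _ => RingHom.id ℚ) f g

/-- Plethysm of symmetric functions with a parameter `t`, which satisfies `p_k ∘ t = t ^ k`. -/
def plethysmT (f g : SymFun (Polynomial ℚ)) : SymFun (Polynomial ℚ) :=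
  plethysmWith (fun k => (Polynomial.expand ℚ k).toRingHom) f g

/-- The parameter `t`, as a constant symmetric function. -/
def t : SymFun (Polynomial ℚ) := C Polynomial.X

/-- A symmetric function over `ℚ`, seen as a symmetric function with a parameter `t`. -/
def extend (f : SymFun ℚ) : SymFun (Polynomial ℚ) := map Polynomial.C f

/-- The substitution `t = 1`. -/
def atOne (f : SymFun (Polynomial ℚ)) : SymFun ℚ := map (Polynomial.evalRingHom 1) f

/-- The suspension `Σ f = - f(-p₁, -p₂, -p₃, …)`. -/
def suspension (f : SymFun ℚ) : SymFun ℚ := -rescale (fun _ => (-1 : ℚ)) f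

/-- The suspension `Σ_t f = -(1/t) f(-t p₁, -t² p₂, -t³ p₃, …)` of a symmetric function `f` without
constant term. Every coefficient of `f(-t p₁, -t² p₂, …)` is then divisible by `t`, and
`Polynomial.divX` is the division by `t`. -/
def suspensionT (f : SymFun ℚ) : SymFun (Polynomial ℚ) := fun m =>
  -(coeff m (rescale (fun k : ℕ+ => -(Polynomial.X : Polynomial ℚ) ^ (k : ℕ)) (extend f))).divX

/-! ### Frobenius characteristic -/

/-- The monomial `p_{λ₁} p_{λ₂} ⋯` where the `λ_i` are the lengths of the cycles of `σ`, fixed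
points included; it is given by its exponents. -/
def cycleMonomial {n : ℕ} (σ : Equiv.Perm (Fin n)) : ℕ+ →₀ ℕ :=
  (Multiset.toFinsupp σ.partition.parts).comapDomain (fun k : ℕ+ => (k : ℕ))
    PNat.coe_injective.injOn

/-- The Frobenius characteristic `(1/n!) ∑_σ χ(σ) p_{cycle type of σ}` of a finite-dimensional
representation of the symmetric group on `n` letters. -/
def frobenius {n : ℕ} {V : Type} [AddCommGroup V] [Module ℚ V]
    (ρ : Representation ℚ (Equiv.Perm (Fin n)) V) : SymFun ℚ :=
  ((n.factorial : ℚ)⁻¹) • ∑ σ : Equiv.Perm (Fin n), monomial (cycleMonomial σ) (ρ.character σ)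

/-- The symmetric function `∑_n ch(V_n)` of a sequence of finite-dimensional representations of
the symmetric groups; only `ch(V_n)` contributes to degree `n`. -/
def frobeniusSeries {V : ℕ → Type} [∀ n, AddCommGroup (V n)] [∀ n, Module ℚ (V n)]
    (ρ : ∀ n, Representation ℚ (Equiv.Perm (Fin n)) (V n)) : SymFun ℚ :=
  fun m => coeff m (frobenius (ρ (degree m)))

/-! ### The associative and commutative operads -/

/-- `Assoc = p₁ / (1 - p₁)`. -/
def Assoc : SymFun ℚ := p 1 * (1 - p 1)⁻¹

/-- The infinite sum `∑_{k ≥ 1} p_k / k`. -/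
def powerSumSeries : SymFun ℚ := fun m =>
  ∑ᶠ k : ℕ+, coeff m (((k : ℚ)⁻¹) • (p k : SymFun ℚ))

/-- `Comm = exp(∑_{k ≥ 1} p_k / k) - 1`. -/
def Comm : SymFun ℚ := (PowerSeries.exp ℚ).subst powerSumSeries - 1

/-! ### The Lie operad -/

/-- `IsBracketing S x` means that `x` is an iterated bracket, in the free Lie algebra over `ℚ` on
`α`, in which the elements of `S` occur exactly once each and no other generator occurs. -/
inductive IsBracketing {α : Type} [DecidableEq α] : Finset α → FreeLieAlgebra ℚ α → Prop
  | of (i : α) : IsBracketing {i} (FreeLieAlgebra.of ℚ i)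
  | lie {S T : Finset α} {x y : FreeLieAlgebra ℚ α} (h : Disjoint S T)
      (hx : IsBracketing S x) (hy : IsBracketing T y) : IsBracketing (S ∪ T) ⁅x, y⁆

/-- The multilinear part of the free Lie algebra on `n` generators, that is, the component
`Lie(n)` of the operad `Lie`. -/
def lieOperad (n : ℕ) : Submodule ℚ (FreeLieAlgebra ℚ (Fin n)) :=
  Submodule.span ℚ {x | IsBracketing Finset.univ x}

/-- The action of a permutation of the generators on the free Lie algebra. -/
def relabelLie {α : Type} (σ : Equiv.Perm α) : FreeLieAlgebra ℚ α →ₗ⁅ℚ⁆ FreeLieAlgebra ℚ α :=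
  FreeLieAlgebra.lift ℚ (fun i => FreeLieAlgebra.of ℚ (σ i))

theorem relabelLie_of {α : Type} (σ : Equiv.Perm α) (i : α) :
    relabelLie σ (FreeLieAlgebra.of ℚ i) = FreeLieAlgebra.of ℚ (σ i) :=
  FreeLieAlgebra.lift_of_apply _ i

theorem relabelLie_one {α : Type} (x : FreeLieAlgebra ℚ α) :
    relabelLie (1 : Equiv.Perm α) x = x := by
  have h : relabelLie (1 : Equiv.Perm α) = LieHom.id :=
    FreeLieAlgebra.hom_ext (fun i => by rw [relabelLie_of]; rfl)
  rw [h]; rfl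

theorem relabelLie_mul {α : Type} (σ τ : Equiv.Perm α) (x : FreeLieAlgebra ℚ α) :
    relabelLie (σ * τ) x = relabelLie σ (relabelLie τ x) := by
  have h : relabelLie (σ * τ) = (relabelLie σ).comp (relabelLie τ) :=
    FreeLieAlgebra.hom_ext (fun i => by
      rw [relabelLie_of, LieHom.comp_apply, relabelLie_of, relabelLie_of]; rfl)
  rw [h]; rfl

theorem IsBracketing.relabel {α : Type} [DecidableEq α] (σ : Equiv.Perm α) {S : Finset α}
    {x : FreeLieAlgebra ℚ α} (h : IsBracketing S x) :
    IsBracketing (S.map σ.toEmbedding) (relabelLie σ x) := by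
  induction h with
  | of i => rw [relabelLie_of, Finset.map_singleton]; exact IsBracketing.of _
  | lie h _ _ ihx ihy =>
    rw [LieHom.map_lie, Finset.map_union]
    exact IsBracketing.lie ((Finset.disjoint_map _).2 h) ihx ihy

theorem relabelLie_mem {n : ℕ} (σ : Equiv.Perm (Fin n)) :
    ∀ x ∈ lieOperad n, (relabelLie σ : FreeLieAlgebra ℚ (Fin n) →ₗ[ℚ] _) x ∈ lieOperad n := by
  intro x hx
  refine (Submodule.span_le (p := (lieOperad n).comap
    (relabelLie σ : FreeLieAlgebra ℚ (Fin n) →ₗ[ℚ] FreeLieAlgebra ℚ (Fin n)))).2 ?_ hx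
  intro y hy
  refine Submodule.subset_span ?_
  have := IsBracketing.relabel σ hy
  rwa [Finset.map_univ_equiv] at this

/-- The action of the symmetric group on `Lie(n)` by permutation of the generators. -/
def lieRep (n : ℕ) : Representation ℚ (Equiv.Perm (Fin n)) (lieOperad n) where
  toFun σ := (relabelLie σ : FreeLieAlgebra ℚ (Fin n) →ₗ[ℚ] _).restrict (relabelLie_mem σ)
  map_one' := by
    ext x
    exact relabelLie_one x.1
  map_mul' σ τ := by
    ext x
    exact relabelLie_mul σ τ x.1

/-- The symmetric function of the operad `Lie`. -/
def Lie : SymFun ℚ := frobeniusSeries lieRep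

/-! ### The pre-Lie operad -/

/-- A rooted tree with vertex set `α`, encoded by its root and by the map which sends every other
vertex to its parent (the next vertex on the path to the root) and fixes the root. -/
@[ext]
structure RootedTree (α : Type) where
  root : α
  parent : α → α
  parent_root : parent root = root
  reaches_root : ∀ x, ∃ k : ℕ, parent^[k] x = root

/-- Relabelling of the vertices of a rooted tree. -/
def RootedTree.relabel {α : Type} (σ : Equiv.Perm α) (T : RootedTree α) : RootedTree α where
  root := σ T.root
  parent x := σ (T.parent (σ.symm x))
  parent_root := by simp [T.parent_root]
  reaches_root x := by
    obtain ⟨k, hk⟩ := T.reaches_root (σ.symm x)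
    refine ⟨k, ?_⟩
    have h : Function.Semiconj σ T.parent (fun x => σ (T.parent (σ.symm x))) := fun y => by simp
    have := (h.iterate_right k) (σ.symm x)
    rw [hk, Equiv.apply_symm_apply] at this
    exact this.symm

instance {α : Type} : MulAction (Equiv.Perm α) (RootedTree α) where
  smul σ T := T.relabel σ
  one_smul _ := rfl
  mul_smul _ _ _ := rfl

/-- The symmetric function of the operad `PreLie`: the Frobenius characteristic of the permutation
representations of the symmetric groups on the rooted trees with vertex set `{1, …, n}`. -/
def PreLie : SymFun ℚ :=
  frobeniusSeries fun n =>
    Representation.ofMulAction ℚ (Equiv.Perm (Fin n)) (RootedTree (Fin n))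

/-! ### Auxiliary facts: existence and uniqueness of the solution of a plethystic equation -/

section FixedPoint

variable {R : Type} [CommRing R]

/-- Two symmetric functions agree in degrees less than `n`. -/
def Agree (n : ℕ) (f g : SymFun R) : Prop := ∀ m, degree m < n → coeff m f = coeff m g

theorem degree_add (a b : ℕ+ →₀ ℕ) : degree (a + b) = degree a + degree b := map_add _ a b

theorem Agree.mul {n : ℕ} {f f' g g' : SymFun R} (hf : Agree n f f') (hg : Agree n g g') :
    Agree n (f * g) (f' * g') := by
  classical
  intro m hm
  rw [coeff_mul, coeff_mul]
  refine Finset.sum_congr rfl fun x hx => ?_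
  have h := degree_add x.1 x.2
  rw [Finset.HasAntidiagonal.mem_antidiagonal.1 hx] at h
  rw [hf _ (by omega), hg _ (by omega)]

theorem Agree.pow {n : ℕ} {f f' : SymFun R} (hf : Agree n f f') (k : ℕ) :
    Agree n (f ^ k) (f' ^ k) := by
  induction k with
  | zero => intro m _; simp
  | succ k ih => rw [pow_succ, pow_succ]; exact ih.mul hf

theorem Agree.prod {n : ℕ} {ι : Type} (s : Finset ι) {f f' : ι → SymFun R}
    (h : ∀ i ∈ s, Agree n (f i) (f' i)) : Agree n (∏ i ∈ s, f i) (∏ i ∈ s, f' i) := by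
  classical
  induction s using Finset.induction_on with
  | empty => intro m _; simp
  | insert a s ha ih =>
    rw [Finset.prod_insert ha, Finset.prod_insert ha]
    exact (h a (Finset.mem_insert_self _ _)).mul
      (ih fun i hi => h i (Finset.mem_insert_of_mem hi))

theorem degree_mapDomain (k : ℕ+) (y : ℕ+ →₀ ℕ) :
    degree (y.mapDomain (mulLeftEmbedding k)) = k * degree y := by
  simp only [degree, Finsupp.weight_apply]
  rw [Finsupp.sum_mapDomain_index (by simp) (by intros; simp [add_mul]), Finsupp.mul_sum]
  refine Finsupp.sum_congr fun i _ => ?_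
  simp [mulLeftEmbedding]
  ring

theorem Agree.adams (ψ : ℕ+ → R →+* R) {n : ℕ} {g g' : SymFun R} (h : Agree n g g') (k : ℕ+) :
    Agree n (adams ψ k g) (adams ψ k g') := by
  intro m hm
  unfold PreLieHAL.adams
  rw [coeff_rename, coeff_rename]
  refine Finset.sum_congr rfl fun y hy => ?_
  have hy' : y.mapDomain (mulLeftEmbedding k) = m := by simpa using hy
  have h1 := degree_mapDomain k y
  rw [hy'] at h1
  have h2 : degree y < n :=
    lt_of_le_of_lt (h1 ▸ Nat.le_mul_of_pos_left _ k.pos) hm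
  rw [coeff_map, coeff_map, h y h2]

theorem constantCoeff_adams (ψ : ℕ+ → R →+* R) (k : ℕ+) {g : SymFun R}
    (hg : constantCoeff g = 0) : constantCoeff (adams ψ k g) = 0 := by
  unfold adams
  rw [constantCoeff_rename, constantCoeff_map, hg, map_zero]

theorem hasSubst_adams (ψ : ℕ+ → R →+* R) {g : SymFun R} (hg : constantCoeff g = 0) :
    HasSubst (fun k => adams ψ k g) where
  const_coeff k := by rw [constantCoeff_adams ψ k hg]; exact IsNilpotent.zero
  coeff_zero d := by
    refine (Set.finite_Iic (Nat.succPNat (degree d))).subset fun k hk => ?_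
    rw [Set.mem_Iic, ← PNat.coe_le_coe]
    by_contra hlt
    rw [not_le, Nat.succPNat_coe] at hlt
    apply hk
    unfold adams
    rw [coeff_rename]
    refine Finset.sum_eq_zero fun y hy => ?_
    have hy' : y.mapDomain (mulLeftEmbedding k) = d := by simpa using hy
    have h1 := degree_mapDomain k y
    rw [hy'] at h1
    have h0 : degree y = 0 := by
      by_contra h0
      have := Nat.le_mul_of_pos_right (k : ℕ) (Nat.pos_of_ne_zero h0)
      omega
    have hz : y = 0 := by
      ext i
      have := Finsupp.le_weight (fun k : ℕ+ => (k : ℕ)) (s := i) i.pos.ne' y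
      simp only [degree] at h0
      simp; omega
    rw [hz, coeff_map, coeff_zero_eq_constantCoeff_apply, hg, map_zero]

theorem Agree.plethysmWith (ψ : ℕ+ → R →+* R) (f : SymFun R) {n : ℕ} {g g' : SymFun R}
    (hg : constantCoeff g = 0) (hg' : constantCoeff g' = 0) (h : Agree n g g') :
    Agree n (plethysmWith ψ f g) (plethysmWith ψ f g') := by
  intro m hm
  unfold PreLieHAL.plethysmWith
  rw [coeff_subst (hasSubst_adams ψ hg), coeff_subst (hasSubst_adams ψ hg')]
  refine finsum_congr fun d => ?_
  rw [Finsupp.prod, Finsupp.prod,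
    Agree.prod d.support (fun i _ => (h.adams ψ i).pow (d i)) m hm]

theorem constantCoeff_plethysmWith (ψ : ℕ+ → R →+* R) {f g : SymFun R}
    (hf : constantCoeff f = 0) (hg : constantCoeff g = 0) :
    constantCoeff (plethysmWith ψ f g) = 0 :=
  constantCoeff_subst_eq_zero (hasSubst_adams ψ hg) (fun k => constantCoeff_adams ψ k hg) hf

theorem Agree.p_mul {n : ℕ} {f g : SymFun R} (h : Agree n f g) :
    Agree (n + 1) (p 1 * f) (p 1 * g) := by
  classical
  intro m hm
  rw [coeff_mul, coeff_mul]
  refine Finset.sum_congr rfl fun x hx => ?_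
  by_cases h1 : x.1 = Finsupp.single 1 1
  · have h2 := degree_add x.1 x.2
    rw [Finset.HasAntidiagonal.mem_antidiagonal.1 hx, h1] at h2
    have h3 : degree (Finsupp.single 1 1) = 1 := by simp [degree, Finsupp.weight_single]
    rw [h _ (by omega)]
  · rw [coeff_X, if_neg h1, zero_mul, zero_mul]

/-- A map that commutes with truncation and raises the order of agreement has a unique fixed
point. -/
theorem existsUnique_fixedPoint (Φ : SymFun R → SymFun R)
    (h0 : ∀ H, constantCoeff H = 0 → constantCoeff (Φ H) = 0)
    (hΦ : ∀ n H H', constantCoeff H = 0 → constantCoeff H' = 0 → Agree n H H' →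
      Agree (n + 1) (Φ H) (Φ H')) :
    ∃! H : SymFun R, constantCoeff H = 0 ∧ H = Φ H := by
  have hc : ∀ n, constantCoeff (Φ^[n] 0) = 0 := by
    intro n
    induction n with
    | zero => simp
    | succ n ih => rw [Function.iterate_succ_apply']; exact h0 _ ih
  have hstep : ∀ n, Agree n (Φ^[n] 0) (Φ^[n + 1] 0) := by
    intro n
    induction n with
    | zero => intro m hm; omega
    | succ n ih =>
      rw [Function.iterate_succ_apply', Function.iterate_succ_apply']
      exact hΦ n _ _ (hc n) (hc (n + 1)) ih
  have hmono : ∀ n k, Agree n (Φ^[n] 0) (Φ^[n + k] 0) := by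
    intro n k
    induction k with
    | zero => intro m _; rfl
    | succ k ih =>
      intro m hm
      rw [ih m hm]
      exact hstep (n + k) m (by omega)
  set L : SymFun R := fun m => coeff m (Φ^[degree m + 1] 0) with hL
  have hLa : ∀ n, Agree n L (Φ^[n] 0) := by
    intro n m hm
    obtain ⟨k, rfl⟩ := Nat.exists_eq_add_of_le (Nat.succ_le_of_lt hm)
    exact hmono (degree m + 1) k m (Nat.lt_succ_self _)
  have hL0 : constantCoeff L = 0 := by
    rw [← coeff_zero_eq_constantCoeff_apply, hLa 1 0 (by simp [degree]),
      coeff_zero_eq_constantCoeff_apply, hc]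
  refine ⟨L, ⟨hL0, ?_⟩, ?_⟩
  · ext m
    have h1 := hΦ (degree m) L _ hL0 (hc _) (hLa (degree m)) m (Nat.lt_succ_self _)
    rw [← Function.iterate_succ_apply' Φ] at h1
    rw [h1]
    exact hLa (degree m + 1) m (Nat.lt_succ_self _)
  · rintro H ⟨hH0, hH⟩
    have key : ∀ n, Agree n H L := by
      intro n m hm
      rw [hLa n m hm]
      revert m
      induction n with
      | zero => intro m hm; omega
      | succ n ih =>
        intro m hm
        rw [hH, Function.iterate_succ_apply']
        exact hΦ n _ _ hH0 (hc n) ih m hm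
    ext m
    exact key (degree m + 1) m (Nat.lt_succ_self _)

theorem existsUnique_plethystic (ψ : ℕ+ → R →+* R) (f g c : SymFun R) (hg : constantCoeff g = 0) :
    ∃! H : SymFun R, constantCoeff H = 0 ∧
      H = p 1 * plethysmWith ψ f (plethysmWith ψ g (p 1 - c * H)) := by
  have hs : ∀ H : SymFun R, constantCoeff H = 0 → constantCoeff (p 1 - c * H) = 0 := by
    intro H hH
    rw [map_sub, map_mul, hH, mul_zero, constantCoeff_X, sub_zero]
  refine existsUnique_fixedPoint
    (fun H => p 1 * plethysmWith ψ f (plethysmWith ψ g (p 1 - c * H))) ?_ ?_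
  · intro H _
    rw [map_mul, constantCoeff_X, zero_mul]
  · intro n H H' hH hH' h
    refine Agree.p_mul (Agree.plethysmWith ψ f (constantCoeff_plethysmWith ψ hg (hs H hH))
      (constantCoeff_plethysmWith ψ hg (hs H' hH'))
      (Agree.plethysmWith ψ g (hs H hH) (hs H' hH') ?_))
    intro m hm
    have h1 : Agree n (c * H) (c * H') := Agree.mul (fun _ _ => rfl) h
    rw [map_sub, map_sub, h1 m hm]

end FixedPoint

theorem constantCoeff_powerSumSeries : constantCoeff powerSumSeries = 0 := by
  rw [← coeff_zero_eq_constantCoeff_apply]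
  change (∑ᶠ k : ℕ+, coeff 0 (((k : ℚ)⁻¹) • (p k : SymFun ℚ))) = 0
  rw [finsum_congr (g := fun _ => 0), finsum_zero]
  intro k
  rw [coeff_smul, coeff_zero_X, mul_zero]

theorem constantCoeff_Comm : constantCoeff Comm = 0 := by
  have hs : PowerSeries.HasSubst powerSumSeries :=
    PowerSeries.HasSubst.of_constantCoeff_zero constantCoeff_powerSumSeries
  have h : Comm = (PowerSeries.exp ℚ - 1).subst powerSumSeries := by
    have h1 : (1 : PowerSeries ℚ).subst powerSumSeries = (1 : SymFun ℚ) := by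
      rw [← PowerSeries.coe_substAlgHom hs, map_one]
    rw [PowerSeries.subst_sub hs, h1, Comm]
  rw [h]
  exact PowerSeries.constantCoeff_subst_eq_zero constantCoeff_powerSumSeries _ (by simp)

/-! ### The symmetric functions `HAL` -/

theorem existsUnique_HALpa : ∃! H : SymFun (Polynomial ℚ), constantCoeff H = 0 ∧
    H = p 1 * plethysmT (suspensionT Assoc) (plethysmT (extend Comm) (p 1 - t * H)) :=
  existsUnique_plethystic _ _ _ _ (by
    rw [extend, constantCoeff_map, constantCoeff_Comm, map_zero])

/-- `HAL^{pa}`, the unique solution without constant term of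
`HAL^{pa} = p₁ · ([Σ_t Assoc] ∘ Comm ∘ [p₁ - t HAL^{pa}])`. -/
def HALpa : SymFun (Polynomial ℚ) := existsUnique_HALpa.choose

/-- `HAL^p = p₁ · ([Σ_t Lie] ∘ Comm ∘ [p₁ - t HAL^{pa}])`. -/
def HALp : SymFun (Polynomial ℚ) :=
  p 1 * plethysmT (suspensionT Lie) (plethysmT (extend Comm) (p 1 - t * HALpa))

/-- `HAL^a = [Comm - p₁] ∘ [p₁ - t HAL^{pa}]`. -/
def HALa : SymFun (Polynomial ℚ) :=
  plethysmT (extend Comm - p 1) (p 1 - t * HALpa)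

/-- `HAL = HAL^p + HAL^a - HAL^{pa}`. -/
def HAL : SymFun (Polynomial ℚ) := HALp + HALa - HALpa

/-- The specialization of `HAL` at `t = 1`. -/
def HALbar : SymFun ℚ := atOne HAL

end

end PreLieHAL

open PreLieHAL

/-! ### Plethysm over `ℚ`, the Euler derivation and the plethystic exponential. -/

namespace PreLieHAL
open MvPowerSeries
noncomputable section

/-! Write `E(g) = 1 + Comm ∘ g = exp(∑ (p_k ∘ g) / k)` (`plethysticExp`). The theorem is formal
algebra from two facts: `PreLie = p_1 E(PreLie)`, since a rooted tree is a root carrying a set of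
rooted trees (`PreLie_eq_p_mul_plethysticExp`), and `Comm ∘ Σ Lie = p_1`
(`plethysm_Comm_suspension_Lie_eq_p_one`).

Formal part. As `E(Σ g)` is the inverse of `E(g)` with signs on the variables, `P = Σ PreLie`
satisfies `P E(P) = p_1`. Since `Σ Assoc = p_1 / (1 + p_1)`, this says that `p_1 - P` solves the
equation of `HAL^{pa}` at `t = 1`, and uniqueness identifies the two. As `Σ Lie` is inverse to
`Comm`, the specialized `HAL` is `p_1 P + Comm ∘ P - p_1` (`HALbar_eq`). The identity then follows
by differentiating `P E(P) = p_1` in `p_1`, because `∂ E(P) = E(P) ∂ P`. The characterization of `G`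
holds because `Comm` and `Σ Lie` are mutually inverse and `Σ` respects plethysm.

Both facts are proved with cycle index series and in logarithmic form: the Euler derivation sends
`E(g)` to `E(g) ∑ p_k ∘ (euler g)`, so it is enough to count structures with a marked point
(`eq_plethysticExp`). The plethysm by `p_d` is modelled by colourings in `ℤ/d` that `σ` shifts by
one (`cycleIndex_adFun`). For a forest fixed by `σ`, a marked vertex selects the `σ`-orbit of its
tree, that is, `d` copies of one tree (`card_mul_forestFun`, `card_mul_orbitForestFun`).

For `Lie`, a marked letter selects its orbit `κ`. Lazard elimination writes the multilinear part on
`κ ⊕ β` as that on `κ` tensored with the ways of distributing `β` into lists attached to the letters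
of `κ` (`elimTensor_bijective`). Taking traces gives `euler Lie = ∑ c_d p_d / (1 - p_d)`. The
multilinear part has no invariants for two or more letters, because a bracketing changes sign when
the letters of an innermost bracket are exchanged; hence `∑_{d ∣ n} c_d` vanishes for `n > 1`
(`sum_cycleCoeff`), so `∑ p_k ∘ (euler Lie)` collapses to `p_1 / (1 - p_1)`, and suspending gives
the logarithmic derivative of `1 + p_1`. -/

/-- The ring endomorphism `g ↦ p_k ∘ g` over `ℚ`. -/
abbrev psi (k : ℕ+) : SymFun ℚ →ₐ[ℚ] SymFun ℚ := rename (mulLeftEmbedding k)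

theorem adams_id (k : ℕ+) (g : SymFun ℚ) : adams (fun _ => RingHom.id ℚ) k g = psi k g := by
  simp [adams, map_id]

theorem plethysm_eq (f g : SymFun ℚ) : plethysm f g = subst (fun k => psi k g) f := by
  simp only [plethysm, plethysmWith, adams_id]

theorem hasSubst_psi {g : SymFun ℚ} (hg : constantCoeff g = 0) :
    HasSubst (fun k => psi k g) := by
  simpa only [adams_id] using hasSubst_adams (fun _ => RingHom.id ℚ) hg

/-- The Euler derivation, multiplying every homogeneous component by its degree. -/
def euler : Derivation ℚ (SymFun ℚ) (SymFun ℚ) :=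
  Derivation.mk'
    { toFun := fun f m => (degree m : ℚ) * coeff m f
      map_add' := fun f g => by
        funext m; exact (by rw [map_add, mul_add] : (degree m : ℚ) * coeff m (f + g) = _)
      map_smul' := fun r f => by
        funext m
        exact (by rw [coeff_smul]; ring : (degree m : ℚ) * coeff m (r • f) = r * (degree m * coeff m f)) }
    (fun f g => by
      classical
      ext m
      change (degree m : ℚ) * coeff m (f * g) = coeff m (f * _ + g * _)
      rw [mul_comm g, map_add, coeff_mul, coeff_mul, coeff_mul, ← Finset.sum_add_distrib,
        Finset.mul_sum]
      refine Finset.sum_congr rfl fun x hx => ?_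
      rw [← Finset.HasAntidiagonal.mem_antidiagonal.1 hx, degree_add]
      change _ = coeff x.1 f * (degree x.2 * coeff x.2 g) + (degree x.1 * coeff x.1 f) * coeff x.2 g
      push_cast
      ring)

theorem coeff_euler (m : ℕ+ →₀ ℕ) (f : SymFun ℚ) :
    coeff m (euler f) = degree m * coeff m f := rfl

theorem degree_eq_zero {m : ℕ+ →₀ ℕ} (h : degree m = 0) : m = 0 := by
  ext i
  have := Finsupp.le_weight (fun k : ℕ+ => (k : ℕ)) (s := i) i.pos.ne' m
  simp only [degree] at h
  simp; omega

theorem constantCoeff_euler (f : SymFun ℚ) : constantCoeff (euler f) = 0 := by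
  rw [← coeff_zero_eq_constantCoeff_apply, coeff_euler]
  simp [degree]

theorem euler_p (k : ℕ+) : euler (p k) = (k : ℚ) • p k := by
  classical
  ext m
  rw [coeff_euler, coeff_smul, coeff_X]
  split_ifs with h
  · subst h; simp [degree, Finsupp.weight_single]
  · simp

theorem euler_psi (k : ℕ+) (f : SymFun ℚ) : euler (psi k f) = (k : ℚ) • psi k (euler f) := by
  ext m
  rw [coeff_euler, coeff_smul, coeff_rename, coeff_rename, Finset.mul_sum, Finset.mul_sum]
  refine Finset.sum_congr rfl fun y hy => ?_
  have hy' : y.mapDomain (mulLeftEmbedding k) = m := by simpa using hy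
  rw [← hy', degree_mapDomain, coeff_euler]
  push_cast
  ring

/-- A derivation which commutes with truncation up to a shift by one. -/
def TruncCompat (δ : Derivation ℚ (SymFun ℚ) (SymFun ℚ)) : Prop :=
  ∀ n f g, Agree (n + 1) f g → Agree n (δ f) (δ g)

theorem truncCompat_euler : TruncCompat euler := by
  intro n f g h m hm
  rw [coeff_euler, coeff_euler, h m (by omega)]

theorem truncCompat_pderiv : TruncCompat (pderiv ℚ (1 : ℕ+)) := by
  intro n f g h m hm
  rw [coeff_pderiv, coeff_pderiv, h]
  rw [degree_add]
  have : degree (Finsupp.single 1 1) = 1 := by simp [degree, Finsupp.weight_single]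
  omega

theorem coeff_pow_eq_zero {h : SymFun ℚ} (h0 : constantCoeff h = 0) {d : ℕ} {m : ℕ+ →₀ ℕ}
    (hm : degree m < d) : coeff m (h ^ d) = 0 := by
  apply coeff_of_lt_order
  refine lt_of_lt_of_le ?_ (le_order_pow_of_constantCoeff_eq_zero d h0)
  refine lt_of_le_of_lt ?_ (Nat.cast_lt.2 hm)
  rw [Nat.cast_le]
  rw [degree, Finsupp.weight_apply, Finsupp.degree]
  exact Finset.sum_le_sum fun i _ => Nat.le_mul_of_pos_right _ i.pos

/-- As `h` has no constant term, `h ^ d` starts in degree at least `d`, so the powers that are cut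
off do not reach degrees below `n`. -/
theorem agree_subst_trunc (f : PowerSeries ℚ) {h : SymFun ℚ} (h0 : constantCoeff h = 0) (n : ℕ) :
    Agree n (f.subst h) (Polynomial.aeval h (PowerSeries.trunc n f)) := by
  intro m hm
  have hs : PowerSeries.HasSubst h := PowerSeries.HasSubst.of_constantCoeff_zero h0
  rw [← PowerSeries.subst_coe hs, PowerSeries.coeff_subst hs, PowerSeries.coeff_subst hs]
  refine finsum_congr fun d => ?_
  rw [Polynomial.coeff_coe, PowerSeries.coeff_trunc]
  split_ifs with hd
  · rfl
  · rw [coeff_pow_eq_zero h0 (by omega), smul_zero, smul_zero]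

/-- The chain rule holds for polynomials and every derivation; truncation compatibility carries it
over to power series. -/
theorem derivation_subst {δ : Derivation ℚ (SymFun ℚ) (SymFun ℚ)} (hδ : TruncCompat δ)
    (f : PowerSeries ℚ) {h : SymFun ℚ} (h0 : constantCoeff h = 0) :
    δ (f.subst h) = (PowerSeries.derivative ℚ f).subst h * δ h := by
  ext m
  -- The order is the degree of `m` plus two: one unit is lost by applying `δ`, and equally by
  -- differentiating the truncation, and one is needed because `Agree` is strict.
  have h1 := hδ _ _ _ (agree_subst_trunc f h0 (degree m + 1 + 1)) m (by omega)
  have h2 := Derivation.comp_aeval_eq (a := h) δ (PowerSeries.trunc (degree m + 1 + 1) f)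
  rw [h1, h2, smul_eq_mul, ← PowerSeries.trunc_derivative]
  exact ((agree_subst_trunc _ h0 (degree m + 1)).mul (fun _ _ => rfl) m (by omega)).symm

/-- Two series with the same constant term and the same logarithmic Euler derivative agree. -/
theorem eq_of_euler_eq_mul {E E' H : SymFun ℚ} (hH : constantCoeff H = 0)
    (hE : euler E = E * H) (hE' : euler E' = E' * H)
    (h0 : constantCoeff E = constantCoeff E') : E = E' := by
  classical
  have key : ∀ n, Agree n E E' := by
    intro n
    induction n with
    | zero => intro m hm; omega
    | succ n ih =>
      intro m hm
      rcases Nat.eq_zero_or_pos (degree m) with hd | hd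
      · rw [degree_eq_zero hd]; simpa using h0
      -- Since `H` has no constant term, these coefficients only involve coefficients of `E` and
      -- `E'` in smaller degree.
      have h1 : coeff m (E * H) = coeff m (E' * H) := by
        rw [coeff_mul, coeff_mul]
        refine Finset.sum_congr rfl fun x hx => ?_
        have h3 := degree_add x.1 x.2
        rw [Finset.HasAntidiagonal.mem_antidiagonal.1 hx] at h3
        rcases Nat.eq_zero_or_pos (degree x.2) with h2 | h2
        · rw [degree_eq_zero h2, coeff_zero_eq_constantCoeff_apply, hH, mul_zero, mul_zero]
        · rw [ih x.1 (by omega)]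
      rw [← hE, ← hE', coeff_euler, coeff_euler] at h1
      exact mul_left_cancel₀ (Nat.cast_ne_zero.2 hd.ne') h1
  ext m
  exact key _ m (Nat.lt_succ_self _)

theorem eq_of_euler_eq {f g : SymFun ℚ} (h : euler f = euler g)
    (h0 : constantCoeff f = constantCoeff g) : f = g := by
  ext m
  rcases Nat.eq_zero_or_pos (degree m) with hd | hd
  · rw [degree_eq_zero hd]; simpa using h0
  · have h1 := congrArg (coeff m) h
    rw [coeff_euler, coeff_euler] at h1
    exact mul_left_cancel₀ (Nat.cast_ne_zero.2 hd.ne') h1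

/-- The infinite sum `∑_{k ≥ 1} p_k ∘ f`. -/
def psiSum (f : SymFun ℚ) : SymFun ℚ := fun m => ∑ᶠ k : ℕ+, coeff m (psi k f)

theorem coeff_psiSum (f : SymFun ℚ) (m : ℕ+ →₀ ℕ) :
    coeff m (psiSum f) = ∑ᶠ k : ℕ+, coeff m (psi k f) := rfl

theorem constantCoeff_psiSum {f : SymFun ℚ} (hf : constantCoeff f = 0) :
    constantCoeff (psiSum f) = 0 := by
  rw [← coeff_zero_eq_constantCoeff_apply, coeff_psiSum]
  simp [constantCoeff_rename, hf]

theorem coeff_powerSumSeries (m : ℕ+ →₀ ℕ) :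
    coeff m powerSumSeries = ∑ᶠ k : ℕ+, coeff m (((k : ℚ)⁻¹) • (p k : SymFun ℚ)) := rfl

theorem coeff_powerSumSeries_single (k : ℕ+) :
    coeff (Finsupp.single k 1) powerSumSeries = (k : ℚ)⁻¹ := by
  classical
  rw [coeff_powerSumSeries, finsum_eq_single _ k]
  · simp
  · intro j hj
    rw [coeff_smul, coeff_X, if_neg, mul_zero]
    intro h
    exact hj ((Finsupp.single_left_inj one_ne_zero).1 h).symm

theorem coeff_powerSumSeries_of_ne {m : ℕ+ →₀ ℕ} (h : ∀ k, m ≠ Finsupp.single k 1) :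
    coeff m powerSumSeries = 0 := by
  classical
  rw [coeff_powerSumSeries, ← finsum_zero (α := ℕ+)]
  refine finsum_congr fun k => ?_
  rw [coeff_smul, coeff_X, if_neg (h k), mul_zero]

/-- The sum `∑_{k ≥ 1} (p_k ∘ g) / k`. -/
def logPlethysm (g : SymFun ℚ) : SymFun ℚ := subst (fun k => psi k g) powerSumSeries

theorem coeff_logPlethysm {g : SymFun ℚ} (hg : constantCoeff g = 0) (m : ℕ+ →₀ ℕ) :
    coeff m (logPlethysm g) = ∑ᶠ k : ℕ+, (k : ℚ)⁻¹ * coeff m (psi k g) := by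
  classical
  rw [logPlethysm, coeff_subst (hasSubst_psi hg)]
  have hinj : Function.Injective (fun k : ℕ+ => Finsupp.single k (1 : ℕ)) :=
    fun a b h => (Finsupp.single_left_inj one_ne_zero).1 h
  -- `powerSumSeries` is supported on the exponents `single k 1`, so the sum over monomials becomes
  -- a sum over `k`.
  have h := finsum_mem_range (f := fun d => coeff d powerSumSeries •
    coeff m (d.prod fun s e => psi s g ^ e)) hinj
  rw [finsum_mem_def] at h
  rw [show (∑ᶠ k : ℕ+, (k : ℚ)⁻¹ * coeff m (psi k g)) = ∑ᶠ k : ℕ+,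
    coeff (Finsupp.single k 1) powerSumSeries •
    coeff m ((Finsupp.single k 1).prod fun s e => psi s g ^ e) from finsum_congr fun k => by
      rw [coeff_powerSumSeries_single, Finsupp.prod_single_index (h := fun s e => psi s g ^ e) (pow_zero _), pow_one, smul_eq_mul],
    ← h]
  refine finsum_congr fun d => ?_
  by_cases hd : d ∈ Set.range (fun k : ℕ+ => Finsupp.single k (1 : ℕ))
  · rw [Set.indicator_of_mem hd]
  · rw [Set.indicator_of_notMem hd, coeff_powerSumSeries_of_ne, zero_smul]
    exact fun k hk => hd ⟨k, hk.symm⟩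

theorem constantCoeff_logPlethysm {g : SymFun ℚ} (hg : constantCoeff g = 0) :
    constantCoeff (logPlethysm g) = 0 := by
  rw [← coeff_zero_eq_constantCoeff_apply, coeff_logPlethysm hg]
  simp [constantCoeff_rename, hg]

/-- The factor `k` coming from `euler_psi` cancels the denominator `k`. -/
theorem euler_logPlethysm {g : SymFun ℚ} (hg : constantCoeff g = 0) :
    euler (logPlethysm g) = psiSum (euler g) := by
  ext m
  rw [coeff_euler, coeff_logPlethysm hg, coeff_psiSum, ← smul_eq_mul, smul_finsum]
  refine finsum_congr fun k => ?_
  have h := congrArg (coeff m) (euler_psi k g)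
  rw [coeff_euler, coeff_smul] at h
  rw [smul_eq_mul, mul_left_comm, h, ← mul_assoc, inv_mul_cancel₀ (Nat.cast_ne_zero.2 k.pos.ne'),
    one_mul]

/-- The plethystic exponential. -/
def plethysticExp (g : SymFun ℚ) : SymFun ℚ := (PowerSeries.exp ℚ).subst (logPlethysm g)

theorem one_add_plethysm_Comm {g : SymFun ℚ} (hg : constantCoeff g = 0) :
    1 + plethysm Comm g = plethysticExp g := by
  have hs : PowerSeries.HasSubst powerSumSeries :=
    PowerSeries.HasSubst.of_constantCoeff_zero constantCoeff_powerSumSeries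
  rw [plethysm_eq, Comm, subst_sub (hasSubst_psi hg), ← coe_substAlgHom (hasSubst_psi hg), map_one,
    coe_substAlgHom, plethysticExp, PowerSeries.subst, PowerSeries.subst,
    subst_comp_subst_apply hs.const (hasSubst_psi hg)]
  simp [logPlethysm]

theorem constantCoeff_plethysticExp {g : SymFun ℚ} (hg : constantCoeff g = 0) :
    constantCoeff (plethysticExp g) = 1 := by
  have h := constantCoeff_plethysmWith (fun _ => RingHom.id ℚ) constantCoeff_Comm hg
  rw [← one_add_plethysm_Comm hg, map_add, map_one, plethysm, h, add_zero]

theorem derivation_plethysticExp {δ : Derivation ℚ (SymFun ℚ) (SymFun ℚ)} (hδ : TruncCompat δ)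
    {g : SymFun ℚ} (hg : constantCoeff g = 0) :
    δ (plethysticExp g) = plethysticExp g * δ (logPlethysm g) := by
  rw [plethysticExp, derivation_subst hδ _ (constantCoeff_logPlethysm hg),
    PowerSeries.derivative_exp]

theorem euler_plethysticExp {g : SymFun ℚ} (hg : constantCoeff g = 0) :
    euler (plethysticExp g) = plethysticExp g * psiSum (euler g) := by
  rw [derivation_plethysticExp truncCompat_euler hg, euler_logPlethysm hg]

/-- Recognizes a plethystic exponential by its logarithmic Euler derivative, which is free of
denominators and counts structures with a marked point. It serves for the forest series and for `1 +
p 1`. -/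
theorem eq_plethysticExp {E g : SymFun ℚ} (hg : constantCoeff g = 0) (h0 : constantCoeff E = 1)
    (hE : euler E = E * psiSum (euler g)) : E = plethysticExp g :=
  eq_of_euler_eq_mul (constantCoeff_psiSum (constantCoeff_euler g)) hE (euler_plethysticExp hg)
    (by rw [h0, constantCoeff_plethysticExp hg])

theorem finite_support_coeff_psi {f : SymFun ℚ} (hf : constantCoeff f = 0) (m : ℕ+ →₀ ℕ) :
    (Function.support fun k : ℕ+ => coeff m (psi k f)).Finite :=
  (hasSubst_psi hf).coeff_zero m

theorem psi_one (f : SymFun ℚ) : psi 1 f = f := by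
  have : (mulLeftEmbedding (1 : ℕ+) : ℕ+ → ℕ+) = id := by funext i; simp [mulLeftEmbedding]
  simp [psi, this]

/-- The system is triangular: the term `k = 1` is the series itself, and in positive degree the
terms with `k ≥ 2` only involve coefficients of strictly smaller degree. -/
theorem psiSum_injective {f g : SymFun ℚ} (hf : constantCoeff f = 0) (hg : constantCoeff g = 0)
    (h : psiSum f = psiSum g) : f = g := by
  have key : ∀ n, Agree n f g := by
    intro n
    induction n with
    | zero => intro m hm; omega
    | succ n ih =>
      intro m hm
      rcases Nat.eq_zero_or_pos (degree m) with hd | hd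
      · rw [degree_eq_zero hd]; simp [hf, hg]
      have h1 := congrArg (coeff m) h
      rw [coeff_psiSum, coeff_psiSum, ← sub_eq_zero,
        ← finsum_sub_distrib (finite_support_coeff_psi hf m) (finite_support_coeff_psi hg m),
        finsum_eq_single _ 1, psi_one, psi_one, sub_eq_zero] at h1
      · exact h1
      · intro k hk
        rw [sub_eq_zero, coeff_rename, coeff_rename]
        refine Finset.sum_congr rfl fun y hy => ih y ?_
        have hy' : y.mapDomain (mulLeftEmbedding k) = m := by simpa using hy
        have h2 := degree_mapDomain k y
        rw [hy'] at h2
        have h3 : 2 ≤ (k : ℕ) := by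
          have h4 : (k : ℕ) ≠ 1 := fun h => hk (PNat.coe_injective h)
          have := k.pos
          omega
        nlinarith
  ext m
  exact key _ m (Nat.lt_succ_self _)

theorem plethysticExp_injective {g g' : SymFun ℚ} (hg : constantCoeff g = 0)
    (hg' : constantCoeff g' = 0) (h : plethysticExp g = plethysticExp g') : g = g' := by
  have h1 := euler_plethysticExp hg
  rw [h, euler_plethysticExp hg'] at h1
  have h2 : plethysticExp g' ≠ 0 := fun h0 => by
    have := constantCoeff_plethysticExp hg'
    rw [h0, map_zero] at this
    exact zero_ne_one this
  refine eq_of_euler_eq ?_ (hg.trans hg'.symm)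
  exact (psiSum_injective (constantCoeff_euler _) (constantCoeff_euler _)
    (mul_left_cancel₀ h2 h1)).symm

theorem plethysm_Comm_injective {g g' : SymFun ℚ} (hg : constantCoeff g = 0)
    (hg' : constantCoeff g' = 0) (h : plethysm Comm g = plethysm Comm g') : g = g' :=
  plethysticExp_injective hg hg' (by
    rw [← one_add_plethysm_Comm hg, ← one_add_plethysm_Comm hg', h])

theorem constantCoeff_plethysm {f g : SymFun ℚ} (hf : constantCoeff f = 0)
    (hg : constantCoeff g = 0) : constantCoeff (plethysm f g) = 0 :=
  constantCoeff_plethysmWith _ hf hg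

theorem psi_psi (j k : ℕ+) (f : SymFun ℚ) : psi j (psi k f) = psi (j * k) f := by
  rw [psi, psi, rename_rename]
  have : (mulLeftEmbedding j : ℕ+ → ℕ+) ∘ mulLeftEmbedding k = mulLeftEmbedding (j * k) := by
    funext i; simp [mulLeftEmbedding, mul_assoc]
  simp [this]

theorem psi_plethysm (k : ℕ+) (f g : SymFun ℚ) (hg : constantCoeff g = 0) :
    psi k (plethysm f g) = plethysm (psi k f) g := by
  rw [plethysm_eq, plethysm_eq, psi, rename_eq_subst, rename_eq_subst,
    subst_comp_subst_apply (hasSubst_psi hg) (HasSubst.X_comp _),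
    subst_comp_subst_apply (HasSubst.X_comp _) (hasSubst_psi hg)]
  congr 1
  funext j
  rw [← rename_eq_subst, Function.comp_apply, subst_X (hasSubst_psi hg)]
  exact psi_psi k j g

theorem plethysm_assoc (f : SymFun ℚ) {g h : SymFun ℚ} (hg : constantCoeff g = 0)
    (hh : constantCoeff h = 0) : plethysm f (plethysm g h) = plethysm (plethysm f g) h := by
  rw [plethysm_eq f (plethysm g h), plethysm_eq (plethysm f g), plethysm_eq f g,
    subst_comp_subst_apply (hasSubst_psi hg) (hasSubst_psi hh)]
  congr 1
  funext k
  rw [psi_plethysm k g h hh, plethysm_eq]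

theorem plethysm_p_one {h : SymFun ℚ} (hh : constantCoeff h = 0) : plethysm (p 1) h = h := by
  rw [plethysm_eq, subst_X (hasSubst_psi hh), psi_one]

end
end PreLieHAL

/-! ### Suspension, and reduction of the theorem to the plethystic equations of `Lie` and `PreLie`.
-/

namespace PreLieHAL
open MvPowerSeries
noncomputable section

/-- The substitution `p_k ↦ -p_k`. -/
abbrev negVars : SymFun ℚ →ₐ[ℚ] SymFun ℚ := rescaleAlgHom (fun _ => (-1 : ℚ))

theorem suspension_eq (f : SymFun ℚ) : suspension f = -negVars f := by
  rw [suspension, rescaleAlgHom_apply]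

theorem coeff_negVars (m : ℕ+ →₀ ℕ) (f : SymFun ℚ) :
    coeff m (negVars f) = (m.prod fun _ k => (-1 : ℚ) ^ k) * coeff m f := by
  rw [rescaleAlgHom_apply, coeff_rescale]

/-- The sign of a monomial depends only on its number of factors, which relabelling the `p_j`
preserves. -/
theorem negVars_psi (k : ℕ+) (f : SymFun ℚ) : negVars (psi k f) = psi k (negVars f) := by
  ext m
  rw [coeff_negVars, coeff_rename, coeff_rename, Finset.mul_sum]
  refine Finset.sum_congr rfl fun y hy => ?_
  have hy' : y.mapDomain (mulLeftEmbedding k) = m := by simpa using hy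
  rw [coeff_negVars, ← hy', Finsupp.prod_mapDomain_index (by simp) (by intros; rw [pow_add])]

theorem negVars_p (k : ℕ+) : negVars (p k) = -p k := by
  classical
  ext m
  rw [coeff_negVars, map_neg, coeff_X]
  split_ifs with h
  · subst h; simp
  · simp

theorem negVars_euler (f : SymFun ℚ) : negVars (euler f) = euler (negVars f) := by
  ext m
  rw [coeff_negVars, coeff_euler, coeff_euler, coeff_negVars]
  ring

theorem constantCoeff_negVars (f : SymFun ℚ) :
    constantCoeff (negVars f) = constantCoeff f := by
  rw [← coeff_zero_eq_constantCoeff_apply, coeff_negVars]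
  simp

theorem constantCoeff_suspension {f : SymFun ℚ} (hf : constantCoeff f = 0) :
    constantCoeff (suspension f) = 0 := by
  rw [suspension_eq, map_neg, constantCoeff_negVars, hf, neg_zero]

theorem negVars_negVars (f : SymFun ℚ) : negVars (negVars f) = f := by
  ext m
  rw [coeff_negVars, coeff_negVars, ← mul_assoc, ← Finsupp.prod_mul]
  simp [← mul_pow]

theorem suspension_injective : Function.Injective suspension := by
  intro f g h
  rw [suspension_eq, suspension_eq, neg_inj] at h
  rw [← negVars_negVars f, h, negVars_negVars]

/-- The sign put on `p_k` in `suspension f` cancels the one in front of `suspension g`; what remains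
is that `negVars` commutes with every `psi k`. -/
theorem suspension_plethysm (f : SymFun ℚ) {g : SymFun ℚ} (hg : constantCoeff g = 0) :
    suspension (plethysm f g) = plethysm (suspension f) (suspension g) := by
  have hg' := constantCoeff_suspension hg
  rw [plethysm_eq, plethysm_eq, suspension_eq (subst _ f), suspension_eq f,
    ← coe_substAlgHom (hasSubst_psi hg'), map_neg, coe_substAlgHom, rescaleAlgHom_apply,
    rescaleAlgHom_apply, rescale_eq_subst, rescale_eq_subst,
    subst_comp_subst_apply (hasSubst_psi hg) (HasSubst.smul_X _),
    subst_comp_subst_apply (HasSubst.smul_X _) (hasSubst_psi hg')]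
  congr 2
  funext k
  rw [← rescale_eq_subst, Pi.smul_apply', subst_smul (hasSubst_psi hg'),
    subst_X (hasSubst_psi hg'), suspension_eq, map_neg, ← negVars_psi, smul_neg, neg_one_smul,
    neg_neg, rescaleAlgHom_apply]

theorem psiSum_suspension (f : SymFun ℚ) : psiSum (suspension f) = suspension (psiSum f) := by
  ext m
  rw [suspension_eq, suspension_eq, map_neg, coeff_negVars, coeff_psiSum, coeff_psiSum,
    ← neg_mul, ← smul_eq_mul, smul_finsum]
  refine finsum_congr fun k => ?_
  rw [map_neg, map_neg, ← negVars_psi, coeff_negVars, smul_eq_mul, neg_mul]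

/-- The logarithmic Euler derivatives of the two factors are opposite, because `psiSum` commutes
with `suspension`, which carries a minus sign. -/
theorem plethysticExp_suspension {g : SymFun ℚ} (hg : constantCoeff g = 0) :
    plethysticExp (suspension g) * negVars (plethysticExp g) = 1 := by
  have hg' := constantCoeff_suspension hg
  refine eq_of_euler_eq ?_ ?_
  · rw [Derivation.map_one_eq_zero, Derivation.leibniz, euler_plethysticExp hg', ← negVars_euler,
      euler_plethysticExp hg, suspension_eq, map_neg, ← negVars_euler,
      ← suspension_eq (euler g),
      psiSum_suspension, suspension_eq (psiSum _), map_mul, smul_eq_mul, smul_eq_mul]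
    ring
  · rw [map_mul, constantCoeff_negVars, constantCoeff_plethysticExp hg,
      constantCoeff_plethysticExp hg', mul_one, map_one]

/-! ### Specialization at `t = 1` -/

/-- Evaluation at `1` absorbs the action of `p_k` on coefficients, as `t` and `t ^ k` both become
`1`. -/
theorem atOne_plethysmT (f : SymFun (Polynomial ℚ)) {g : SymFun (Polynomial ℚ)}
    (hg : constantCoeff g = 0) : atOne (plethysmT f g) = plethysm (atOne f) (atOne g) := by
  rw [atOne, plethysmT, plethysmWith, map_subst (hasSubst_adams _ hg), plethysm_eq]
  congr 1
  funext k
  rw [adams, ← rename_map]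
  congr 1
  ext m
  simp only [atOne, coeff_map]
  simp [Polynomial.expand_eval]

theorem atOne_extend (f : SymFun ℚ) : atOne (extend f) = f := by
  ext m
  simp [atOne, extend]

theorem atOne_t : atOne t = 1 := by
  simp [atOne, t]

theorem atOne_p (k : ℕ+) : atOne (p k) = p k := by simp [atOne]

theorem atOne_suspensionT {f : SymFun ℚ} (hf : constantCoeff f = 0) :
    atOne (suspensionT f) = suspension f := by
  ext m
  set q := coeff m (rescale (fun k : ℕ+ => -(Polynomial.X : Polynomial ℚ) ^ (k : ℕ)) (extend f))
    with hq
  have h1 : coeff m (atOne (suspensionT f)) = -(q.divX.eval 1) := by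
    rw [atOne, coeff_map, Polynomial.coe_evalRingHom]
    exact Polynomial.eval_neg _ _
  have h2 : q = (m.prod fun k e => (-(Polynomial.X : Polynomial ℚ) ^ (k : ℕ)) ^ e) *
      Polynomial.C (coeff m f) := by
    rw [hq, coeff_rescale, extend, coeff_map]
  -- A nontrivial monomial brings a factor divisible by `t`, and the trivial one has coefficient
  -- zero in `f`. Hence `divX` is an exact division, which does not change the value at `1`.
  have h3 : q.coeff 0 = 0 := by
    rw [Polynomial.coeff_zero_eq_eval_zero, h2, Polynomial.eval_mul, Polynomial.eval_C]
    by_cases hm : m = 0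
    · rw [hm, coeff_zero_eq_constantCoeff_apply, hf, mul_zero]
    · obtain ⟨k, hk⟩ := Finsupp.support_nonempty_iff.2 hm
      rw [Finsupp.prod, Polynomial.eval_prod, Finset.prod_eq_zero hk, zero_mul]
      simp [Finsupp.mem_support_iff.1 hk]
  have h4 : q.eval 1 = q.divX.eval 1 := by
    conv_lhs => rw [← Polynomial.divX_mul_X_add q]
    simp [h3]
  rw [h1, ← h4, h2, suspension_eq, map_neg, coeff_negVars, Finsupp.prod, Finsupp.prod,
    Polynomial.eval_mul, Polynomial.eval_prod]
  simp

/-! ### The main identity, from the plethystic equations of `Lie` and `PreLie` -/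

theorem plethysm_Comm_suspension_Lie (hL0 : constantCoeff Lie = 0)
    (hL : plethysm Comm (suspension Lie) = p 1) {Y : SymFun ℚ} (hY : constantCoeff Y = 0) :
    plethysm Comm (plethysm (suspension Lie) Y) = Y := by
  rw [plethysm_assoc _ (constantCoeff_suspension hL0) hY, hL, plethysm_p_one hY]

/-- A right inverse of `Comm` is also a left inverse, by injectivity of `plethysm Comm`. -/
theorem plethysm_suspension_Lie_Comm (hL0 : constantCoeff Lie = 0)
    (hL : plethysm Comm (suspension Lie) = p 1) {Y : SymFun ℚ} (hY : constantCoeff Y = 0) :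
    plethysm (suspension Lie) (plethysm Comm Y) = Y := by
  have h1 := constantCoeff_plethysm constantCoeff_Comm hY
  exact plethysm_Comm_injective (constantCoeff_plethysm (constantCoeff_suspension hL0) h1) hY
    (plethysm_Comm_suspension_Lie hL0 hL h1)

theorem plethysm_Lie_eq_iff (hL0 : constantCoeff Lie = 0)
    (hL : plethysm Comm (suspension Lie) = p 1) {T G : SymFun ℚ} (hT : constantCoeff T = 0)
    (hG : constantCoeff G = 0) :
    plethysm Lie G = T ↔ suspension G = plethysm Comm (suspension T) := by
  have hG' := constantCoeff_suspension hG
  rw [← suspension_injective.eq_iff, suspension_plethysm _ hG]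
  constructor
  · intro h
    rw [← h, plethysm_Comm_suspension_Lie hL0 hL hG']
  · intro h
    rw [h, plethysm_suspension_Lie_Comm hL0 hL (constantCoeff_suspension hT)]

/-- The functional equation of rooted trees after suspension: the sign on `p 1` cancels the one in
front, and `plethysticExp_suspension` moves the exponential to the other side. -/
theorem suspension_mul_plethysticExp {T : SymFun ℚ} (hT0 : constantCoeff T = 0)
    (hT : T = p 1 * plethysticExp T) :
    suspension T * plethysticExp (suspension T) = p 1 := by
  have h1 : suspension T = p 1 * negVars (plethysticExp T) := by
    conv_lhs => rw [hT]
    rw [suspension_eq, map_mul, negVars_p, neg_mul, neg_neg]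
  conv_lhs => rw [h1, mul_assoc, mul_comm (negVars _), ← h1]
  rw [plethysticExp_suspension hT0, mul_one]

theorem Assoc_mul : Assoc * (1 - p 1) = p 1 := by
  rw [Assoc, mul_assoc, MvPowerSeries.inv_mul_cancel, mul_one]
  simp

theorem constantCoeff_Assoc : constantCoeff Assoc = 0 := by simp [Assoc]

theorem suspension_Assoc_mul : suspension Assoc * (1 + p 1) = p 1 := by
  have h := congrArg negVars Assoc_mul
  rw [map_mul, map_sub, map_one, negVars_p, sub_neg_eq_add] at h
  rw [suspension_eq, neg_mul, h, neg_neg]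

theorem plethysm_suspension_Assoc_mul {Y : SymFun ℚ} (hY : constantCoeff Y = 0) :
    plethysm (suspension Assoc) Y * (1 + Y) = Y := by
  have h := congrArg (substAlgHom (R := ℚ) (hasSubst_psi hY)) suspension_Assoc_mul
  rw [map_mul, map_add, map_one, coe_substAlgHom, ← plethysm_eq, ← plethysm_eq,
    plethysm_p_one hY] at h
  exact h

theorem constantCoeff_HALpa : constantCoeff HALpa = 0 := existsUnique_HALpa.choose_spec.1.1

theorem HALpa_eq : HALpa = p 1 * plethysmT (suspensionT Assoc)
    (plethysmT (extend Comm) (p 1 - t * HALpa)) := existsUnique_HALpa.choose_spec.1.2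

theorem constantCoeff_p_sub_t_mul_HALpa :
    constantCoeff ((p 1 : SymFun (Polynomial ℚ)) - t * HALpa) = 0 := by
  rw [map_sub, map_mul, constantCoeff_HALpa, mul_zero, constantCoeff_X, sub_zero]

theorem constantCoeff_extend_Comm : constantCoeff (extend Comm) = 0 := by
  rw [extend, constantCoeff_map, constantCoeff_Comm, map_zero]

theorem constantCoeff_plethysmT_Comm_HALpa :
    constantCoeff (plethysmT (extend Comm) (p 1 - t * HALpa)) = 0 :=
  constantCoeff_plethysmWith _ constantCoeff_extend_Comm constantCoeff_p_sub_t_mul_HALpa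

theorem atOne_p_sub_t_mul_HALpa : atOne (p 1 - t * HALpa) = p 1 - 1 * atOne HALpa := by
  rw [atOne, map_sub, map_mul, ← atOne, ← atOne, ← atOne, atOne_p, atOne_t]

theorem atOne_plethysmT_Comm_HALpa : atOne (plethysmT (extend Comm) (p 1 - t * HALpa)) =
    plethysm Comm (p 1 - 1 * atOne HALpa) := by
  rw [atOne_plethysmT _ constantCoeff_p_sub_t_mul_HALpa, atOne_extend, atOne_p_sub_t_mul_HALpa]

/-- The equation of `HALpa` at `t = 1` has a single solution, so it suffices that `p 1 - P` is one.
As `suspension Assoc` is `p_1 / (1 + p_1)` and `1 + Comm ∘ P` is `plethysticExp P`, clearing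
denominators leaves exactly `hP`. -/
theorem p_sub_atOne_HALpa {P : SymFun ℚ} (hP0 : constantCoeff P = 0)
    (hP : P * plethysticExp P = p 1) : p 1 - 1 * atOne HALpa = P := by
  have hu := existsUnique_plethystic (fun _ => RingHom.id ℚ) (suspension Assoc) Comm 1
    constantCoeff_Comm
  have h1 : atOne HALpa = p 1 - P := by
    refine hu.unique ⟨?_, ?_⟩ ⟨?_, ?_⟩
    · rw [atOne, constantCoeff_map, constantCoeff_HALpa, map_zero]
    · have h := congrArg atOne HALpa_eq
      rw [atOne, atOne, map_mul, ← atOne, ← atOne, ← atOne, atOne_p,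
        atOne_plethysmT _ constantCoeff_plethysmT_Comm_HALpa, atOne_plethysmT_Comm_HALpa,
        atOne_suspensionT constantCoeff_Assoc] at h
      exact h
    · rw [map_sub, hP0, constantCoeff_X, sub_zero]
    · rw [one_mul, sub_sub_cancel]
      change p 1 - P = p 1 * plethysm (suspension Assoc) (plethysm Comm P)
      have hC0 := constantCoeff_plethysm constantCoeff_Comm hP0
      have hC := plethysm_suspension_Assoc_mul hC0
      have hE := one_add_plethysm_Comm hP0
      have hne : plethysticExp P ≠ 0 := fun h0 => by
        have := constantCoeff_plethysticExp hP0
        rw [h0, map_zero] at this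
        exact zero_ne_one this
      refine mul_right_cancel₀ hne ?_
      rw [sub_mul, hP, mul_assoc, ← hE, hC]
      ring
  rw [h1]
  ring

/-- At `t = 1`, `HAL^p` is `p_1 P` because `Σ Lie` undoes `Comm`, `HAL^a` is `Comm ∘ P - P`, and
`HAL^{pa}` is `p_1 - P`. -/
theorem HALbar_eq (hL0 : constantCoeff Lie = 0) (hL : plethysm Comm (suspension Lie) = p 1)
    {P : SymFun ℚ} (hP0 : constantCoeff P = 0) (hP : P * plethysticExp P = p 1) :
    HALbar = p 1 * P + plethysm Comm P - p 1 := by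
  have h1 := p_sub_atOne_HALpa hP0 hP
  have h2 : atOne HALp = p 1 * P := by
    rw [HALp, atOne, map_mul, ← atOne, ← atOne, atOne_p,
      atOne_plethysmT _ constantCoeff_plethysmT_Comm_HALpa, atOne_plethysmT_Comm_HALpa,
      atOne_suspensionT hL0, h1, plethysm_suspension_Lie_Comm hL0 hL hP0]
  have h3 : atOne HALa = plethysm Comm P - P := by
    rw [HALa, atOne_plethysmT _ constantCoeff_p_sub_t_mul_HALpa, atOne_p_sub_t_mul_HALpa, h1,
      atOne, map_sub, ← atOne, ← atOne, atOne_p, atOne_extend, plethysm_eq,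
      subst_sub (hasSubst_psi hP0), ← plethysm_eq, ← plethysm_eq, plethysm_p_one hP0]
  rw [HALbar, HAL, atOne, map_sub, map_add, ← atOne, ← atOne, ← atOne, h2, h3]
  linear_combination h1

/-- For `k ≥ 2` the variable `p_1` does not occur in `psi k g`, so only the term `k = 1` survives.
-/
theorem pderiv_logPlethysm {g : SymFun ℚ} (hg : constantCoeff g = 0) :
    pderiv ℚ 1 (logPlethysm g) = pderiv ℚ 1 g := by
  ext m
  rw [coeff_pderiv, coeff_pderiv, coeff_logPlethysm hg, finsum_eq_single _ 1, psi_one]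
  · simp
  · intro k hk
    rw [coeff_rename, Finset.sum_eq_zero, mul_zero]
    intro y hy
    exfalso
    have hy' : y.mapDomain (mulLeftEmbedding k) = m + Finsupp.single 1 1 := by simpa using hy
    have h1 : (y.mapDomain (mulLeftEmbedding k)) 1 = 0 := by
      refine Finsupp.mapDomain_of_notMem_range _ _ ?_
      rintro ⟨j, hj⟩
      have h2 : k * j = 1 := hj
      exact hk (PNat.coe_injective (Nat.eq_one_of_mul_eq_one_right
        (m := (k : ℕ)) (n := (j : ℕ)) (by exact_mod_cast congrArg PNat.val h2)))
    rw [hy'] at h1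
    simp at h1

/-- Let `E` be `plethysticExp P` and `P'` the derivative of `P` in `p_1`. By `HALbar_eq` the two
sides differ by `p_1 (1 - (p_1 + E) P')`, and differentiating `P E = p_1` gives `(E + p_1) P' = 1`.
-/
theorem plethysm_Comm_eq (hL0 : constantCoeff Lie = 0)
    (hL : plethysm Comm (suspension Lie) = p 1)
    {P : SymFun ℚ} (hP0 : constantCoeff P = 0) (hP : P * plethysticExp P = p 1) :
    plethysm Comm P = p 1 - (p 1 * pderiv ℚ 1 HALbar - HALbar) := by
  have h1 := derivation_plethysticExp truncCompat_pderiv hP0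
  rw [pderiv_logPlethysm hP0] at h1
  have h2 := congrArg (pderiv ℚ (1 : ℕ+)) hP
  rw [Derivation.leibniz, h1, pderiv_X_self, smul_eq_mul, smul_eq_mul] at h2
  have h3 : pderiv ℚ 1 (plethysm Comm P) = plethysticExp P * pderiv ℚ 1 P := by
    rw [← h1, ← one_add_plethysm_Comm hP0, map_add, Derivation.map_one_eq_zero, zero_add]
  rw [HALbar_eq hL0 hL hP0 hP, map_sub, map_add, Derivation.leibniz, h3, pderiv_X_self,
    smul_eq_mul, smul_eq_mul]
  linear_combination (p 1) * h2 - (p 1) * pderiv ℚ 1 P * hP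

end
end PreLieHAL

/-! ### Class functions on permutations and operations on their cycle index series. -/

namespace PreLieHAL
open MvPowerSeries Equiv
noncomputable section

/-! ### Cycle types -/

/-- The number of points of minimal period `k`. -/
def perCount {α : Type} (σ : Perm α) (k : ℕ) : ℕ :=
  Nat.card {x // Function.minimalPeriod σ x = k}

theorem minimalPeriod_eq_card_support_cycleOf {α : Type} [Fintype α] [DecidableEq α] (σ : Perm α)
    {x : α} (hx : σ x ≠ x) : Function.minimalPeriod σ x = (σ.cycleOf x).support.card := by
  have hc : (σ.cycleOf x).IsCycle := Perm.isCycle_cycleOf σ hx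
  have hx' : σ.cycleOf x x ≠ x := by rwa [Perm.cycleOf_apply_self]
  refine Nat.dvd_right_iff_eq.1 fun n => ?_
  rw [← Function.isPeriodicPt_iff_minimalPeriod_dvd, ← hc.orderOf, orderOf_dvd_iff_pow_eq_one,
    hc.pow_eq_one_iff' hx', Perm.cycleOf_pow_apply_self, Function.IsPeriodicPt,
    Function.IsFixedPt, ← Perm.iterate_eq_pow]

/-- The points of minimal period `k` form the disjoint union of the supports of the cycles of length
`k`. Fixed points are treated apart because `cycleType` omits them. -/
theorem mul_count_parts {α : Type} [Fintype α] [DecidableEq α] (σ : Perm α) {k : ℕ} (hk : 0 < k) :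
    k * σ.partition.parts.count k = perCount σ k := by
  rw [Perm.parts_partition, Multiset.count_add, Multiset.count_replicate, perCount,
    Nat.card_eq_fintype_card, Fintype.card_subtype]
  rcases Nat.eq_or_lt_of_le (Nat.succ_le_of_lt hk) with rfl | h2
  · rw [Multiset.count_eq_zero.2, zero_add, if_pos rfl, Nat.succ_eq_add_one, zero_add, one_mul,
      ← Finset.card_compl]
    · congr 1
      ext x
      simp [Function.minimalPeriod_eq_one_iff_isFixedPt, Function.IsFixedPt]
    · intro h
      exact absurd (Perm.two_le_of_mem_cycleType h) (by norm_num)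
  · rw [if_neg (by omega), add_zero, Perm.cycleType_def, Multiset.count_map]
    have hB : (Finset.univ.filter fun x => Function.minimalPeriod σ x = k) =
        (σ.cycleFactorsFinset.filter fun c => k = c.support.card).biUnion fun c => c.support := by
      ext x
      simp only [Finset.mem_filter, Finset.mem_univ, true_and, Finset.mem_biUnion]
      constructor
      · intro h
        have hx : σ x ≠ x := fun h1 => by
          have := Function.minimalPeriod_eq_one_iff_isFixedPt.2 h1
          omega
        refine ⟨σ.cycleOf x, ⟨Perm.cycleOf_mem_cycleFactorsFinset_iff.2 (Perm.mem_support.2 hx), ?_⟩, ?_⟩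
        · rw [← minimalPeriod_eq_card_support_cycleOf σ hx, h]
        · rw [Perm.mem_support, Perm.cycleOf_apply_self]; exact hx
      · rintro ⟨c, ⟨hc, hk'⟩, hx⟩
        have h1 := Perm.cycle_is_cycleOf hx hc
        have hx' : σ x ≠ x := Perm.mem_support.1 (Perm.mem_cycleFactorsFinset_support_le hc hx)
        rw [minimalPeriod_eq_card_support_cycleOf σ hx', ← h1, hk']
    rw [hB, Finset.card_biUnion, Finset.sum_congr rfl (g := fun _ => k), Finset.sum_const,
      smul_eq_mul, mul_comm]
    · rfl
    · intro c hc
      exact (Finset.mem_filter.1 hc).2.symm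
    · intro c hc d hd hcd
      exact (Perm.cycleFactorsFinset_pairwise_disjoint σ (Finset.mem_filter.1 hc).1
        (Finset.mem_filter.1 hd).1 hcd).disjoint_support

/-- The exponents of the monomial in the power sums given by the cycle type. -/
def cyc {α : Type} [Finite α] (σ : Perm α) : ℕ+ →₀ ℕ :=
  letI := Fintype.ofFinite α
  letI := Classical.decEq α
  (Multiset.toFinsupp σ.partition.parts).comapDomain (fun k : ℕ+ => (k : ℕ))
    PNat.coe_injective.injOn

theorem mul_cyc {α : Type} [Finite α] (σ : Perm α) (k : ℕ+) : k * cyc σ k = perCount σ k := by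
  let := Fintype.ofFinite α
  let := Classical.decEq α
  exact mul_count_parts σ k.pos

/-- Cycle types are computed below by counting points of each minimal period, which passes to
bijections, stable subsets and products more easily than the cycles themselves. -/
theorem cyc_eq {α : Type} [Finite α] {σ : Perm α} {m : ℕ+ →₀ ℕ}
    (h : ∀ k : ℕ+, perCount σ k = k * m k) : cyc σ = m := by
  ext k
  have := mul_cyc σ k
  rw [h k] at this
  exact Nat.eq_of_mul_eq_mul_left k.pos this

theorem cyc_fin {n : ℕ} (σ : Perm (Fin n)) : cyc σ = cycleMonomial σ :=
  cyc_eq fun k => (mul_count_parts σ k.pos).symm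

theorem minimalPeriod_pos {α : Type} [Finite α] (σ : Perm α) (x : α) :
    0 < Function.minimalPeriod σ x := by
  refine Function.IsPeriodicPt.minimalPeriod_pos (orderOf_pos σ) ?_
  rw [Function.IsPeriodicPt, Function.IsFixedPt, Perm.iterate_eq_pow, pow_orderOf_eq_one]
  rfl

theorem perCount_conj {α β : Type} (e : α ≃ β) (σ : Perm α) (k : ℕ) :
    perCount (e.permCongr σ) k = perCount σ k := by
  refine (Nat.card_congr (e.subtypeEquiv fun x => ?_)).symm
  have h : ∀ n, (e.permCongr σ)^[n] (e x) = e (σ^[n] x) := fun n => by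
    have : Function.Semiconj e σ (e.permCongr σ) := fun y => by simp [Equiv.permCongr_apply]
    exact ((this.iterate_right n) x).symm
  have : Function.minimalPeriod (e.permCongr σ) (e x) = Function.minimalPeriod σ x := by
    rw [Function.minimalPeriod_eq_minimalPeriod_iff]
    intro n
    rw [Function.IsPeriodicPt, Function.IsPeriodicPt, Function.IsFixedPt, Function.IsFixedPt, h,
      e.injective.eq_iff]
  rw [this]

theorem cyc_conj {α β : Type} [Finite α] [Finite β] (e : α ≃ β) (σ : Perm α) :
    cyc (e.permCongr σ) = cyc σ :=
  cyc_eq fun k => by rw [perCount_conj, mul_cyc]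

theorem degree_cyc {α : Type} [Finite α] (σ : Perm α) : degree (cyc σ) = Nat.card α := by
  classical
  let := Fintype.ofFinite α
  let f : α → ℕ+ := fun x => ⟨Function.minimalPeriod σ x, minimalPeriod_pos σ x⟩
  have h1 : ∀ k : ℕ+, perCount σ k = (Finset.univ.filter fun x => f x = k).card := fun k => by
    rw [perCount, Nat.card_eq_fintype_card, Fintype.card_subtype]
    congr 1
    ext x
    simp only [Finset.mem_filter, Finset.mem_univ, true_and]
    exact ⟨fun h => PNat.coe_injective h, fun h => congrArg PNat.val h⟩
  rw [degree, Finsupp.weight_apply, Finsupp.sum, Nat.card_eq_fintype_card, ← Finset.card_univ,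
    Finset.card_eq_sum_card_fiberwise (f := f) (t := (cyc σ).support)]
  · refine Finset.sum_congr rfl fun k _ => ?_
    rw [smul_eq_mul, mul_comm, mul_cyc, h1]
  · intro x _
    rw [Finset.mem_coe, Finsupp.mem_support_iff]
    intro h0
    have h2 := mul_cyc σ (f x)
    rw [h0, mul_zero, h1, eq_comm, Finset.card_eq_zero] at h2
    exact Finset.notMem_empty x (h2 ▸ Finset.mem_filter.2 ⟨Finset.mem_univ x, rfl⟩)

theorem minimalPeriod_subtypePerm {α : Type} (σ : Perm α) {q : α → Prop}
    (h : ∀ x, q (σ x) ↔ q x) (x : {x // q x}) :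
    Function.minimalPeriod (σ.subtypePerm h) x = Function.minimalPeriod σ (x : α) := by
  rw [Function.minimalPeriod_eq_minimalPeriod_iff]
  intro n
  rw [Function.IsPeriodicPt, Function.IsPeriodicPt, Function.IsFixedPt, Function.IsFixedPt,
    Perm.iterate_eq_pow, Perm.iterate_eq_pow, Perm.subtypePerm_pow, Subtype.ext_iff,
    Perm.subtypePerm_apply]

theorem cyc_subtypePerm_add {α : Type} [Finite α] (σ : Perm α) {q : α → Prop}
    (h : ∀ x, q (σ x) ↔ q x) (h' : ∀ x, ¬ q (σ x) ↔ ¬ q x) :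
    cyc σ = cyc (σ.subtypePerm h) + cyc (σ.subtypePerm (p := fun x => ¬ q x) h') := by
  classical
  let := Fintype.ofFinite α
  refine cyc_eq fun k => ?_
  rw [Finsupp.add_apply, mul_add, mul_cyc, mul_cyc, perCount, perCount, perCount]
  simp only [minimalPeriod_subtypePerm]
  rw [← Nat.card_congr (Equiv.subtypeSubtypeEquivSubtypeInter q
      (fun x => Function.minimalPeriod σ x = k)).symm,
    ← Nat.card_congr (Equiv.subtypeSubtypeEquivSubtypeInter (fun x => ¬ q x)
      (fun x => Function.minimalPeriod σ x = k)).symm, Nat.card_eq_fintype_card,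
    Nat.card_eq_fintype_card, Nat.card_eq_fintype_card, Fintype.card_subtype, Fintype.card_subtype,
    Fintype.card_subtype, ← Finset.card_filter_add_card_filter_not (fun x => q x)]
  rw [Finset.filter_filter, Finset.filter_filter]
  simp only [and_comm]

end
end PreLieHAL

namespace PreLieHAL
open MvPowerSeries Equiv
noncomputable section

/-! ### Cycle index series -/

/-- A function on the permutations of all sets which is invariant under bijections. -/
def IsClassFun (F : ∀ α : Type, Perm α → ℚ) : Prop :=
  ∀ (α β : Type) (e : α ≃ β) (σ : Perm α), F β (e.permCongr σ) = F α σ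

/-- The sum of `F` over the permutations of cycle type `m`. -/
def wsum (F : ∀ α : Type, Perm α → ℚ) (α : Type) [Fintype α] [DecidableEq α] (m : ℕ+ →₀ ℕ) : ℚ :=
  ∑ σ : Perm α, if cyc σ = m then F α σ else 0

theorem IsClassFun.wsum_congr {F : ∀ α : Type, Perm α → ℚ} (hF : IsClassFun F) {α β : Type}
    [Fintype α] [DecidableEq α] [Fintype β] [DecidableEq β] (e : α ≃ β) (m : ℕ+ →₀ ℕ) :
    wsum F α m = wsum F β m :=
  Fintype.sum_equiv e.permCongr _ _ fun σ => by rw [cyc_conj, hF]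

theorem wsum_eq_zero (F : ∀ α : Type, Perm α → ℚ) {α : Type} [Fintype α] [DecidableEq α]
    {m : ℕ+ →₀ ℕ} (h : degree m ≠ Fintype.card α) : wsum F α m = 0 := by
  refine Finset.sum_eq_zero fun σ _ => if_neg ?_
  rintro rfl
  exact h (by rw [degree_cyc, Nat.card_eq_fintype_card])

/-- The cycle index series of a class function. -/
def cycleIndex (F : ∀ α : Type, Perm α → ℚ) : SymFun ℚ := fun m =>
  ((degree m).factorial : ℚ)⁻¹ * wsum F (Fin (degree m)) m

theorem coeff_cycleIndex (F : ∀ α : Type, Perm α → ℚ) (m : ℕ+ →₀ ℕ) :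
    coeff m (cycleIndex F) = ((degree m).factorial : ℚ)⁻¹ * wsum F (Fin (degree m)) m := rfl

theorem factorial_mul_coeff_cycleIndex (F : ∀ α : Type, Perm α → ℚ) {m : ℕ+ →₀ ℕ} {n : ℕ}
    (h : degree m = n) :
    (n.factorial : ℚ) * coeff m (cycleIndex F) = wsum F (Fin n) m := by
  subst h
  rw [coeff_cycleIndex, ← mul_assoc, mul_inv_cancel₀ (Nat.cast_ne_zero.2 (Nat.factorial_ne_zero _)),
    one_mul]

theorem IsClassFun.wsum_eq {F : ∀ α : Type, Perm α → ℚ} (hF : IsClassFun F) (α : Type)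
    [Fintype α] [DecidableEq α] (m : ℕ+ →₀ ℕ) : wsum F α m =
      if degree m = Fintype.card α then ((Fintype.card α).factorial : ℚ) * coeff m (cycleIndex F)
      else 0 := by
  split_ifs with h
  · rw [hF.wsum_congr (Fintype.equivFin α), factorial_mul_coeff_cycleIndex F h]
  · exact wsum_eq_zero F h

theorem euler_cycleIndex (F : ∀ α : Type, Perm α → ℚ) :
    euler (cycleIndex F) = cycleIndex fun α σ => Nat.card α * F α σ := by
  ext m
  rw [coeff_euler, coeff_cycleIndex, coeff_cycleIndex, wsum, wsum, mul_left_comm, Finset.mul_sum]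
  congr 1
  refine Finset.sum_congr rfl fun σ _ => ?_
  rw [mul_ite, mul_zero, Nat.card_eq_fintype_card, Fintype.card_fin]

theorem cycleIndex_finset_sum {ι : Type} (s : Finset ι) (F : ι → ∀ α : Type, Perm α → ℚ)  :
    (cycleIndex fun α σ => ∑ i ∈ s, F i α σ) = ∑ i ∈ s, cycleIndex (F i) := by
  ext m
  rw [map_sum]
  simp only [coeff_cycleIndex, wsum]
  rw [← Finset.mul_sum, Finset.sum_comm]
  congr 1
  refine Finset.sum_congr rfl fun σ _ => ?_
  split_ifs
  · rfl
  · rw [Finset.sum_const_zero]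

theorem sum_dite_eq_sum_subtype {ι : Type} [Fintype ι] (P : ι → Prop) [DecidablePred P]
    (f : ∀ a, P a → ℚ) : (∑ a, if h : P a then f a h else 0) = ∑ a : {a // P a}, f a a.2 := by
  rw [Finset.sum_dite, Finset.sum_const_zero, add_zero]
  exact Fintype.sum_equiv (Equiv.subtypeEquivRight (by simp)) _ _ fun x => rfl

/-- A permutation stabilizing a set is a pair of permutations of the set and of its complement. -/
def stablePermEquiv {α : Type} [DecidableEq α] (s : Finset α) :
    {σ : Perm α // ∀ x, σ x ∈ s ↔ x ∈ s} ≃ Perm {x // x ∈ s} × Perm {x // x ∉ s} where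
  toFun σ := (σ.1.subtypePerm σ.2, σ.1.subtypePerm fun x => not_congr (σ.2 x))
  invFun τ := ⟨Perm.subtypeCongr τ.1 τ.2, fun x => by
    by_cases hx : x ∈ s
    · rw [Perm.subtypeCongr.left_apply τ.1 τ.2 hx]
      exact iff_of_true (τ.1 ⟨x, hx⟩).2 hx
    · rw [Perm.subtypeCongr.right_apply τ.1 τ.2 hx]
      exact iff_of_false (τ.2 ⟨x, hx⟩).2 hx⟩
  left_inv σ := by
    ext x
    by_cases hx : x ∈ s
    · simp [Perm.subtypeCongr.left_apply _ _ hx]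
    · simp [Perm.subtypeCongr.right_apply _ _ hx]
  right_inv τ := by
    refine Prod.ext ?_ ?_
    · ext x
      simp [Perm.subtypeCongr.left_apply _ _ x.2]
    · ext x
      simp [Perm.subtypeCongr.right_apply _ _ x.2]

/-- The product of class functions: the sum over the stable subsets. -/
def prodFun (A B : ∀ α : Type, Perm α → ℚ) {α : Type} [Fintype α] [DecidableEq α] (σ : Perm α) :
    ℚ :=
  ∑ s : Finset α, if h : ∀ x, σ x ∈ s ↔ x ∈ s then
    A {x // x ∈ s} (σ.subtypePerm h) * B {x // x ∉ s} (σ.subtypePerm fun x => not_congr (h x))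
  else 0

/-- A permutation with a stable subset is a pair of permutations, of the subset and of its
complement, and the cycle types add up; exchanging the sums gives a convolution. -/
theorem sum_prodFun (A B : ∀ α : Type, Perm α → ℚ) {α : Type} [Fintype α] [DecidableEq α]
    (m : ℕ+ →₀ ℕ) : (∑ σ : Perm α, if cyc σ = m then prodFun A B σ else 0) =
      ∑ s : Finset α, ∑ x ∈ Finset.HasAntidiagonal.antidiagonal m,
        wsum A {x // x ∈ s} x.1 * wsum B {x // x ∉ s} x.2 := by
  classical
  have h1 : ∀ σ : Perm α, (if cyc σ = m then prodFun A B σ else 0) =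
      ∑ s : Finset α, if h : ∀ x, σ x ∈ s ↔ x ∈ s then (if cyc σ = m then
        A {x // x ∈ s} (σ.subtypePerm h) * B {x // x ∉ s} (σ.subtypePerm fun x => not_congr (h x))
        else 0) else 0 := fun σ => by
    split_ifs
    · rfl
    · rw [Finset.sum_eq_zero]
      intro s _
      split_ifs <;> rfl
  simp only [h1]
  rw [Finset.sum_comm]
  refine Finset.sum_congr rfl fun s _ => ?_
  rw [sum_dite_eq_sum_subtype]
  rw [Fintype.sum_equiv (stablePermEquiv s) _ (fun τ => if cyc τ.1 + cyc τ.2 = m then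
    A _ τ.1 * B _ τ.2 else 0)]
  · simp only [wsum, Finset.sum_mul_sum]
    rw [Finset.sum_comm, Fintype.sum_prod_type]
    refine Finset.sum_congr rfl fun σ _ => ?_
    rw [Finset.sum_comm]
    refine Finset.sum_congr rfl fun τ _ => ?_
    simp only [ite_mul, zero_mul, mul_ite, mul_zero, ← ite_and]
    by_cases hm : cyc σ + cyc τ = m
    · rw [if_pos hm, Finset.sum_eq_single (cyc σ, cyc τ)]
      · simp
      · rintro ⟨a, b⟩ _ hab
        rw [if_neg]
        rintro ⟨rfl, rfl⟩
        exact hab rfl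
      · intro h
        exact absurd (Finset.HasAntidiagonal.mem_antidiagonal.2 hm) h
    · rw [if_neg hm, Finset.sum_eq_zero]
      rintro ⟨a, b⟩ hab
      rw [if_neg]
      rintro ⟨rfl, rfl⟩
      exact hm (Finset.HasAntidiagonal.mem_antidiagonal.1 hab)
  · rintro ⟨σ, h⟩
    rw [cyc_subtypePerm_add σ h fun x => not_congr (h x)]
    rfl

theorem factorial_mul_coeff_cycleIndex_mul {A B : ∀ α : Type, Perm α → ℚ} (hA : IsClassFun A)
    (hB : IsClassFun B) (m : ℕ+ →₀ ℕ) :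
    ((degree m).factorial : ℚ) * coeff m (cycleIndex A * cycleIndex B) =
      ∑ σ : Perm (Fin (degree m)), if cyc σ = m then prodFun A B σ else 0 := by
  classical
  symm
  rw [sum_prodFun, Finset.sum_comm, coeff_mul, Finset.mul_sum]
  refine Finset.sum_congr rfl fun x hx => ?_
  have hd := degree_add x.1 x.2
  rw [Finset.HasAntidiagonal.mem_antidiagonal.1 hx] at hd
  -- The contribution of `s` depends only on its cardinality and vanishes unless that is the degree
  -- of `x.1`; the binomial coefficient counting these `s` then accounts for the factorials.
  have h1 : ∀ s : Finset (Fin (degree m)),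
      wsum A {x // x ∈ s} x.1 * wsum B {x // x ∉ s} x.2 = if s.card = degree x.1 then
        ((degree x.1).factorial * (degree x.2).factorial : ℚ) *
          (coeff x.1 (cycleIndex A) * coeff x.2 (cycleIndex B)) else 0 := fun s => by
    have hs : s.card ≤ degree m := by simpa using s.card_le_univ
    rw [hA.wsum_eq, hB.wsum_eq, Fintype.card_coe, Fintype.card_subtype_compl, Fintype.card_coe,
      Fintype.card_fin]
    by_cases h : s.card = degree x.1
    · rw [if_pos h.symm, if_pos h, if_pos (by omega), h, show degree m - degree x.1 = degree x.2 by omega]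
      ring
    · rw [if_neg (Ne.symm h), if_neg h, zero_mul]
  rw [Finset.sum_congr rfl fun s _ => h1 s, ← Finset.sum_filter, Finset.sum_const,
    ← Finset.powerset_univ, ← Finset.powersetCard_eq_filter, Finset.card_powersetCard, Finset.card_univ,
    Fintype.card_fin, nsmul_eq_mul, ← mul_assoc]
  congr 1
  have h2 := Nat.choose_mul_factorial_mul_factorial (n := degree m) (k := degree x.1) (by omega)
  rw [show degree m - degree x.1 = degree x.2 by omega] at h2
  rw [← h2]
  push_cast
  ring

/-- Turns a decomposition of structures along a stable subset and its complement into a product of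
symmetric functions. -/
theorem cycleIndex_eq_mul {A B F : ∀ α : Type, Perm α → ℚ} (hA : IsClassFun A) (hB : IsClassFun B)
    (hF : ∀ n (σ : Perm (Fin n)), F _ σ = prodFun A B σ) :
    cycleIndex F = cycleIndex A * cycleIndex B := by
  classical
  ext m
  have hn : ((degree m).factorial : ℚ) ≠ 0 := Nat.cast_ne_zero.2 (Nat.factorial_ne_zero _)
  refine mul_left_cancel₀ hn ?_
  rw [factorial_mul_coeff_cycleIndex F rfl, factorial_mul_coeff_cycleIndex_mul hA hB, wsum]
  simp only [hF]

end
end PreLieHAL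

namespace PreLieHAL
open MvPowerSeries Equiv
noncomputable section

/-! ### Cyclic colourings and plethysm by power sums -/

/-- The colourings in `ℤ/d` whose value increases by one along `σ`. -/
abbrev CyclicColoring {α : Type} (σ : Perm α) (d : ℕ+) : Type :=
  {c : α → ZMod d // ∀ x, c (σ x) = c x + 1}

theorem CyclicColoring.pow_apply {α : Type} {σ : Perm α} {d : ℕ+} (c : CyclicColoring σ d) (n : ℕ)
    (x : α) : c.1 ((σ ^ n) x) = c.1 x + n := by
  induction n with
  | zero => simp
  | succ n ih => rw [pow_succ', Perm.mul_apply, c.2, ih]; push_cast; ring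

/-- The permutation induced by `σ ^ d` on the points of colour zero. -/
def CyclicColoring.rootPerm {α : Type} {σ : Perm α} {d : ℕ+} (c : CyclicColoring σ d) :
    Perm {x // c.1 x = 0} :=
  (σ ^ (d : ℕ)).subtypePerm fun x => by rw [c.pow_apply, ZMod.natCast_self, add_zero]

theorem CyclicColoring.coe_rootPerm_apply {α : Type} {σ : Perm α} {d : ℕ+}
    (c : CyclicColoring σ d) (x : {x // c.1 x = 0}) : (c.rootPerm x : α) = (σ ^ (d : ℕ)) x := rfl

/-- The permutation of `β × ℤ/d` which moves cyclically the copies of `β` and whose `d`-th power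
acts as `τ` on each of them. -/
def cyclicPerm {β : Type} (τ : Perm β) (d : ℕ+) : Perm (β × ZMod d) where
  toFun x := (if x.2 + 1 = 0 then τ x.1 else x.1, x.2 + 1)
  invFun x := (if x.2 = 0 then τ.symm x.1 else x.1, x.2 - 1)
  left_inv x := by
    refine Prod.ext ?_ (by simp)
    by_cases h : x.2 + 1 = 0 <;> simp [h]
  right_inv x := by
    refine Prod.ext ?_ (by simp)
    by_cases h : x.2 = 0 <;> simp [h]

theorem cyclicPerm_apply {β : Type} (τ : Perm β) (d : ℕ+) (i : β) (j : ZMod d) :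
    cyclicPerm τ d (i, j) = (if j + 1 = 0 then τ i else i, j + 1) := rfl

theorem cyclicPerm_pow_of_lt {β : Type} (τ : Perm β) (d : ℕ+) (i : β) {v : ℕ} (hv : v < d) :
    (cyclicPerm τ d ^ v) (i, 0) = (i, (v : ZMod d)) := by
  induction v with
  | zero => simp
  | succ v ih =>
    rw [pow_succ', Perm.mul_apply, ih (by omega), cyclicPerm_apply, if_neg]
    · push_cast; rfl
    · intro h
      have h1 : ((v + 1 : ℕ) : ZMod d) = 0 := by push_cast; exact h
      rw [ZMod.natCast_eq_zero_iff] at h1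
      exact absurd (Nat.le_of_dvd (Nat.succ_pos _) h1) (by omega)

theorem cyclicPerm_pow_zero {β : Type} (τ : Perm β) (d : ℕ+) (i : β) :
    (cyclicPerm τ d ^ (d : ℕ)) (i, 0) = (τ i, 0) := by
  obtain ⟨v, hv⟩ : ∃ v, (d : ℕ) = v + 1 := ⟨d - 1, by have := d.pos; omega⟩
  have h : ((v : ZMod d) + 1) = 0 := by
    have h0 : ((v + 1 : ℕ) : ZMod d) = 0 := by rw [ZMod.natCast_eq_zero_iff, ← hv]
    exact_mod_cast h0
  rw [show (cyclicPerm τ d ^ (d : ℕ)) = cyclicPerm τ d ^ (v + 1) by rw [← hv], pow_succ',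
    Perm.mul_apply, cyclicPerm_pow_of_lt τ d i (by omega), cyclicPerm_apply, if_pos h, h]

theorem cyclicPerm_pow_val {β : Type} (τ : Perm β) (d : ℕ+) (i : β) (j : ZMod d) :
    (cyclicPerm τ d ^ j.val) (i, 0) = (i, j) := by
  rw [cyclicPerm_pow_of_lt τ d i (ZMod.val_lt j), ZMod.natCast_zmod_val]

theorem cyclicPerm_pow_self {β : Type} (τ : Perm β) (d : ℕ+) (i : β) (j : ZMod d) :
    (cyclicPerm τ d ^ (d : ℕ)) (i, j) = (τ i, j) := by
  rw [← cyclicPerm_pow_val τ d i j, ← Perm.mul_apply, ← pow_add, add_comm, pow_add, Perm.mul_apply,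
    cyclicPerm_pow_zero, cyclicPerm_pow_val]

theorem snd_cyclicPerm_pow {β : Type} (τ : Perm β) (d : ℕ+) (x : β × ZMod d) (n : ℕ) :
    ((cyclicPerm τ d ^ n) x).2 = x.2 + n :=
  CyclicColoring.pow_apply (σ := cyclicPerm τ d) ⟨fun x => x.2, fun _ => rfl⟩ n x

theorem cyclicPerm_pow_mul {β : Type} (τ : Perm β) (d : ℕ+) (i : β) (j : ZMod d) (n : ℕ) :
    (cyclicPerm τ d ^ ((d : ℕ) * n)) (i, j) = ((τ ^ n) i, j) := by
  induction n with
  | zero => simp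
  | succ n ih =>
    rw [mul_add, mul_one, add_comm, pow_add, Perm.mul_apply, ih, cyclicPerm_pow_self, pow_succ',
      Perm.mul_apply]

/-- A return to the same copy of `β` takes a multiple of `d` steps, and `d` steps act as `τ`. -/
theorem minimalPeriod_cyclicPerm {β : Type} (τ : Perm β) (d : ℕ+) (x : β × ZMod d) :
    Function.minimalPeriod (cyclicPerm τ d) x = d * Function.minimalPeriod τ x.1 := by
  obtain ⟨i, j⟩ := x
  refine Nat.dvd_right_iff_eq.1 fun n => ?_
  rw [← Function.isPeriodicPt_iff_minimalPeriod_dvd, Function.IsPeriodicPt, Function.IsFixedPt,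
    Perm.iterate_eq_pow]
  by_cases hd : (d : ℕ) ∣ n
  · obtain ⟨q, rfl⟩ := hd
    rw [cyclicPerm_pow_mul, Nat.mul_dvd_mul_iff_left d.pos,
      ← Function.isPeriodicPt_iff_minimalPeriod_dvd, Function.IsPeriodicPt, Function.IsFixedPt,
      Perm.iterate_eq_pow]
    simp
  · refine iff_of_false (fun h => hd ?_) (fun h => hd ((Dvd.intro _ rfl).trans h))
    have h1 := congrArg Prod.snd h
    rw [snd_cyclicPerm_pow] at h1
    rw [← ZMod.natCast_eq_zero_iff]
    simpa using h1

theorem cyc_cyclicPerm {β : Type} [Finite β] (τ : Perm β) (d : ℕ+) :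
    cyc (cyclicPerm τ d) = (cyc τ).embDomain (mulLeftEmbedding d) := by
  refine cyc_eq fun k => ?_
  by_cases hk : k ∈ Set.range (mulLeftEmbedding d)
  · obtain ⟨k, rfl⟩ := hk
    rw [Finsupp.embDomain_apply_self]
    have h1 : ((mulLeftEmbedding d k : ℕ+) : ℕ) = d * k := rfl
    rw [h1, mul_assoc, mul_cyc, perCount, perCount]
    simp only [minimalPeriod_cyclicPerm, Nat.mul_right_inj d.pos.ne']
    rw [← Nat.card_congr (Equiv.prodSubtypeFstEquivSubtypeProd
      (p := fun x => Function.minimalPeriod τ x = k) (β := ZMod d)).symm, Nat.card_prod, Nat.card_zmod, mul_comm]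
  · rw [Finsupp.embDomain_of_notMem_range _ _ _ hk, mul_zero, perCount, Nat.card_eq_zero]
    left
    constructor
    rintro ⟨x, hx⟩
    rw [minimalPeriod_cyclicPerm] at hx
    exact hk ⟨⟨_, minimalPeriod_pos τ x.1⟩, PNat.coe_injective hx⟩

/-- The coordinates given by a cyclic colouring and an enumeration of the points of colour zero. -/
def CyclicColoring.coords {α β : Type} {σ : Perm α} {d : ℕ+} (c : CyclicColoring σ d)
    (e : β ≃ {x // c.1 x = 0}) : β × ZMod d ≃ α :=
  Equiv.ofBijective (fun x => (σ ^ x.2.val) (e x.1)) (by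
    have hc : ∀ x : β × ZMod d, c.1 ((σ ^ x.2.val) (e x.1)) = x.2 := fun x => by
      rw [c.pow_apply, (e x.1).2, zero_add, ZMod.natCast_zmod_val]
    constructor
    · rintro ⟨i, j⟩ ⟨i', j'⟩ h
      have h1 : j = j' := by
        have h2 := congrArg c.1 h
        rwa [hc, hc] at h2
      subst h1
      exact Prod.ext (e.injective (Subtype.ext (by simpa using h))) rfl
    · intro y
      have h0 : c.1 ((σ ^ (c.1 y).val).symm y) = 0 := by
        have h1 := c.pow_apply (c.1 y).val ((σ ^ (c.1 y).val).symm y)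
        rw [Equiv.apply_symm_apply, ZMod.natCast_zmod_val] at h1
        simpa using h1
      refine ⟨(e.symm ⟨_, h0⟩, c.1 y), ?_⟩
      simp)

theorem CyclicColoring.coords_apply {α β : Type} {σ : Perm α} {d : ℕ+} (c : CyclicColoring σ d)
    (e : β ≃ {x // c.1 x = 0}) (i : β) (j : ZMod d) : c.coords e (i, j) = (σ ^ j.val) (e i) := rfl

theorem CyclicColoring.apply_coords {α β : Type} {σ : Perm α} {d : ℕ+} (c : CyclicColoring σ d)
    (e : β ≃ {x // c.1 x = 0}) (x : β × ZMod d) : c.1 (c.coords e x) = x.2 := by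
  obtain ⟨i, j⟩ := x
  rw [coords_apply, c.pow_apply, (e i).2, zero_add, ZMod.natCast_zmod_val]

/-- Normal form of a permutation with a cyclic colouring: each point is a power of `σ`, with
exponent below `d`, applied to a unique point of colour zero. The only remaining datum is the
first-return permutation `rootPerm`. -/
theorem CyclicColoring.permCongr_coords {α β : Type} {σ : Perm α} {d : ℕ+} (c : CyclicColoring σ d)
    (e : β ≃ {x // c.1 x = 0}) :
    (c.coords e).permCongr (cyclicPerm (e.symm.permCongr c.rootPerm) d) = σ := by
  ext y
  obtain ⟨⟨i, j⟩, rfl⟩ := (c.coords e).surjective y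
  rw [Equiv.permCongr_apply, Equiv.symm_apply_apply, cyclicPerm_apply, coords_apply, coords_apply,
    ← Perm.mul_apply, ← pow_succ']
  have hj := ZMod.val_lt j
  rcases Nat.lt_or_ge (j.val + 1) d with h | h
  · have h1 : j + 1 ≠ 0 := fun h0 => by
      have h2 : ((j.val + 1 : ℕ) : ZMod d) = 0 := by
        push_cast; rw [ZMod.natCast_zmod_val]; exact h0
      rw [ZMod.natCast_eq_zero_iff] at h2
      exact absurd (Nat.le_of_dvd (Nat.succ_pos _) h2) (by omega)
    have h3 : (j + 1).val = j.val + 1 := by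
      have : j + 1 = ((j.val + 1 : ℕ) : ZMod d) := by push_cast; rw [ZMod.natCast_zmod_val]
      rw [this, ZMod.val_natCast, Nat.mod_eq_of_lt h]
    rw [if_neg h1, h3]
  -- Wrap-around: the total exponent of `σ` reaches `d`, and the point comes back to colour zero
  -- through `rootPerm`.
  · have h2 : j.val + 1 = d := by omega
    have h1 : j + 1 = 0 := by
      have : j + 1 = ((j.val + 1 : ℕ) : ZMod d) := by push_cast; rw [ZMod.natCast_zmod_val]
      rw [this, h2, ZMod.natCast_self]
    rw [if_pos h1, h1, h2, ZMod.val_zero, pow_zero, Perm.one_apply, Equiv.permCongr_apply,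
      Equiv.symm_symm, Equiv.apply_symm_apply, coe_rootPerm_apply]

theorem CyclicColoring.cyc_eq {α : Type} [Finite α] {σ : Perm α} {d : ℕ+} (c : CyclicColoring σ d) :
    cyc σ = (cyc c.rootPerm).embDomain (mulLeftEmbedding d) := by
  conv_lhs => rw [← c.permCongr_coords (Equiv.refl _)]
  rw [cyc_conj, cyc_cyclicPerm]
  rfl

theorem permCongr_pow_apply {α β : Type} (e : α ≃ β) (σ : Perm α) (n : ℕ) (x : α) :
    (e.permCongr σ ^ n) (e x) = e ((σ ^ n) x) := by
  induction n generalizing x with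
  | zero => rfl
  | succ n ih =>
    rw [pow_succ', Perm.mul_apply, ih, pow_succ', Perm.mul_apply, Equiv.permCongr_apply,
      Equiv.symm_apply_apply]

/-- Cyclic colourings with an enumeration of the points of colour zero. -/
abbrev EnumColoring (α β : Type) (d : ℕ+) : Type :=
  Σ σ : Perm α, Σ c : CyclicColoring σ d, β ≃ {x // c.1 x = 0}

def EnumColoring.toPair {α β : Type} {d : ℕ+} (x : EnumColoring α β d) :
    (β × ZMod d ≃ α) × Perm β :=
  (x.2.1.coords x.2.2, x.2.2.symm.permCongr x.2.1.rootPerm)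

/-- The normal form recovers `σ`; the colouring is then the second coordinate, and the enumeration
consists of the points whose second coordinate is zero. Conversely, conjugating `cyclicPerm τ d` by
any bijection yields such data. -/
theorem EnumColoring.toPair_bijective {α β : Type} {d : ℕ+} :
    Function.Bijective (toPair : EnumColoring α β d → _) := by
  constructor
  · rintro ⟨σ, c, e⟩ ⟨σ', c', e'⟩ h
    have h1 : c.coords e = c'.coords e' := congrArg Prod.fst h
    have h2 : e.symm.permCongr c.rootPerm = e'.symm.permCongr c'.rootPerm := congrArg Prod.snd h
    have h3 : σ = σ' := by
      rw [← c.permCongr_coords e, h1, h2, c'.permCongr_coords e']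
    subst h3
    have h4 : c = c' := by
      refine Subtype.ext (funext fun y => ?_)
      obtain ⟨x, rfl⟩ := (c.coords e).surjective y
      rw [c.apply_coords]
      conv_rhs => rw [h1]
      rw [c'.apply_coords]
    subst h4
    have h5 : e = e' := by
      refine Equiv.ext fun i => Subtype.ext ?_
      have h6 := Equiv.congr_fun h1 (i, 0)
      simpa [CyclicColoring.coords_apply] using h6
    rw [h5]
  · rintro ⟨f, τ⟩
    let c : CyclicColoring (f.permCongr (cyclicPerm τ d)) d :=
      ⟨fun y => (f.symm y).2, fun y => by
        rw [Equiv.permCongr_apply]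
        simp only [Equiv.symm_apply_apply]
        rfl⟩
    let e : β ≃ {x // c.1 x = 0} := Equiv.ofBijective
      (fun i => ⟨f (i, 0), by change (f.symm (f (i, 0))).2 = 0; rw [Equiv.symm_apply_apply]⟩) (by
        constructor
        · intro i i' h
          have h1 := f.injective (congrArg Subtype.val h)
          exact congrArg Prod.fst h1
        · rintro ⟨y, hy⟩
          refine ⟨(f.symm y).1, Subtype.ext ?_⟩
          change f ((f.symm y).1, 0) = y
          rw [← hy]
          exact f.apply_symm_apply y)
    have he : ∀ i, (e i : α) = f (i, 0) := fun i => rfl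
    refine ⟨⟨_, c, e⟩, Prod.ext ?_ ?_⟩
    · refine Equiv.ext fun x => ?_
      obtain ⟨i, j⟩ := x
      change c.coords e (i, j) = f (i, j)
      rw [c.coords_apply, he, permCongr_pow_apply, cyclicPerm_pow_val]
    · refine Equiv.ext fun i => e.injective (Subtype.ext ?_)
      change ((e (e.symm.permCongr c.rootPerm i) : {x // c.1 x = 0}) : α) = e (τ i)
      rw [Equiv.permCongr_apply, Equiv.symm_symm, Equiv.apply_symm_apply, c.coe_rootPerm_apply, he,
        permCongr_pow_apply, cyclicPerm_pow_zero, he]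

/-- The class function whose cycle index series is the plethysm `p_d ∘ F`. -/
def adFun (d : ℕ+) (F : ∀ α : Type, Perm α → ℚ) : ∀ α : Type, Perm α → ℚ := fun _ σ =>
  ∑ᶠ c : CyclicColoring σ d, F {x // c.1 x = 0} c.rootPerm

theorem IsClassFun.adFun {F : ∀ α : Type, Perm α → ℚ} (hF : IsClassFun F) (d : ℕ+) :
    IsClassFun (adFun d F) := by
  intro α β e σ
  let f : CyclicColoring σ d ≃ CyclicColoring (e.permCongr σ) d :=
    { toFun := fun c => ⟨fun y => c.1 (e.symm y), fun y => by
        rw [Equiv.permCongr_apply]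
        simp only [Equiv.symm_apply_apply, c.2]⟩
      invFun := fun c => ⟨fun x => c.1 (e x), fun x => by
        rw [← c.2, Equiv.permCongr_apply, Equiv.symm_apply_apply]⟩
      left_inv := fun c => by ext x; simp
      right_inv := fun c => by ext x; simp }
  refine (finsum_eq_of_bijective f f.bijective fun c => ?_).symm
  let e' : {x // c.1 x = 0} ≃ {y // (f c).1 y = 0} := e.subtypeEquiv fun x => by
    change _ ↔ c.1 (e.symm (e x)) = 0
    rw [Equiv.symm_apply_apply]
  rw [← hF _ _ e' c.rootPerm]
  congr 1
  refine Equiv.ext fun y => Subtype.ext ?_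
  obtain ⟨x, rfl⟩ := e'.surjective y
  rw [Equiv.permCongr_apply, Equiv.symm_apply_apply, (f c).coe_rootPerm_apply]
  change e ((σ ^ (d : ℕ)) x) = ((e.permCongr σ) ^ (d : ℕ)) (e x)
  rw [permCongr_pow_apply]

/-- Double counting of `EnumColoring`: a set of colour zero with `b` points has `b!` enumerations,
while by `toPair_bijective` the data amount to one of `(d b)!` bijections together with a
permutation of `Fin b`. -/
theorem sum_cyclicColoring {α : Type} [Fintype α] [DecidableEq α] (d : ℕ+) (b : ℕ)
    (F : ∀ α : Type, Perm α → ℚ) (hF : IsClassFun F) {y : ℕ+ →₀ ℕ} (hy : degree y = b)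
    (hα : Fintype.card α = d * b) :
    (b.factorial : ℚ) * ∑ σ : Perm α, ∑ᶠ c : CyclicColoring σ d,
      (if cyc c.rootPerm = y then F _ c.rootPerm else 0) =
      ((Fintype.card α).factorial : ℚ) * wsum F (Fin b) y := by
  classical
  have : ∀ σ : Perm α, Fintype (CyclicColoring σ d) := fun σ => Fintype.ofFinite _
  have h1 : ∀ (σ : Perm α) (c : CyclicColoring σ d),
      (b.factorial : ℚ) * (if cyc c.rootPerm = y then F _ c.rootPerm else 0) =
      ∑ e : Fin b ≃ {x // c.1 x = 0}, (if cyc (e.symm.permCongr c.rootPerm) = y then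
        F _ (e.symm.permCongr c.rootPerm) else 0) := by
    intro σ c
    simp only [cyc_conj, hF _ _]
    rw [Finset.sum_const, nsmul_eq_mul, Finset.card_univ]
    split_ifs with h
    · have h2 : Nat.card {x // c.1 x = 0} = b := by rw [← degree_cyc c.rootPerm, h, hy]
      rw [Fintype.card_equiv (Fintype.equivFinOfCardEq
        (by rw [← Nat.card_eq_fintype_card, h2])).symm, Fintype.card_fin]
    · rw [mul_zero, mul_zero]
  simp only [finsum_eq_sum_of_fintype, Finset.mul_sum, h1]
  have h2 := Fintype.sum_bijective (EnumColoring.toPair (α := α) (β := Fin b) (d := d))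
    EnumColoring.toPair_bijective
    (fun x => if cyc (x.2.2.symm.permCongr x.2.1.rootPerm) = y then
        F _ (x.2.2.symm.permCongr x.2.1.rootPerm) else 0)
    (fun x => if cyc x.2 = y then F _ x.2 else 0) (fun x => rfl)
  rw [Fintype.sum_sigma, Fintype.sum_prod_type] at h2
  simp only [Fintype.sum_sigma] at h2
  rw [h2, Finset.sum_const, Finset.card_univ, nsmul_eq_mul, wsum]
  congr 2
  have h3 : Fintype.card (Fin b × ZMod d) = Fintype.card α := by
    rw [Fintype.card_prod, Fintype.card_fin, ZMod.card, hα, mul_comm]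
  rw [Fintype.card_equiv (Fintype.equivOfCardEq h3), h3]

/-- The cycle lengths of `σ` are `d` times those of `rootPerm`, so only monomials in the `p_{dj}`
occur; for these `sum_cyclicColoring` compares coefficients. -/
theorem cycleIndex_adFun {F : ∀ α : Type, Perm α → ℚ} (hF : IsClassFun F) (d : ℕ+) :
    cycleIndex (adFun d F) = psi d (cycleIndex F) := by
  classical
  ext m
  have : ∀ σ : Perm (Fin (degree m)), Fintype (CyclicColoring σ d) := fun σ => Fintype.ofFinite _
  rw [coeff_cycleIndex, wsum]
  by_cases hm : ∃ y : ℕ+ →₀ ℕ, y.embDomain (mulLeftEmbedding d) = m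
  · obtain ⟨y, hy⟩ := hm
    have hd : degree m = d * degree y := by
      rw [← hy, Finsupp.embDomain_eq_mapDomain, degree_mapDomain]
    have h1 := sum_cyclicColoring (α := Fin (degree m)) d (degree y) F hF rfl
      (by rw [Fintype.card_fin, hd])
    have h2 : ∀ σ : Perm (Fin (degree m)), (if cyc σ = m then adFun d F _ σ else 0) =
        ∑ᶠ c : CyclicColoring σ d, (if cyc c.rootPerm = y then F _ c.rootPerm else 0) := by
      intro σ
      have h3 : ∀ c : CyclicColoring σ d, cyc σ = m ↔ cyc c.rootPerm = y := fun c => by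
        have h4 := c.cyc_eq
        constructor
        · intro h
          exact (Finsupp.embDomain_inj).1 ((h4.symm.trans h).trans hy.symm)
        · intro h
          rw [h4, h, hy]
      simp only [adFun, finsum_eq_sum_of_fintype]
      split_ifs with h
      · exact Finset.sum_congr rfl fun c _ => (if_pos ((h3 c).1 h)).symm
      · exact (Finset.sum_eq_zero fun c _ => if_neg (mt (h3 c).2 h)).symm
    simp only [h2]
    rw [Fintype.card_fin, ← factorial_mul_coeff_cycleIndex F rfl, mul_left_comm] at h1
    have h3 := mul_left_cancel₀ (Nat.cast_ne_zero.2 (Nat.factorial_ne_zero _)) h1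
    have h4 : coeff m (psi d (cycleIndex F)) = coeff y (cycleIndex F) := by
      rw [← hy, psi, coeff_embDomain_rename]
    rw [h3, h4, ← mul_assoc, inv_mul_cancel₀ (Nat.cast_ne_zero.2 (Nat.factorial_ne_zero _)), one_mul]
  · rw [psi, coeff_rename_eq_zero, Finset.sum_eq_zero, mul_zero]
    · intro σ _
      split_ifs with h
      · refine finsum_eq_zero_of_forall_eq_zero fun c => ?_
        exact absurd ⟨_, c.cyc_eq.symm.trans h⟩ hm
      · rfl
    · rintro ⟨y, hy⟩
      exact hm ⟨y, by rw [Finsupp.embDomain_eq_mapDomain, hy]⟩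

end
end PreLieHAL

/-! ### The functional equation of the series of rooted trees. -/

namespace PreLieHAL
open MvPowerSeries Equiv
noncomputable section

/-! ### Characters and cycle index series -/

theorem frobeniusSeries_eq_cycleIndex {V : ℕ → Type} [∀ n, AddCommGroup (V n)]
    [∀ n, Module ℚ (V n)] (ρ : ∀ n, Representation ℚ (Equiv.Perm (Fin n)) (V n))
    {F : ∀ α : Type, Perm α → ℚ} (h : ∀ n (σ : Perm (Fin n)), (ρ n).character σ = F _ σ) :
    frobeniusSeries ρ = cycleIndex F := by
  classical
  ext m
  change coeff m (frobenius (ρ (degree m))) = _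
  rw [coeff_cycleIndex, frobenius, coeff_smul, map_sum, wsum]
  congr 1
  refine Finset.sum_congr rfl fun σ _ => ?_
  rw [coeff_monomial, cyc_fin, h]
  simp only [eq_comm]

theorem trace_lmapDomain {X : Type} [Finite X] (f : X → X) :
    LinearMap.trace ℚ (X →₀ ℚ) (Finsupp.lmapDomain ℚ ℚ f) = Nat.card {x // f x = x} := by
  classical
  let := Fintype.ofFinite X
  rw [LinearMap.trace_eq_matrix_trace ℚ Finsupp.basisSingleOne, Matrix.trace]
  rw [Nat.card_eq_fintype_card, Fintype.card_subtype, Finset.card_filter, Nat.cast_sum]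
  refine Finset.sum_congr rfl fun x _ => ?_
  rw [Matrix.diag_apply, LinearMap.toMatrix_apply]
  simp [Finsupp.mapDomain_single, Finsupp.single_apply]

theorem natCard_eq_sum_of_existsUnique {X Y : Type} [Finite X] [Fintype Y] (R : X → Y → Prop)
    (h : ∀ x, ∃! y, R x y) : Nat.card X = ∑ y, Nat.card {x // R x y} := by
  rw [← Nat.card_sigma]
  choose g hg hu using h
  exact Nat.card_congr
    { toFun := fun x => ⟨g x, x, hg x⟩
      invFun := fun y => y.2.1
      left_inv := fun x => rfl
      right_inv := fun ⟨y, x, hx⟩ => by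
        have : y = g x := hu x y hx
        subst this
        rfl }

theorem cyc_one {α : Type} [Finite α] : cyc (1 : Perm α) = Finsupp.single 1 (Nat.card α) := by
  refine cyc_eq fun k => ?_
  have h : ∀ x : α, Function.minimalPeriod (1 : Perm α) x = 1 := fun x =>
    Function.minimalPeriod_eq_one_iff_isFixedPt.2 rfl
  rw [perCount]
  simp only [h]
  rw [Finsupp.single_apply]
  split_ifs with hk
  · subst hk
    simp
  · rw [mul_zero, Nat.card_eq_zero]
    left
    constructor
    rintro ⟨x, hx⟩
    exact hk (PNat.coe_injective hx)

/-- The class function of one-point sets. -/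
def pointFun : ∀ α : Type, Perm α → ℚ := fun α _ => if Nat.card α = 1 then 1 else 0

theorem isClassFun_pointFun : IsClassFun pointFun := fun α β e σ => by
  rw [pointFun, pointFun, Nat.card_congr e]

theorem cycleIndex_pointFun : cycleIndex pointFun = p 1 := by
  classical
  ext m
  rw [coeff_cycleIndex, coeff_X, wsum]
  by_cases hm : degree m = 1
  · have h1 : ∀ σ : Perm (Fin (degree m)), σ = 1 := fun σ => by
      have : Subsingleton (Fin (degree m)) := by rw [hm]; infer_instance
      exact Subsingleton.elim _ _
    have h2 : ∀ σ : Perm (Fin (degree m)), (if cyc σ = m then pointFun _ σ else 0) =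
      if m = Finsupp.single 1 1 then 1 else 0 := fun σ => by
      rw [h1 σ, cyc_one, pointFun, Nat.card_eq_fintype_card, Fintype.card_fin, if_pos hm, hm]
      simp only [eq_comm]
    rw [Finset.sum_congr rfl fun σ _ => h2 σ, Finset.sum_const, Finset.card_univ, Fintype.card_perm,
      Fintype.card_fin, hm]
    simp
  · rw [Finset.sum_eq_zero, mul_zero, if_neg]
    · rintro rfl
      exact hm (by simp [degree, Finsupp.weight_single])
    · intro σ _
      rw [pointFun, Nat.card_eq_fintype_card, Fintype.card_fin, if_neg hm, ite_self]

/-! ### Rooted trees and forests as functions -/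

/-- A forest, as the function sending each vertex to its parent and each root to itself. -/
def IsForest {α : Type} (f : α → α) : Prop := ∀ x, ∃ k : ℕ, f (f^[k] x) = f^[k] x

/-- A rooted tree, as the function sending each vertex to its parent and the root to itself. -/
def IsTree {α : Type} (f : α → α) : Prop := ∃ r, f r = r ∧ ∀ x, ∃ k : ℕ, f^[k] x = r

theorem iterate_fixed {α : Type} {f : α → α} {r : α} (h : f r = r) (k : ℕ) : f^[k] r = r :=
  Function.iterate_fixed h k

theorem IsTree.isForest {α : Type} {f : α → α} (h : IsTree f) : IsForest f := by
  obtain ⟨r, hr, h⟩ := h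
  intro x
  obtain ⟨k, hk⟩ := h x
  exact ⟨k, by rw [hk, hr]⟩

theorem IsTree.fixed_unique {α : Type} {f : α → α} (h : IsTree f) {a b : α} (ha : f a = a)
    (hb : f b = b) : a = b := by
  obtain ⟨r, hr, h⟩ := h
  obtain ⟨k, hk⟩ := h a
  obtain ⟨l, hl⟩ := h b
  rw [iterate_fixed ha] at hk
  rw [iterate_fixed hb] at hl
  rw [hk, hl]

/-- The number of rooted trees fixed by a permutation. -/
def treeFun : ∀ α : Type, Perm α → ℚ := fun α σ =>
  Nat.card {f : α → α // IsTree f ∧ ∀ x, f (σ x) = σ (f x)}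

/-- The number of rooted forests fixed by a permutation. -/
def forestFun : ∀ α : Type, Perm α → ℚ := fun α σ =>
  Nat.card {f : α → α // IsForest f ∧ ∀ x, f (σ x) = σ (f x)}

/-- The number of rooted forests fixed by a permutation which permutes their roots transitively. -/
def orbitForestFun : ∀ α : Type, Perm α → ℚ := fun α σ =>
  Nat.card {f : α → α // (IsForest f ∧ ∀ x, f (σ x) = σ (f x)) ∧
    ∀ r r', f r = r → f r' = r' → σ.SameCycle r r'}

theorem arrowCongr_iterate {α β : Type} (e : α ≃ β) (f : α → α) (k : ℕ) (x : α) :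
    (e.arrowCongr e f)^[k] (e x) = e (f^[k] x) := by
  have : Function.Semiconj e f (e.arrowCongr e f) := fun y => by simp
  exact ((this.iterate_right k) x).symm

theorem isForest_arrowCongr {α β : Type} (e : α ≃ β) (f : α → α) :
    IsForest f ↔ IsForest (e.arrowCongr e f) := by
  rw [IsForest, IsForest, ← e.forall_congr_right]
  simp only [arrowCongr_iterate]
  simp

theorem isTree_arrowCongr {α β : Type} (e : α ≃ β) (f : α → α) :
    IsTree f ↔ IsTree (e.arrowCongr e f) := by
  rw [IsTree, IsTree, ← e.exists_congr_right]
  refine exists_congr fun r => and_congr (by simp) ?_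
  rw [← e.forall_congr_right]
  simp only [arrowCongr_iterate, e.injective.eq_iff]

theorem commute_arrowCongr {α β : Type} (e : α ≃ β) (f : α → α) (σ : Perm α) :
    (∀ x, f (σ x) = σ (f x)) ↔
      ∀ y, e.arrowCongr e f (e.permCongr σ y) = e.permCongr σ (e.arrowCongr e f y) := by
  rw [← e.forall_congr_right]
  simp [Equiv.permCongr_apply]

theorem isClassFun_treeFun : IsClassFun treeFun := fun α β e σ => by
  rw [treeFun, treeFun, Nat.cast_inj]
  exact (Nat.card_congr ((e.arrowCongr e).subtypeEquiv fun f =>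
    and_congr (isTree_arrowCongr e f) (commute_arrowCongr e f σ))).symm

theorem isClassFun_forestFun : IsClassFun forestFun := fun α β e σ => by
  rw [forestFun, forestFun, Nat.cast_inj]
  exact (Nat.card_congr ((e.arrowCongr e).subtypeEquiv fun f =>
    and_congr (isForest_arrowCongr e f) (commute_arrowCongr e f σ))).symm

theorem sameCycle_permCongr {α β : Type} (e : α ≃ β) (σ : Perm α) (x y : α) :
    (e.permCongr σ).SameCycle (e x) (e y) ↔ σ.SameCycle x y := by
  refine exists_congr fun i => ?_
  have h : (e.permCongr σ) ^ i = e.permCongr (σ ^ i) := (map_zpow e.permCongrHom σ i).symm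
  rw [h, Equiv.permCongr_apply, Equiv.symm_apply_apply, e.injective.eq_iff]

theorem isClassFun_orbitForestFun : IsClassFun orbitForestFun := fun α β e σ => by
  rw [orbitForestFun, orbitForestFun, Nat.cast_inj]
  refine (Nat.card_congr ((e.arrowCongr e).subtypeEquiv fun f =>
    and_congr (and_congr (isForest_arrowCongr e f) (commute_arrowCongr e f σ)) ?_)).symm
  rw [← e.forall_congr_right]
  refine forall_congr' fun r => ?_
  rw [← e.forall_congr_right]
  simp [sameCycle_permCongr]

/-- Rooted trees are determined by their parent functions. -/
def rootedTreeEquiv (α : Type) : RootedTree α ≃ {f : α → α // IsTree f} :=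
  Equiv.ofBijective (fun T => ⟨T.parent, T.root, T.parent_root, T.reaches_root⟩) (by
    constructor
    · intro T T' h
      have h1 : T.parent = T'.parent := congrArg Subtype.val h
      refine RootedTree.ext ?_ h1
      exact IsTree.fixed_unique ⟨T.root, T.parent_root, T.reaches_root⟩ T.parent_root
        (by rw [h1]; exact T'.parent_root)
    · rintro ⟨f, r, hr, h⟩
      exact ⟨⟨r, f, hr, h⟩, rfl⟩)

theorem PreLie_eq_cycleIndex : PreLie = cycleIndex treeFun := by
  refine frobeniusSeries_eq_cycleIndex _ fun n σ => ?_
  have : Finite (RootedTree (Fin n)) := Finite.of_equiv _ (rootedTreeEquiv (Fin n)).symm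
  have h : Representation.ofMulAction ℚ (Perm (Fin n)) (RootedTree (Fin n)) σ =
      (MonoidAlgebra.coeffLinearEquiv ℚ).symm.conj
        (Finsupp.lmapDomain ℚ ℚ fun T : RootedTree (Fin n) => σ • T) := by
    rw [Representation.ofMulAction_def]
    rfl
  rw [Representation.character, h, LinearMap.trace_conj', trace_lmapDomain, treeFun, Nat.cast_inj]
  refine Nat.card_congr (((rootedTreeEquiv (Fin n)).subtypeEquiv
    (q := fun f => ∀ x, f.1 (σ x) = σ (f.1 x)) fun T => ?_).trans
    (Equiv.subtypeSubtypeEquivSubtypeInter IsTree fun f => ∀ x, f (σ x) = σ (f x)))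
  rw [← (rootedTreeEquiv (Fin n)).injective.eq_iff, Subtype.ext_iff]
  change (fun x => σ (T.parent (σ.symm x))) = T.parent ↔ ∀ x, T.parent (σ x) = σ (T.parent x)
  rw [funext_iff, ← σ.forall_congr_right]
  simp [eq_comm]

end
end PreLieHAL

namespace PreLieHAL
open MvPowerSeries Equiv
noncomputable section

/-- `S` is the subset that a structure singles out. Sorting structures by it gives the terms of
`prodFun`; by `hS`, a subset that is not stable carries no structure. -/
theorem natCard_eq_prodFun {X α : Type} [Finite X] [Fintype α] [DecidableEq α]
    {A B : ∀ α : Type, Perm α → ℚ} {σ : Perm α} (S : X → Finset α)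
    (hS : ∀ x y, σ y ∈ S x ↔ y ∈ S x)
    (h : ∀ (s : Finset α) (hs : ∀ y, σ y ∈ s ↔ y ∈ s), (Nat.card {x // S x = s} : ℚ) =
      A {y // y ∈ s} (σ.subtypePerm hs) *
        B {y // y ∉ s} (σ.subtypePerm fun y => not_congr (hs y))) :
    (Nat.card X : ℚ) = prodFun A B σ := by
  rw [natCard_eq_sum_of_existsUnique (fun x s => S x = s) fun x => existsUnique_eq',
    Nat.cast_sum, prodFun]
  refine Finset.sum_congr rfl fun s _ => ?_
  split_ifs with hs
  · exact h s hs
  · have : IsEmpty {x // S x = s} := ⟨fun x => hs fun y => by rw [← x.2]; exact hS x.1 y⟩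
    rw [Nat.card_of_isEmpty, Nat.cast_zero]

/-! ### Rooted trees are forests attached to a root -/

theorem IsTree.existsUnique_fixed {α : Type} {f : α → α} (h : IsTree f) : ∃! r, f r = r := by
  obtain ⟨r, hr, h'⟩ := h
  exact ⟨r, hr, fun y hy => IsTree.fixed_unique ⟨r, hr, h'⟩ hy hr⟩

section Root

variable {α : Type} {P : α → Prop}

open scoped Classical in
/-- Remove the root of a tree, the only vertex where `P` fails to hold. -/
def removeRoot (P : α → Prop) (f : α → α) (y : {x // P x}) : {x // P x} :=
  if h : P (f y) then ⟨f y, h⟩ else y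

open scoped Classical in
/-- Connect all the roots of a forest to a new root `r`. -/
def addRoot (r : α) (g : {x // P x} → {x // P x}) (y : α) : α :=
  if h : P y then (if g ⟨y, h⟩ = ⟨y, h⟩ then r else g ⟨y, h⟩) else y

theorem isForest_removeRoot {r : α} (hr : ∀ y, ¬ P y ↔ y = r) {f : α → α}
    (hf : IsTree f) (hfr : f r = r) : IsForest (removeRoot P f) := by
  obtain ⟨r', hr', h⟩ := hf
  have hrr : r' = r := IsTree.fixed_unique ⟨r', hr', h⟩ hr' hfr
  subst hrr
  have key : ∀ (k : ℕ) (y : {x // P x}), f^[k] y = r' →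
      ∃ j : ℕ, removeRoot P f ((removeRoot P f)^[j] y) = (removeRoot P f)^[j] y := by
    intro k
    induction k with
    | zero => exact fun y hy => absurd y.2 ((hr y).2 hy)
    | succ k ih =>
      intro y hy
      by_cases hP : P (f y)
      · have h1 : removeRoot P f y = ⟨f y, hP⟩ := dif_pos hP
        obtain ⟨j, hj⟩ := ih ⟨f y, hP⟩ hy
        exact ⟨j + 1, by rw [Function.iterate_succ_apply, h1, hj]⟩
      · exact ⟨0, dif_neg hP⟩
  intro y
  obtain ⟨k, hk⟩ := h y
  exact key k y hk

theorem isTree_addRoot {r : α} (hr : ∀ y, ¬ P y ↔ y = r) {g : {x // P x} → {x // P x}}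
    (hg : IsForest g) : IsTree (addRoot r g) := by
  have hrr : addRoot r g r = r := dif_neg ((hr r).2 rfl)
  have key : ∀ (k : ℕ) (y : {x // P x}), g (g^[k] y) = g^[k] y →
      ∃ j : ℕ, (addRoot r g)^[j] y = r := by
    intro k
    induction k with
    | zero =>
      intro y hy
      exact ⟨1, by rw [Function.iterate_one, addRoot, dif_pos y.2]; exact if_pos hy⟩
    | succ k ih =>
      intro y hy
      by_cases h : g y = y
      · exact ⟨1, by rw [Function.iterate_one, addRoot, dif_pos y.2]; exact if_pos h⟩
      · obtain ⟨j, hj⟩ := ih (g y) hy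
        refine ⟨j + 1, ?_⟩
        have h1 : addRoot r g y = g y := by rw [addRoot, dif_pos y.2]; exact if_neg h
        rw [Function.iterate_succ_apply, h1, hj]
  refine ⟨r, hrr, fun y => ?_⟩
  by_cases hy : P y
  · obtain ⟨k, hk⟩ := hg ⟨y, hy⟩
    exact key k ⟨y, hy⟩ hk
  · exact ⟨0, (hr y).1 hy⟩

theorem addRoot_removeRoot {r : α} (hr : ∀ y, ¬ P y ↔ y = r) {f : α → α}
    (hf : ∀ y, f y = y ↔ y = r) : addRoot r (removeRoot P f) = f := by
  funext y
  by_cases hy : P y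
  · rw [addRoot, dif_pos hy]
    by_cases hP : P (f y)
    · have h1 : removeRoot P f ⟨y, hy⟩ = ⟨f y, hP⟩ := dif_pos hP
      rw [h1, if_neg]
      intro h
      exact (hr y).2 ((hf y).1 (congrArg Subtype.val h)) hy
    · have h1 : removeRoot P f ⟨y, hy⟩ = ⟨y, hy⟩ := dif_neg hP
      rw [h1, if_pos rfl, (hr _).1 hP]
  · rw [addRoot, dif_neg hy, (hr y).1 hy, (hf r).2 rfl]

open scoped Classical in
theorem removeRoot_addRoot {r : α} (hr : ∀ y, ¬ P y ↔ y = r) (g : {x // P x} → {x // P x}) :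
    removeRoot P (addRoot r g) = g := by
  funext y
  have h0 : addRoot r g y = if g y = y then r else g y := dif_pos y.2
  by_cases h : g y = y
  · rw [if_pos h] at h0
    rw [removeRoot, dif_neg (by rw [h0, hr]), h]
  · rw [if_neg h] at h0
    have h1 : P (addRoot r g y) := by rw [h0]; exact (g y).2
    rw [removeRoot, dif_pos h1]
    exact Subtype.ext h0

theorem removeRoot_comm {σ : Perm α} (hσ : ∀ y, P (σ y) ↔ P y) {f : α → α}
    (hf : ∀ y, f (σ y) = σ (f y)) (y : {x // P x}) :
    removeRoot P f (σ.subtypePerm hσ y) = σ.subtypePerm hσ (removeRoot P f y) := by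
  by_cases hP : P (f y)
  · have h2 : P (f (σ.subtypePerm hσ y)) := by
      rw [Perm.subtypePerm_apply, hf, hσ]; exact hP
    have h1 : removeRoot P f y = ⟨f y, hP⟩ := dif_pos hP
    rw [h1, removeRoot, dif_pos h2]
    exact Subtype.ext (hf y)
  · have h2 : ¬ P (f (σ.subtypePerm hσ y)) := by
      rw [Perm.subtypePerm_apply, hf, hσ]; exact hP
    have h1 : removeRoot P f y = y := dif_neg hP
    rw [h1, removeRoot, dif_neg h2]

open scoped Classical in
theorem addRoot_comm {σ : Perm α} (hσ : ∀ y, P (σ y) ↔ P y) {r : α} (hr : σ r = r)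
    {g : {x // P x} → {x // P x}}
    (hg : ∀ y, g (σ.subtypePerm hσ y) = σ.subtypePerm hσ (g y)) (y : α) :
    addRoot r g (σ y) = σ (addRoot r g y) := by
  by_cases hy : P y
  · have h1 : addRoot r g (σ y) = if g (σ.subtypePerm hσ ⟨y, hy⟩) = σ.subtypePerm hσ ⟨y, hy⟩
      then r else g (σ.subtypePerm hσ ⟨y, hy⟩) := dif_pos ((hσ y).2 hy)
    have h2 : addRoot r g y = if g ⟨y, hy⟩ = ⟨y, hy⟩ then r else g ⟨y, hy⟩ := dif_pos hy
    rw [h1, h2, hg]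
    by_cases h : g ⟨y, hy⟩ = ⟨y, hy⟩
    · rw [if_pos h, if_pos (congrArg _ h), hr]
    · rw [if_neg h, if_neg fun h' => h ((σ.subtypePerm hσ).injective h')]
      rfl
  · rw [addRoot, dif_neg fun h => hy ((hσ y).1 h), addRoot, dif_neg hy]

end Root

/-- The subset singled out is the set of fixed points of the parent function, which is just the
root; `removeRoot` and `addRoot` are inverse to each other on the complement. -/
theorem treeFun_eq_prodFun {α : Type} [Fintype α] [DecidableEq α] (σ : Perm α) :
    treeFun α σ = prodFun pointFun forestFun σ := by
  refine natCard_eq_prodFun (fun f => Finset.univ.filter fun y => f.1 y = y) ?_ ?_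
  · intro f y
    simp [f.2.2]
  · intro s hs
    have hmem : ∀ f : {f : α → α // IsTree f ∧ ∀ x, f (σ x) = σ (f x)},
        Finset.univ.filter (fun y => f.1 y = y) = s ↔ ∀ y, f.1 y = y ↔ y ∈ s := fun f => by
      simp [Finset.ext_iff]
    by_cases h1 : s.card = 1
    · obtain ⟨r, rfl⟩ := Finset.card_eq_one.1 h1
      have hr : ∀ y, ¬ y ∉ ({r} : Finset α) ↔ y = r := fun y => by simp
      have hσr : σ r = r := by simpa using hs r
      rw [pointFun, if_pos (by simp), one_mul, forestFun, Nat.cast_inj]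
      refine Nat.card_congr
        { toFun := fun f => ⟨removeRoot _ f.1.1, isForest_removeRoot hr f.1.2.1
            (by simpa using ((hmem f.1).1 f.2 r)),
            fun y => removeRoot_comm (P := fun y => y ∉ ({r} : Finset α))
              (fun y => not_congr (hs y)) f.1.2.2 y⟩
          invFun := fun g => ⟨⟨addRoot r g.1, isTree_addRoot hr g.2.1,
            addRoot_comm (P := fun y => y ∉ ({r} : Finset α)) (fun y => not_congr (hs y)) hσr g.2.2⟩, (hmem _).2 fun y => ?_⟩
          left_inv := fun f => Subtype.ext (Subtype.ext (addRoot_removeRoot hr fun y => by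
            simpa using ((hmem f.1).1 f.2 y)))
          right_inv := fun g => Subtype.ext (removeRoot_addRoot hr g.1) }
      have h3 : addRoot r g.1 r = r := dif_neg (by simp)
      rw [Finset.mem_singleton]
      exact ⟨fun h => (isTree_addRoot hr g.2.1).fixed_unique h h3, fun h => h ▸ h3⟩
    · rw [pointFun, if_neg (by simpa using h1), zero_mul, Nat.cast_eq_zero, Nat.card_eq_zero]
      left
      constructor
      rintro ⟨f, hf⟩
      obtain ⟨r, hr, hu⟩ := f.2.1.existsUnique_fixed
      refine h1 (Finset.card_eq_one.2 ⟨r, ?_⟩)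
      ext y
      rw [← (hmem f).1 hf, Finset.mem_singleton]
      exact ⟨hu y, fun h => by rw [h, hr]⟩

theorem cycleIndex_treeFun : cycleIndex treeFun = p 1 * cycleIndex forestFun := by
  rw [← cycleIndex_pointFun]
  exact cycleIndex_eq_mul isClassFun_pointFun isClassFun_forestFun fun n σ =>
    treeFun_eq_prodFun σ

end
end PreLieHAL

namespace PreLieHAL
open MvPowerSeries Equiv
noncomputable section

/-! ### The roots of a forest -/

/-- The root of the component of `x` in a forest. -/
def IsForest.root {α : Type} {f : α → α} (h : IsForest f) (x : α) : α := f^[(h x).choose] x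

namespace IsForest

variable {α : Type} {f : α → α}

theorem apply_root (h : IsForest f) (x : α) : f (h.root x) = h.root x := (h x).choose_spec

theorem exists_iterate (h : IsForest f) (x : α) : ∃ k : ℕ, f^[k] x = h.root x := ⟨_, rfl⟩

theorem root_eq (h : IsForest f) {x r : α} {k : ℕ} (hk : f^[k] x = r) (hr : f r = r) :
    h.root x = r := by
  obtain ⟨l, hl⟩ := h.exists_iterate x
  rw [← hl]
  have h1 : f^[l + k] x = r := by rw [Function.iterate_add_apply, hk, iterate_fixed hr]
  rw [add_comm, Function.iterate_add_apply, hl, iterate_fixed (h.apply_root x), ← hl] at h1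
  exact h1

theorem root_of_fixed (h : IsForest f) {r : α} (hr : f r = r) : h.root r = r :=
  h.root_eq (k := 0) rfl hr

theorem root_apply (h : IsForest f) (x : α) : h.root (f x) = h.root x := by
  obtain ⟨k, hk⟩ := h.exists_iterate (f x)
  exact (h.root_eq (k := k + 1) hk (h.apply_root _)).symm

theorem root_perm (h : IsForest f) {σ : Perm α} (hσ : ∀ x, f (σ x) = σ (f x)) (x : α) :
    h.root (σ x) = σ (h.root x) := by
  obtain ⟨k, hk⟩ := h.exists_iterate x
  refine h.root_eq (k := k) ?_ (by rw [hσ, h.apply_root])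
  have h1 : Function.Semiconj σ f f := fun y => (hσ y).symm
  rw [← hk, (h1.iterate_right k) x]

theorem root_pow (h : IsForest f) {σ : Perm α} (hσ : ∀ x, f (σ x) = σ (f x)) (n : ℕ) (x : α) :
    h.root ((σ ^ n) x) = (σ ^ n) (h.root x) := by
  induction n with
  | zero => rfl
  | succ n ih => rw [pow_succ', Perm.mul_apply, h.root_perm hσ, ih, Perm.mul_apply]

/-- A function which is constant along a forest takes the same value at a point and its root. -/
theorem map_root (h : IsForest f) {β : Type} {c : α → β} (hc : ∀ y, c (f y) = c y) (x : α) :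
    c (h.root x) = c x := by
  obtain ⟨k, hk⟩ := h.exists_iterate x
  rw [← hk]
  clear hk
  induction k with
  | zero => rfl
  | succ k ih => rw [Function.iterate_succ_apply', hc, ih]

end IsForest

/-! ### Gluing forests -/

section Glue

variable {α : Type} {P : α → Prop}

/-- The restriction of a function to a stable subset. -/
def restrictFun (f : α → α) (h : ∀ x, P (f x) ↔ P x) (x : {x // P x}) : {x // P x} :=
  ⟨f x, (h x).2 x.2⟩

theorem restrictFun_iterate {f : α → α} (h : ∀ x, P (f x) ↔ P x) (k : ℕ) (x : {x // P x}) :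
    ((restrictFun f h)^[k] x : α) = f^[k] x := by
  have : Function.Semiconj Subtype.val (restrictFun f h) f := fun y => rfl
  exact (this.iterate_right k) x

theorem IsForest.restrictFun {f : α → α} (hf : IsForest f) (h : ∀ x, P (f x) ↔ P x) :
    IsForest (restrictFun f h) := by
  intro x
  obtain ⟨k, hk⟩ := hf x
  refine ⟨k, Subtype.ext ?_⟩
  change f _ = _
  rw [restrictFun_iterate, hk]

open scoped Classical in
/-- Glue a function on a subset and a function on its complement. -/
def glueFun (f : {x // P x} → {x // P x}) (g : {x // ¬ P x} → {x // ¬ P x}) (x : α) : α :=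
  if h : P x then f ⟨x, h⟩ else g ⟨x, h⟩

variable (f : {x // P x} → {x // P x}) (g : {x // ¬ P x} → {x // ¬ P x})

theorem glueFun_left (x : {x // P x}) : glueFun f g x = f x := dif_pos x.2

theorem glueFun_right (x : {x // ¬ P x}) : glueFun f g x = g x := dif_neg x.2

theorem glueFun_mem (x : α) : P (glueFun f g x) ↔ P x := by
  by_cases h : P x
  · rw [glueFun_left f g ⟨x, h⟩]
    exact iff_of_true (f _).2 h
  · rw [glueFun_right f g ⟨x, h⟩]
    exact iff_of_false (g _).2 h

theorem restrictFun_glueFun_left (h : ∀ x, P (glueFun f g x) ↔ P x) :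
    restrictFun (glueFun f g) h = f :=
  funext fun x => Subtype.ext (glueFun_left f g x)

theorem restrictFun_glueFun_right (h : ∀ x, ¬ P (glueFun f g x) ↔ ¬ P x) :
    restrictFun (glueFun f g) h = g :=
  funext fun x => Subtype.ext (glueFun_right f g x)

theorem glueFun_restrictFun (f : α → α) (h : ∀ x, P (f x) ↔ P x) (h' : ∀ x, ¬ P (f x) ↔ ¬ P x) :
    glueFun (restrictFun f h) (restrictFun f h') = f := by
  funext x
  by_cases hx : P x
  · exact glueFun_left _ _ ⟨x, hx⟩
  · exact glueFun_right _ _ ⟨x, hx⟩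

variable {f g}

theorem IsForest.glueFun (hf : IsForest f) (hg : IsForest g) : IsForest (glueFun f g) := by
  have h1 : Function.Semiconj Subtype.val f (PreLieHAL.glueFun f g) := fun y =>
    (glueFun_left f g y).symm
  have h2 : Function.Semiconj Subtype.val g (PreLieHAL.glueFun f g) := fun y =>
    (glueFun_right f g y).symm
  intro x
  by_cases hx : P x
  · obtain ⟨k, hk⟩ := hf ⟨x, hx⟩
    refine ⟨k, ?_⟩
    rw [← (h1.iterate_right k) ⟨x, hx⟩, ← h1, hk]
  · obtain ⟨k, hk⟩ := hg ⟨x, hx⟩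
    refine ⟨k, ?_⟩
    rw [← (h2.iterate_right k) ⟨x, hx⟩, ← h2, hk]

theorem glueFun_comm {σ : Perm α} (hσ : ∀ x, P (σ x) ↔ P x)
    (hf : ∀ x, f (σ.subtypePerm hσ x) = σ.subtypePerm hσ (f x))
    (hg : ∀ x, g (σ.subtypePerm (fun x => not_congr (hσ x)) x) =
      σ.subtypePerm (fun x => not_congr (hσ x)) (g x)) (x : α) :
    glueFun f g (σ x) = σ (glueFun f g x) := by
  by_cases hx : P x
  · rw [glueFun_left f g ⟨x, hx⟩]
    refine (glueFun_left f g ⟨σ x, (hσ x).2 hx⟩).trans (congrArg Subtype.val (hf ⟨x, hx⟩))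
  · rw [glueFun_right f g ⟨x, hx⟩]
    refine (glueFun_right f g ⟨σ x, fun h => hx ((hσ x).1 h)⟩).trans
      (congrArg Subtype.val (hg ⟨x, hx⟩))

end Glue

/-- Mark a vertex `x`. The trees whose roots lie in the `σ`-orbit of the root of `x` cover a stable
subset containing `x`. The forest restricts to this subset, where its roots form one orbit, and to
the complement, and the two restrictions can be glued back. -/
theorem card_mul_forestFun {α : Type} [Fintype α] [DecidableEq α] (σ : Perm α) :
    Nat.card α * forestFun α σ =
      prodFun (fun β τ => Nat.card β * orbitForestFun β τ) forestFun σ := by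
  classical
  rw [forestFun, ← Nat.cast_mul, ← Nat.card_prod]
  refine natCard_eq_prodFun
    (fun x => Finset.univ.filter fun y => σ.SameCycle (x.2.2.1.root x.1) (x.2.2.1.root y)) ?_ ?_
  · rintro ⟨x, f, hf, hfσ⟩ y
    simp [hf.root_perm hfσ]
  · intro s hs
    rw [forestFun, orbitForestFun, ← Nat.cast_mul, ← Nat.cast_mul, ← Nat.card_prod, ← Nat.card_prod,
      Nat.cast_inj]
    have hmem : ∀ x : α × {f : α → α // IsForest f ∧ ∀ x, f (σ x) = σ (f x)},
        Finset.univ.filter (fun y => σ.SameCycle (x.2.2.1.root x.1) (x.2.2.1.root y)) = s ↔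
          ∀ y, σ.SameCycle (x.2.2.1.root x.1) (x.2.2.1.root y) ↔ y ∈ s := fun f => by
      simp [Finset.ext_iff]
    have hst : ∀ x : {x : α × {f : α → α // IsForest f ∧ ∀ x, f (σ x) = σ (f x)} //
        Finset.univ.filter (fun y => σ.SameCycle (x.2.2.1.root x.1) (x.2.2.1.root y)) = s},
        ∀ y, x.1.2.1 y ∈ s ↔ y ∈ s := fun x y => by
      rw [← (hmem x.1).1 x.2, ← (hmem x.1).1 x.2, IsForest.root_apply]
    refine Nat.card_congr
      { toFun := fun x => ((⟨x.1.1, ((hmem x.1).1 x.2 _).1 (Perm.SameCycle.refl _ _)⟩,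
          ⟨restrictFun x.1.2.1 (hst x), ⟨x.1.2.2.1.restrictFun _,
            fun y => Subtype.ext (x.1.2.2.2 y)⟩, fun r r' hr hr' => ?_⟩),
          ⟨restrictFun x.1.2.1 fun y => not_congr (hst x y), x.1.2.2.1.restrictFun _,
            fun y => Subtype.ext (x.1.2.2.2 y)⟩)
        invFun := fun x => ⟨(x.1.1, ⟨glueFun x.1.2.1 x.2.1, x.1.2.2.1.1.glueFun x.2.2.1,
          glueFun_comm hs x.1.2.2.1.2 x.2.2.2⟩), (hmem _).2 fun y => ?_⟩
        left_inv := fun x => Subtype.ext (Prod.ext rfl (Subtype.ext (glueFun_restrictFun _ (hst x)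
          fun y => not_congr (hst x y))))
        right_inv := fun x => Prod.ext
          (Prod.ext rfl (Subtype.ext (restrictFun_glueFun_left _ _ (glueFun_mem _ _))))
          (Subtype.ext (restrictFun_glueFun_right _ _ fun y => not_congr (glueFun_mem _ _ y))) }
    · rw [Perm.sameCycle_subtypePerm]
      have h1 := ((hmem x.1).1 x.2 r).2 r.2
      have h2 := ((hmem x.1).1 x.2 r').2 r'.2
      rw [IsForest.root_of_fixed _ (congrArg Subtype.val hr)] at h1
      rw [IsForest.root_of_fixed _ (congrArg Subtype.val hr')] at h2
      exact h1.symm.trans h2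
    · obtain ⟨⟨x, f, ⟨hf, hfσ⟩, hO⟩, g, hg, hgσ⟩ := x
      have hF : IsForest (glueFun f g) := hf.glueFun hg
      -- Membership in `s` is constant along the glued forest, so a vertex and its root lie on the
      -- same side.
      have hm : ∀ y, hF.root y ∈ s ↔ y ∈ s := fun y =>
        iff_of_eq (hF.map_root (c := fun y => y ∈ s) (fun y => propext (glueFun_mem f g y)) y)
      have hfix : ∀ y (hy : y ∈ s), f ⟨hF.root y, (hm y).2 hy⟩ = ⟨hF.root y, (hm y).2 hy⟩ :=
        fun y hy => Subtype.ext (((glueFun_left f g ⟨hF.root y, (hm y).2 hy⟩).symm).trans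
          (hF.apply_root y))
      change σ.SameCycle (hF.root x) (hF.root y) ↔ y ∈ s
      constructor
      · intro h
        obtain ⟨i, -, hi⟩ := h.exists_pow_eq'
        rw [← hm, ← hi]
        clear hi
        induction i with
        | zero => exact (hm x).2 x.2
        | succ i ih => rw [pow_succ', Perm.mul_apply, hs]; exact ih
      · intro hy
        exact Perm.sameCycle_subtypePerm.1 (hO _ _ (hfix x x.2) (hfix y hy))

theorem IsClassFun.card_mul {F : ∀ α : Type, Perm α → ℚ} (hF : IsClassFun F) :
    IsClassFun fun α σ => Nat.card α * F α σ := fun α β e σ => by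
  dsimp only
  rw [hF, Nat.card_congr e]

theorem euler_cycleIndex_forestFun : euler (cycleIndex forestFun) =
    cycleIndex (fun α σ => Nat.card α * orbitForestFun α σ) * cycleIndex forestFun := by
  rw [euler_cycleIndex]
  exact cycleIndex_eq_mul isClassFun_orbitForestFun.card_mul isClassFun_forestFun fun n σ =>
    card_mul_forestFun σ

end
end PreLieHAL

namespace PreLieHAL
open MvPowerSeries Equiv
noncomputable section

/-! ### Forests with an orbit of roots are forests of isomorphic trees -/

theorem zpow_apply_eq_iff {α : Type} (σ : Perm α) (r : α) (a b : ℤ) :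
    (σ ^ a) r = (σ ^ b) r ↔ (a : ZMod (Function.minimalPeriod σ r)) = b := by
  have h := MulAction.zpow_smul_eq_iff_minimalPeriod_dvd (a := σ) (b := r) (n := a - b)
  rw [ZMod.intCast_eq_intCast_iff_dvd_sub, ← dvd_neg, neg_sub]
  refine Iff.trans ?_ h
  rw [sub_eq_neg_add, zpow_add, zpow_neg, Perm.smul_def, Perm.mul_apply, Perm.inv_eq_iff_eq]

variable {α : Type} {σ : Perm α} {d : ℕ+}

/-- A colouring is compatible with a forest when it is constant on the trees of the forest and
distinguishes their roots. -/
def CyclicColoring.Compatible (c : CyclicColoring σ d) (f : α → α) : Prop :=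
  (∀ y, c.1 (f y) = c.1 y) ∧
    ∀ r r', f r = r → f r' = r' → c.1 r = 0 → c.1 r' = 0 → r = r'

/-- Only one root has colour zero, so `σ ^ n` fixes it exactly when it preserves its colour. This
makes `d` the length of the orbit of roots. -/
theorem CyclicColoring.Compatible.pow_apply_eq_iff {c : CyclicColoring σ d} {f : α → α}
    (h : c.Compatible f) (hf : IsForest f) (hfσ : ∀ x, f (σ x) = σ (f x)) {x : α} (hx : c.1 x = 0)
    (n : ℕ) : (σ ^ n) (hf.root x) = hf.root x ↔ (d : ℕ) ∣ n := by
  have h0 : c.1 (hf.root x) = 0 := by rw [hf.map_root h.1, hx]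
  rw [← ZMod.natCast_eq_zero_iff]
  constructor
  · intro hn
    have h1 := c.pow_apply n (hf.root x)
    rwa [hn, h0, zero_add, eq_comm] at h1
  · intro hn
    refine h.2 _ _ ?_ (hf.apply_root x) (by rw [c.pow_apply, h0, hn, zero_add]) h0
    rw [← hf.root_pow hfσ, hf.apply_root]

theorem CyclicColoring.Compatible.minimalPeriod_eq {c : CyclicColoring σ d} {f : α → α}
    (h : c.Compatible f) (hf : IsForest f) (hfσ : ∀ x, f (σ x) = σ (f x)) {x : α}
    (hx : c.1 x = 0) : (d : ℕ) = Function.minimalPeriod σ (hf.root x) := by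
  refine (Nat.dvd_right_iff_eq.1 fun n => ?_)
  rw [← h.pow_apply_eq_iff hf hfσ hx, ← Function.isPeriodicPt_iff_minimalPeriod_dvd,
    Function.IsPeriodicPt, Function.IsFixedPt, Perm.iterate_eq_pow]

theorem CyclicColoring.Compatible.apply_eq {c : CyclicColoring σ d} {f : α → α}
    (h : c.Compatible f) (hf : IsForest f) {x : α}
    (hx : c.1 x = 0) {y : α} {n : ℕ} (hn : (σ ^ n) (hf.root x) = hf.root y) : c.1 y = n := by
  rw [← hf.map_root h.1 y, ← hn, c.pow_apply, hf.map_root h.1, hx, zero_add]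

/-- Colour `y` by the exponent `j` for which `σ ^ j` carries the root of `x` to the root of `y`; it
is well defined modulo the length of the orbit. -/
theorem exists_compatible [Finite α] {f : α → α} (hf : IsForest f)
    (hfσ : ∀ x, f (σ x) = σ (f x)) (hO : ∀ r r', f r = r → f r' = r' → σ.SameCycle r r') (x : α) :
    ∃ c : CyclicColoring σ ⟨_, minimalPeriod_pos σ (hf.root x)⟩, c.1 x = 0 ∧ c.Compatible f := by
  choose j hj using fun y => hO _ _ (hf.apply_root x) (hf.apply_root y)
  refine ⟨⟨fun y => (j y : ZMod (Function.minimalPeriod σ (hf.root x))), fun y => ?_⟩, ?_, ?_, ?_⟩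
  · have h1 : (j (σ y) : ZMod (Function.minimalPeriod σ (hf.root x))) = (j y + 1 : ℤ) := by
      rw [← zpow_apply_eq_iff, hj, hf.root_perm hfσ, add_comm, zpow_add, zpow_one, Perm.mul_apply,
        hj]
    exact h1.trans (by rw [Int.cast_add, Int.cast_one]; rfl)
  · have h1 : (j x : ZMod (Function.minimalPeriod σ (hf.root x))) = (0 : ℤ) := by
      rw [← zpow_apply_eq_iff, hj, zpow_zero, Perm.one_apply]
    exact h1.trans Int.cast_zero
  · intro y
    change (j (f y) : ZMod (Function.minimalPeriod σ (hf.root x))) = j y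
    rw [← zpow_apply_eq_iff, hj, hj, hf.root_apply]
  · have key : ∀ r, f r = r → (j r : ZMod (Function.minimalPeriod σ (hf.root x))) = 0 →
        r = hf.root x := fun r hr h0 => by
      rw [← Int.cast_zero, ← zpow_apply_eq_iff, hj, hf.root_of_fixed hr, zpow_zero,
        Perm.one_apply] at h0
      exact h0
    intro r r' hr hr' h h'
    rw [key r hr h, key r' hr' h']

theorem CyclicColoring.arrowCongr_coords (c : CyclicColoring σ d)
    (g : {x // c.1 x = 0} → {x // c.1 x = 0}) (i : {x // c.1 x = 0}) (j : ZMod d) :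
    (c.coords (Equiv.refl _)).arrowCongr (c.coords (Equiv.refl _)) (Prod.map g id)
      (c.coords (Equiv.refl _) (i, j)) = c.coords (Equiv.refl _) (g i, j) := by
  simp

theorem CyclicColoring.coords_zero (c : CyclicColoring σ d) (i : {x // c.1 x = 0}) :
    c.coords (Equiv.refl _) (i, 0) = i := by
  rw [coords_apply, ZMod.val_zero, pow_zero]
  rfl

/-- Each colour class receives a copy of the tree `g`, transported by powers of `σ`; in coordinates
the forest is `Prod.map g id`. -/
theorem CyclicColoring.exists_forest (c : CyclicColoring σ d)
    {g : {x // c.1 x = 0} → {x // c.1 x = 0}} (hg : IsTree g)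
    (hgσ : ∀ x, g (c.rootPerm x) = c.rootPerm (g x)) :
    ∃ f : α → α, (IsForest f ∧ ∀ x, f (σ x) = σ (f x)) ∧
      (∀ r r', f r = r → f r' = r' → σ.SameCycle r r') ∧ c.Compatible f ∧
        ∀ i : {x // c.1 x = 0}, f i = g i := by
  set e := c.coords (Equiv.refl _) with he
  set f : α → α := e.arrowCongr e (Prod.map g id) with hfdef
  have hfe : ∀ i j, f (e (i, j)) = e (g i, j) := c.arrowCongr_coords g
  obtain ⟨r, hr, -⟩ := hg.existsUnique_fixed
  have hfix : ∀ i j, f (e (i, j)) = e (i, j) → i = r := fun i j h => by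
    rw [hfe, e.injective.eq_iff, Prod.mk.injEq] at h
    exact hg.fixed_unique h.1 hr
  refine ⟨f, ⟨?_, ?_⟩, ?_, ⟨?_, ?_⟩, ?_⟩
  · rw [hfdef, ← isForest_arrowCongr]
    rintro ⟨i, j⟩
    obtain ⟨k, hk⟩ := hg.isForest i
    refine ⟨k, ?_⟩
    rw [Prod.map_iterate, Prod.map_apply, Prod.map_apply, hk]
    rfl
  · rw [← c.permCongr_coords (Equiv.refl _), ← he, hfdef, ← commute_arrowCongr]
    rintro ⟨i, j⟩
    rw [Prod.map_apply, cyclicPerm_apply, cyclicPerm_apply, Prod.map_apply]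
    refine Prod.ext ?_ rfl
    by_cases h : j + 1 = 0
    · exact (congrArg g (if_pos h)).trans ((hgσ i).trans (if_pos h).symm)
    · exact (congrArg g (if_neg h)).trans (if_neg h).symm
  · intro y y' hy hy'
    obtain ⟨⟨i, j⟩, rfl⟩ := e.surjective y
    obtain ⟨⟨i', j'⟩, rfl⟩ := e.surjective y'
    rw [hfix i j hy, hfix i' j' hy', he, coords_apply, coords_apply]
    rw [Perm.sameCycle_pow_left, Perm.sameCycle_pow_right]
  · intro y
    obtain ⟨⟨i, j⟩, rfl⟩ := e.surjective y
    rw [hfe, he, apply_coords, apply_coords]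
  · intro y y' hy hy' h h'
    obtain ⟨⟨i, j⟩, rfl⟩ := e.surjective y
    obtain ⟨⟨i', j'⟩, rfl⟩ := e.surjective y'
    rw [he, apply_coords] at h h'
    dsimp only at h h'
    rw [hfix i j hy, hfix i' j' hy', h, h']
  · intro i
    rw [← c.coords_zero i, ← c.coords_zero (g i)]
    exact hfe i 0

/-- The tree on the points of colour zero determines the forest, since the other trees are its
images under powers of `σ`. -/
theorem CyclicColoring.card_compatible (c : CyclicColoring σ d) {x : α} (hx : c.1 x = 0) :
    Nat.card {f : {f : α → α // (IsForest f ∧ ∀ x, f (σ x) = σ (f x)) ∧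
      ∀ r r', f r = r → f r' = r' → σ.SameCycle r r'} // c.Compatible f.1} =
    Nat.card {g : {x // c.1 x = 0} → {x // c.1 x = 0} // IsTree g ∧
      ∀ x, g (c.rootPerm x) = c.rootPerm (g x)} := by
  have hst : ∀ f : {f : {f : α → α // (IsForest f ∧ ∀ x, f (σ x) = σ (f x)) ∧
      ∀ r r', f r = r → f r' = r' → σ.SameCycle r r'} // c.Compatible f.1},
      ∀ y, c.1 (f.1.1 y) = 0 ↔ c.1 y = 0 := fun f y => by rw [f.2.1]
  have hpow : ∀ f : α → α, (∀ x, f (σ x) = σ (f x)) → ∀ (n : ℕ) x, f ((σ ^ n) x) = (σ ^ n) (f x) :=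
    fun f hf n => by
      induction n with
      | zero => exact fun x => rfl
      | succ n ih => intro x; rw [pow_succ', Perm.mul_apply, hf, ih, Perm.mul_apply]
  refine Nat.card_congr (Equiv.ofBijective (fun f => ⟨restrictFun f.1.1 (hst f),
    ⟨⟨f.1.2.1.1.root x, by rw [f.1.2.1.1.map_root f.2.1, hx]⟩,
      Subtype.ext (f.1.2.1.1.apply_root x), fun y => ?_⟩,
    fun y => Subtype.ext (hpow _ f.1.2.1.2 d y)⟩) ⟨?_, ?_⟩)
  · obtain ⟨k, hk⟩ := f.1.2.1.1.exists_iterate y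
    refine ⟨k, Subtype.ext ?_⟩
    rw [restrictFun_iterate, hk]
    exact f.2.2 _ _ (f.1.2.1.1.apply_root y) (f.1.2.1.1.apply_root x)
      (by rw [f.1.2.1.1.map_root f.2.1, y.2]) (by rw [f.1.2.1.1.map_root f.2.1, hx])
  · intro f f' h
    refine Subtype.ext (Subtype.ext (funext fun y => ?_))
    obtain ⟨⟨i, j⟩, rfl⟩ := (c.coords (Equiv.refl _)).surjective y
    rw [coords_apply, hpow _ f.1.2.1.2, hpow _ f'.1.2.1.2]
    exact congrArg _ (congrArg Subtype.val (congrFun (congrArg Subtype.val h) i))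
  · rintro ⟨g, hg, hgσ⟩
    obtain ⟨f, h1, h2, h3, h4⟩ := c.exists_forest hg hgσ
    exact ⟨⟨⟨f, h1, h2⟩, h3⟩, Subtype.ext (funext fun i => Subtype.ext (h4 i))⟩

/-- Such a forest has exactly one compatible colouring giving colour zero to `x`, with `d` the
length of the orbit of roots. Forests are sorted by this colouring. -/
theorem orbitForestFun_eq_sum [Fintype α] (σ : Perm α) (D : Finset ℕ+)
    (hD : ∀ d : ℕ+, (d : ℕ) ≤ Nat.card α → d ∈ D) (x : α) :
    orbitForestFun α σ = ∑ d ∈ D, ∑ᶠ c : CyclicColoring σ d,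
      (if c.1 x = 0 then treeFun _ c.rootPerm else 0) := by
  classical
  have hfin : ∀ d : ℕ+, Fintype (CyclicColoring σ d) := fun d => Fintype.ofFinite _
  rw [orbitForestFun, natCard_eq_sum_of_existsUnique
    (Y := Σ d : D, {c : CyclicColoring σ d.1 // c.1 x = 0}) (fun f c => c.2.1.Compatible f.1)]
  · rw [Fintype.sum_sigma, Nat.cast_sum, ← Finset.sum_coe_sort D]
    refine Finset.sum_congr rfl fun d _ => ?_
    rw [finsum_eq_sum_of_fintype, ← Finset.sum_filter, Nat.cast_sum]
    rw [Finset.sum_subtype (p := fun c : CyclicColoring σ d.1 => c.1 x = 0) _ (by simp)]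
    refine Finset.sum_congr rfl fun c _ => ?_
    rw [treeFun, Nat.cast_inj]
    exact c.1.card_compatible c.2
  · rintro ⟨f, ⟨hf, hfσ⟩, hO⟩
    obtain ⟨c, hc0, hc⟩ := exists_compatible hf hfσ hO x
    refine ⟨⟨⟨_, hD _ ?_⟩, c, hc0⟩, hc, ?_⟩
    · rw [PNat.mk_coe, Nat.card_eq_fintype_card]
      exact Function.minimalPeriod_le_card
    · rintro ⟨⟨d, hd⟩, c', hc0'⟩ h'
      have h1 := CyclicColoring.Compatible.minimalPeriod_eq h' hf hfσ hc0'
      obtain rfl : d = ⟨_, minimalPeriod_pos σ (hf.root x)⟩ := PNat.coe_injective h1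
      have h2 : c' = c := by
        refine Subtype.ext (funext fun y => ?_)
        obtain ⟨n, -, hn⟩ := (hO _ _ (hf.apply_root x) (hf.apply_root y)).exists_pow_eq'
        rw [CyclicColoring.Compatible.apply_eq h' hf hc0' hn, hc.apply_eq hf hc0 hn]
      subst h2
      rfl

/-- Sum over the marked vertex `x`: a colouring is met once for each of its points of colour zero,
that is, for each vertex of the tree placed there. -/
theorem card_mul_orbitForestFun [Fintype α] (σ : Perm α) (D : Finset ℕ+)
    (hD : ∀ d : ℕ+, (d : ℕ) ≤ Nat.card α → d ∈ D) :
    Nat.card α * orbitForestFun α σ =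
      ∑ d ∈ D, adFun d (fun β τ => Nat.card β * treeFun β τ) α σ := by
  classical
  have hfin : ∀ d : ℕ+, Fintype (CyclicColoring σ d) := fun d => Fintype.ofFinite _
  rw [Nat.card_eq_fintype_card, ← nsmul_eq_mul, ← Finset.card_univ, ← Finset.sum_const,
    Finset.sum_congr rfl fun x _ => orbitForestFun_eq_sum σ D hD x, Finset.sum_comm]
  refine Finset.sum_congr rfl fun d _ => ?_
  rw [adFun, finsum_eq_sum_of_fintype]
  simp only [finsum_eq_sum_of_fintype]
  rw [Finset.sum_comm]
  refine Finset.sum_congr rfl fun c _ => ?_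
  rw [← Finset.sum_filter, Finset.sum_const, nsmul_eq_mul, Nat.card_eq_fintype_card,
    Fintype.card_subtype]

theorem cycleIndex_card_mul_orbitForestFun :
    cycleIndex (fun α σ => Nat.card α * orbitForestFun α σ) = psiSum (euler PreLie) := by
  classical
  ext m
  -- Large enough for the support of the sum defining `psiSum` at `m` and for all orbit lengths
  -- possible in a set of `degree m` elements.
  let D : Finset ℕ+ := (finite_support_coeff_psi (constantCoeff_euler PreLie) m).toFinset ∪
    (Set.finite_Iic (Nat.succPNat (degree m))).toFinset
  have hD : ∀ d : ℕ+, (d : ℕ) ≤ degree m → d ∈ D := fun d hd => by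
    refine Finset.mem_union_right _ ?_
    rw [Set.Finite.mem_toFinset, Set.mem_Iic, ← PNat.coe_le_coe, Nat.succPNat_coe]
    omega
  have h1 : coeff m (cycleIndex fun α σ => Nat.card α * orbitForestFun α σ) =
      coeff m (cycleIndex fun α σ =>
        ∑ d ∈ D, adFun d (fun β τ => Nat.card β * treeFun β τ) α σ) := by
    rw [coeff_cycleIndex, coeff_cycleIndex, wsum, wsum]
    congr 1
    refine Finset.sum_congr rfl fun σ _ => ?_
    rw [card_mul_orbitForestFun σ D (by simpa using hD)]
  rw [h1, cycleIndex_finset_sum, map_sum, coeff_psiSum]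
  rw [finsum_eq_sum_of_support_subset (s := D)]
  · refine Finset.sum_congr rfl fun d _ => ?_
    rw [cycleIndex_adFun isClassFun_treeFun.card_mul, ← euler_cycleIndex, PreLie_eq_cycleIndex]
  · intro d hd
    exact Finset.mem_union_left _ ((Set.Finite.mem_toFinset _).2 hd)

theorem PreLie_eq_mul : PreLie = p 1 * cycleIndex forestFun := by
  rw [PreLie_eq_cycleIndex, cycleIndex_treeFun]

theorem constantCoeff_PreLie : constantCoeff PreLie = 0 := by
  rw [PreLie_eq_mul, map_mul, constantCoeff_X, zero_mul]

/-- A forest is a set of rooted trees. Marking a vertex gives the logarithmic Euler derivative: the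
marked orbit of trees contributes `psiSum (euler PreLie)`. -/
theorem cycleIndex_forestFun : cycleIndex forestFun = plethysticExp PreLie := by
  refine eq_plethysticExp constantCoeff_PreLie ?_ ?_
  · rw [← coeff_zero_eq_constantCoeff_apply, coeff_cycleIndex, wsum]
    have hd : degree 0 = 0 := map_zero _
    have : IsEmpty (Fin (degree 0)) := by rw [hd]; infer_instance
    have h1 : ∀ σ : Perm (Fin (degree 0)), (if cyc σ = 0 then forestFun _ σ else 0) = 1 := by
      intro σ
      rw [if_pos (degree_eq_zero (by rw [degree_cyc, Nat.card_of_isEmpty])), forestFun]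
      have : Unique {f : Fin (degree 0) → Fin (degree 0) //
          IsForest f ∧ ∀ x, f (σ x) = σ (f x)} :=
        { default := ⟨id, fun x => isEmptyElim x, fun x => isEmptyElim x⟩
          uniq := fun f => Subtype.ext (Subsingleton.elim _ _) }
      rw [Nat.card_unique, Nat.cast_one]
    rw [Finset.sum_congr rfl fun σ _ => h1 σ, Finset.sum_const, Finset.card_univ, Fintype.card_perm,
      Fintype.card_fin, hd]
    simp
  · rw [euler_cycleIndex_forestFun, cycleIndex_card_mul_orbitForestFun, mul_comm]

theorem PreLie_eq_p_mul_plethysticExp : PreLie = p 1 * plethysticExp PreLie := by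
  rw [← cycleIndex_forestFun, ← PreLie_eq_mul]

end
end PreLieHAL

/-! ### Multilinear parts of free Lie algebras, elimination and characters. -/

namespace PreLieHAL
open MvPowerSeries Equiv
noncomputable section

/-! ### Multilinear elements of free Lie algebras -/

section Relabel

variable {α β γ : Type}

/-- The homomorphism of free Lie algebras induced by a map between the generators. -/
def mapLie (f : α → β) : FreeLieAlgebra ℚ α →ₗ⁅ℚ⁆ FreeLieAlgebra ℚ β :=
  FreeLieAlgebra.lift ℚ fun i => FreeLieAlgebra.of ℚ (f i)

theorem mapLie_of (f : α → β) (i : α) :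
    mapLie f (FreeLieAlgebra.of ℚ i) = FreeLieAlgebra.of ℚ (f i) :=
  FreeLieAlgebra.lift_of_apply _ i

theorem mapLie_mapLie (g : β → γ) (f : α → β) (x : FreeLieAlgebra ℚ α) :
    mapLie g (mapLie f x) = mapLie (g ∘ f) x := by
  have h : (mapLie g).comp (mapLie f) = mapLie (g ∘ f) := FreeLieAlgebra.hom_ext fun i => by
    rw [LieHom.comp_apply, mapLie_of, mapLie_of, mapLie_of, Function.comp_apply]
  rw [← h]
  rfl

theorem mapLie_id (x : FreeLieAlgebra ℚ α) : mapLie id x = x := by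
  have h : mapLie (id : α → α) = LieHom.id := FreeLieAlgebra.hom_ext fun i => by
    rw [mapLie_of]
    rfl
  rw [h]
  rfl

theorem IsBracketing.mapLie [DecidableEq α] [DecidableEq β] (e : α ↪ β) {S : Finset α}
    {x : FreeLieAlgebra ℚ α} (h : IsBracketing S x) :
    IsBracketing (S.map e) (mapLie e x) := by
  induction h with
  | of i => rw [mapLie_of, Finset.map_singleton]; exact IsBracketing.of _
  | lie h _ _ ihx ihy =>
    rw [LieHom.map_lie, Finset.map_union]
    exact IsBracketing.lie ((Finset.disjoint_map _).2 h) ihx ihy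

/-- The multilinear part of a free Lie algebra. -/
def multilinearLie (α : Type) : Submodule ℚ (FreeLieAlgebra ℚ α) :=
  Submodule.span ℚ {x | ∃ (_ : DecidableEq α) (S : Finset α), (∀ a, a ∈ S) ∧ IsBracketing S x}

theorem IsBracketing.mem_multilinearLie [DecidableEq α] {S : Finset α} {x : FreeLieAlgebra ℚ α}
    (h : IsBracketing S x) (hS : ∀ a, a ∈ S) : x ∈ multilinearLie α :=
  Submodule.subset_span ⟨_, S, hS, h⟩

theorem multilinearLie_le {N : Submodule ℚ (FreeLieAlgebra ℚ α)} [dec : DecidableEq α]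
    (h : ∀ (S : Finset α) x, (∀ a, a ∈ S) → IsBracketing S x → x ∈ N) : multilinearLie α ≤ N := by
  refine Submodule.span_le.2 ?_
  rintro x ⟨dec', S, hS, hx⟩
  obtain rfl : dec = dec' := Subsingleton.elim _ _
  exact h S x hS hx

theorem mapLie_mem (e : α ≃ β) {x : FreeLieAlgebra ℚ α} (hx : x ∈ multilinearLie α) :
    mapLie e x ∈ multilinearLie β := by
  classical
  refine (multilinearLie_le (N := (multilinearLie β).comap
    (mapLie e : FreeLieAlgebra ℚ α →ₗ[ℚ] FreeLieAlgebra ℚ β)) fun S y hS hy => ?_) hx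
  exact (hy.mapLie e.toEmbedding).mem_multilinearLie fun b => by
    rw [Finset.mem_map_equiv]
    exact hS _

/-- The action of a bijection on multilinear elements. -/
def multilinearLieEquiv (e : α ≃ β) : multilinearLie α ≃ₗ[ℚ] multilinearLie β where
  toFun x := ⟨mapLie e x.1, mapLie_mem e x.2⟩
  invFun x := ⟨mapLie e.symm x.1, mapLie_mem e.symm x.2⟩
  map_add' x y := Subtype.ext (map_add (mapLie e) x.1 y.1)
  map_smul' c x := Subtype.ext (map_smul (mapLie e) c x.1)
  left_inv x := Subtype.ext (by
    change mapLie e.symm (mapLie e x.1) = x.1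
    rw [mapLie_mapLie, e.symm_comp_self, mapLie_id])
  right_inv x := Subtype.ext (by
    change mapLie e (mapLie e.symm x.1) = x.1
    rw [mapLie_mapLie, e.self_comp_symm, mapLie_id])

theorem coe_multilinearLieEquiv (e : α ≃ β) (x : multilinearLie α) :
    (multilinearLieEquiv e x : FreeLieAlgebra ℚ β) = mapLie e x.1 := rfl

end Relabel

/-- The character of the multilinear part of the free Lie algebras. -/
def lieFun : ∀ α : Type, Perm α → ℚ := fun α σ =>
  LinearMap.trace ℚ (multilinearLie α) (multilinearLieEquiv σ).toLinearMap

theorem isClassFun_lieFun : IsClassFun lieFun := fun α β e σ => by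
  rw [lieFun, lieFun, ← LinearMap.trace_conj' _ (multilinearLieEquiv e)]
  congr 1
  ext x
  change mapLie (e.permCongr σ) x.1 = mapLie e (mapLie σ (mapLie e.symm x.1))
  rw [mapLie_mapLie, mapLie_mapLie]
  rfl

theorem lieOperad_eq (n : ℕ) : lieOperad n = multilinearLie (Fin n) := by
  refine le_antisymm (Submodule.span_le.2 fun x hx =>
    IsBracketing.mem_multilinearLie hx Finset.mem_univ) (multilinearLie_le fun S x hS hx => ?_)
  obtain rfl : S = Finset.univ := Finset.eq_univ_iff_forall.2 hS
  exact Submodule.subset_span hx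

theorem Lie_eq_cycleIndex : Lie = cycleIndex lieFun := by
  refine frobeniusSeries_eq_cycleIndex _ fun n σ => ?_
  rw [Representation.character, lieFun,
    ← LinearMap.trace_conj' _ (LinearEquiv.ofEq _ _ (lieOperad_eq n))]
  congr 1

/-! ### Left-normed brackets -/

section LeftBracket

variable {α β : Type}

/-- The left-normed bracket `[[…[x, l₁], …], l_k]`. -/
def leftBracket (x : FreeLieAlgebra ℚ α) (l : List α) : FreeLieAlgebra ℚ α :=
  l.foldl (fun y b => ⁅y, FreeLieAlgebra.of ℚ b⁆) x

theorem leftBracket_nil (x : FreeLieAlgebra ℚ α) : leftBracket x [] = x := rfl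

theorem leftBracket_cons (x : FreeLieAlgebra ℚ α) (b : α) (l : List α) :
    leftBracket x (b :: l) = leftBracket ⁅x, FreeLieAlgebra.of ℚ b⁆ l := rfl

theorem leftBracket_append_singleton (x : FreeLieAlgebra ℚ α) (l : List α) (b : α) :
    leftBracket x (l ++ [b]) = ⁅leftBracket x l, FreeLieAlgebra.of ℚ b⁆ := by
  rw [leftBracket, List.foldl_append]
  rfl

theorem mapLie_leftBracket (f : α → β) (x : FreeLieAlgebra ℚ α) (l : List α) :
    mapLie f (leftBracket x l) = leftBracket (mapLie f x) (l.map f) := by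
  induction l generalizing x with
  | nil => rfl
  | cons b l ih => rw [leftBracket_cons, ih, LieHom.map_lie, mapLie_of]; rfl

theorem IsBracketing.leftBracket [DecidableEq α] {l : List α} : ∀ {S : Finset α}
    {x : FreeLieAlgebra ℚ α}, IsBracketing S x → l.Nodup → (∀ b ∈ l, b ∉ S) →
      IsBracketing (S ∪ l.toFinset) (leftBracket x l) := by
  induction l with
  | nil =>
    intro S x hx _ _
    rw [List.toFinset_nil, Finset.union_empty]
    exact hx
  | cons b l ih =>
    intro S x hx hl hS
    rw [List.nodup_cons] at hl
    have h1 : S ∪ (b :: l).toFinset = (S ∪ {b}) ∪ l.toFinset := by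
      rw [List.toFinset_cons, Finset.insert_eq, Finset.union_assoc]
    rw [h1, leftBracket_cons]
    refine ih (IsBracketing.lie ?_ hx (IsBracketing.of b)) hl.2 fun c hc => ?_
    · rw [Finset.disjoint_singleton_right]
      exact hS b List.mem_cons_self
    · rw [Finset.mem_union, Finset.mem_singleton, not_or]
      exact ⟨hS c (List.mem_cons_of_mem _ hc), fun h => hl.1 (h ▸ hc)⟩

/-- The enumerations of a type which start with a given element. -/
def Arrangement (c : α) : Type := {l : List α // (c :: l).Nodup ∧ ∀ a, a ∈ c :: l}

instance [Finite α] (c : α) : Finite (Arrangement c) := by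
  classical
  let := Fintype.ofFinite α
  exact Finite.of_injective (fun l : Arrangement c =>
    (⟨l.1, (List.nodup_cons.1 l.2.1).2⟩ : {l : List α // l.Nodup})) fun l l' h =>
      Subtype.ext (Subtype.mk.inj h)

theorem leftBracket_mem {c : α} (l : Arrangement c) :
    leftBracket (FreeLieAlgebra.of ℚ c) l.1 ∈ multilinearLie α := by
  classical
  have h := l.2.1
  rw [List.nodup_cons] at h
  refine ((IsBracketing.of c).leftBracket h.2 fun b hb => ?_).mem_multilinearLie fun a => ?_
  · rw [Finset.mem_singleton]
    rintro rfl
    exact h.1 hb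
  · have := l.2.2 a
    simpa using this

/-- The span of the left-normed brackets starting with `c` whose letters are the elements
of `S`. -/
def leftBracketSpan (c : α) (S : Finset α) : Submodule ℚ (FreeLieAlgebra ℚ α) :=
  Submodule.span ℚ {x | ∃ l : List α, ((c :: l).Nodup ∧ ∀ a, a ∈ c :: l ↔ a ∈ S) ∧
    x = leftBracket (FreeLieAlgebra.of ℚ c) l}

/-- The second clause makes the induction close: the Jacobi identity rewrites a bracket with an
element free of `c` as iterated right brackets, and antisymmetry brings the factor containing `c` to
the left. -/
theorem IsBracketing.mem_leftBracketSpan [DecidableEq α] (c : α) {S : Finset α}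
    {x : FreeLieAlgebra ℚ α} (h : IsBracketing S x) :
    (c ∈ S → x ∈ leftBracketSpan c S) ∧ (c ∉ S → ∀ S', Disjoint S' S →
      ∀ w ∈ leftBracketSpan c S', ⁅w, x⁆ ∈ leftBracketSpan c (S' ∪ S)) := by
  induction h with
  | of i =>
    refine ⟨fun h => ?_, fun h S' hS' w hw => ?_⟩
    · obtain rfl := Finset.mem_singleton.1 h
      exact Submodule.subset_span ⟨[], by simp, rfl⟩
    · induction hw using Submodule.span_induction with
      | mem w hw =>
        obtain ⟨l, ⟨hl, hm⟩, rfl⟩ := hw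
        refine Submodule.subset_span ⟨l ++ [i], ⟨?_, ?_⟩, (leftBracket_append_singleton _ _ _).symm⟩
        · rw [← List.cons_append, List.nodup_append]
          refine ⟨hl, List.nodup_singleton i, fun a ha b hb hab => ?_⟩
          rw [List.mem_singleton] at hb
          rw [hab, hb, hm] at ha
          exact (Finset.disjoint_singleton_right.1 hS') ha
        · intro a
          rw [← List.cons_append, List.mem_append, hm, Finset.mem_union, List.mem_singleton,
            Finset.mem_singleton]
      | zero => rw [zero_lie]; exact zero_mem _
      | add w w' _ _ h h' => rw [add_lie]; exact add_mem h h'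
      | smul a w _ h => rw [smul_lie]; exact Submodule.smul_mem _ _ h
  | @lie S T x y hST _ _ ihx ihy =>
    refine ⟨fun h => ?_, fun h S' hS' w hw => ?_⟩
    · by_cases hS : c ∈ S
      · exact ihy.2 (Finset.disjoint_left.1 hST hS) S hST _ (ihx.1 hS)
      · have hT : c ∈ T := (Finset.mem_union.1 h).resolve_left hS
        rw [← lie_skew, Finset.union_comm]
        exact neg_mem (ihx.2 hS T hST.symm _ (ihy.1 hT))
    · rw [Finset.mem_union, not_or] at h
      rw [Finset.disjoint_union_right] at hS'
      have h1 := ihy.2 h.2 _ (Finset.disjoint_union_left.2 ⟨hS'.2, hST⟩) _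
        (ihx.2 h.1 _ hS'.1 _ hw)
      have h2 := ihx.2 h.1 _ (Finset.disjoint_union_left.2 ⟨hS'.1, hST.symm⟩) _
        (ihy.2 h.2 _ hS'.2 _ hw)
      rw [Finset.union_assoc] at h1 h2
      rw [Finset.union_comm T S] at h2
      have h3 : ⁅w, ⁅x, y⁆⁆ = ⁅⁅w, x⁆, y⁆ - ⁅⁅w, y⁆, x⁆ := by
        rw [leibniz_lie w x y, ← lie_skew x ⁅w, y⁆, sub_eq_add_neg]
      rw [h3]
      exact sub_mem h1 h2

theorem multilinearLie_eq_span (c : α) : multilinearLie α =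
    Submodule.span ℚ (Set.range fun l : Arrangement c =>
      leftBracket (FreeLieAlgebra.of ℚ c) l.1) := by
  classical
  refine le_antisymm (multilinearLie_le fun S x hS hx => ?_) (Submodule.span_le.2 ?_)
  · refine Submodule.span_mono ?_ ((hx.mem_leftBracketSpan c).1 (hS c))
    rintro _ ⟨l, ⟨hl, hm⟩, rfl⟩
    exact ⟨⟨l, hl, fun a => (hm a).2 (hS a)⟩, rfl⟩
  · rintro _ ⟨l, rfl⟩
    exact leftBracket_mem l

theorem multilinearLie_eq_bot [IsEmpty α] : multilinearLie α = ⊥ := by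
  classical
  rw [eq_bot_iff]
  refine multilinearLie_le fun S x hS hx => ?_
  exfalso
  induction hx with
  | of i => exact isEmptyElim i
  | lie _ _ _ ih _ => exact ih fun a => isEmptyElim a

instance [Finite α] : Module.Finite ℚ (multilinearLie α) := by
  rcases isEmpty_or_nonempty α with h | ⟨⟨c⟩⟩
  · rw [multilinearLie_eq_bot]
    infer_instance
  · rw [multilinearLie_eq_span c]
    exact FiniteDimensional.span_of_finite ℚ (Set.finite_range _)

theorem finrank_multilinearLie_le [Finite α] (c : α) :
    Module.finrank ℚ (multilinearLie α) ≤ Nat.card (Arrangement c) := by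
  classical
  let := Fintype.ofFinite (Arrangement c)
  rw [multilinearLie_eq_span c, Nat.card_eq_fintype_card]
  exact finrank_range_le_card _

attribute [local instance] LieRing.ofAssociativeRing

/-- The action of the free Lie algebra on words for which each generator is prepended. -/
def wordAction : FreeLieAlgebra ℚ α →ₗ⁅ℚ⁆ Module.End ℚ (List α →₀ ℚ) :=
  FreeLieAlgebra.lift ℚ fun a => Finsupp.lmapDomain ℚ ℚ (List.cons a)

theorem wordAction_of (a : α) (v : List α →₀ ℚ) :
    wordAction (FreeLieAlgebra.of ℚ a) v = Finsupp.mapDomain (List.cons a) v := by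
  rw [wordAction, FreeLieAlgebra.lift_of_apply]
  rfl

-- In `[x, b] = x b - b x` the words of `b x` start with `b ≠ a`. So among the words starting with
-- `a`, only `a` followed by `l` and `s` occurs.
open scoped Classical in
theorem wordAction_leftBracket {a : α} (l : List α) (ha : a ∉ l) (s w : List α) :
    wordAction (leftBracket (FreeLieAlgebra.of ℚ a) l) (Finsupp.single s 1) (a :: w) =
      if w = l ++ s then 1 else 0 := by
  induction l using List.reverseRecOn generalizing s with
  | nil =>
    rw [leftBracket_nil, wordAction_of, Finsupp.mapDomain_single, Finsupp.single_apply]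
    simp [eq_comm]
  | append_singleton l b ih =>
    rw [List.mem_append, not_or, List.mem_singleton] at ha
    rw [leftBracket_append_singleton, LieHom.map_lie, LieRing.of_associative_ring_bracket,
      LinearMap.sub_apply, Finsupp.sub_apply, Module.End.mul_apply, Module.End.mul_apply,
      wordAction_of, wordAction_of, Finsupp.mapDomain_single, ih ha.1,
      Finsupp.mapDomain_of_notMem_range, sub_zero, List.append_assoc]
    · rfl
    · rintro ⟨v, hv⟩
      exact ha.2 (List.cons.inj hv).1.symm

/-- The coefficients of the words `c :: l`, after acting on the empty word, separate the left-normed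
brackets. Together with `finrank_multilinearLie_le` these form a basis. -/
theorem card_le_finrank_multilinearLie [Finite α] (c : α) :
    Nat.card (Arrangement c) ≤ Module.finrank ℚ (multilinearLie α) := by
  classical
  let := Fintype.ofFinite (Arrangement c)
  rw [Nat.card_eq_fintype_card]
  refine LinearIndependent.fintype_card_le_finrank (R := ℚ) (b := fun l : Arrangement c =>
    (⟨leftBracket (FreeLieAlgebra.of ℚ c) l.1, leftBracket_mem l⟩ : multilinearLie α)) ?_
  rw [Fintype.linearIndependent_iff]
  intro g hg l
  have h1 : ∑ l' : Arrangement c, g l' • leftBracket (FreeLieAlgebra.of ℚ c) l'.1 = 0 := by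
    have := congrArg Subtype.val hg
    simpa using this
  have h2 := congrArg (fun x => wordAction x (Finsupp.single [] 1) (c :: l.1)) h1
  simp only [map_sum, map_smul, LinearMap.sum_apply, LinearMap.smul_apply, Finsupp.finsetSum_apply,
    Finsupp.smul_apply, map_zero, LinearMap.zero_apply, Finsupp.zero_apply] at h2
  rw [Finset.sum_eq_single l] at h2
  · rwa [wordAction_leftBracket _ (List.nodup_cons.1 l.2.1).1, if_pos (by simp), smul_eq_mul,
      mul_one] at h2
  · intro l' _ hl'
    rw [wordAction_leftBracket _ (List.nodup_cons.1 l'.2.1).1, if_neg, smul_zero]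
    rw [List.append_nil]
    exact fun h => hl' (Subtype.ext h.symm)
  · exact fun h => absurd (Finset.mem_univ _) h

end LeftBracket

end
end PreLieHAL

namespace PreLieHAL
open MvPowerSeries Equiv
noncomputable section

/-! ### Elimination in free Lie algebras -/

section Elimination

variable {κ β : Type}

/-- The homomorphism from the free Lie algebra on `κ` to the free Lie algebra on `κ ⊕ β` which
sends a generator `c` to the left-normed bracket of `c` and of the list `u c`. -/
def elimHom (u : κ → List β) : FreeLieAlgebra ℚ κ →ₗ⁅ℚ⁆ FreeLieAlgebra ℚ (κ ⊕ β) :=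
  FreeLieAlgebra.lift ℚ fun c =>
    leftBracket (FreeLieAlgebra.of ℚ (Sum.inl c)) ((u c).map Sum.inr)

theorem elimHom_of (u : κ → List β) (c : κ) : elimHom u (FreeLieAlgebra.of ℚ c) =
    leftBracket (FreeLieAlgebra.of ℚ (Sum.inl c)) ((u c).map Sum.inr) :=
  FreeLieAlgebra.lift_of_apply _ c

variable [DecidableEq κ]

theorem IsBracketing.elimHom_congr {T : Finset κ} {z : FreeLieAlgebra ℚ κ} (h : IsBracketing T z)
    {u u' : κ → List β} (hu : ∀ c ∈ T, u c = u' c) : elimHom u z = elimHom u' z := by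
  induction h with
  | of c => rw [elimHom_of, elimHom_of, hu c (Finset.mem_singleton_self c)]
  | lie _ _ _ ihx ihy =>
    rw [LieHom.map_lie, LieHom.map_lie, ihx fun c hc => hu c (Finset.mem_union_left _ hc),
      ihy fun c hc => hu c (Finset.mem_union_right _ hc)]

/-- Append a letter to one of the lists. -/
def appendLetter (u : κ → List β) (b : β) (c : κ) : κ → List β :=
  Function.update u c (u c ++ [b])

theorem appendLetter_self (u : κ → List β) (b : β) (c : κ) : appendLetter u b c c = u c ++ [b] :=
  Function.update_self ..

theorem appendLetter_of_ne (u : κ → List β) (b : β) {c c' : κ} (h : c' ≠ c) :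
    appendLetter u b c c' = u c' :=
  Function.update_of_ne h ..

/-- Bracketing with a letter is a derivation, so it acts on one letter `c` of the bracketing at a
time, and there it appends `b` to the list `u c`. -/
theorem IsBracketing.elimHom_lie {T : Finset κ} {z : FreeLieAlgebra ℚ κ} (h : IsBracketing T z)
    (u : κ → List β) (b : β) : ⁅elimHom u z, FreeLieAlgebra.of ℚ (Sum.inr b)⁆ =
      ∑ c ∈ T, elimHom (appendLetter u b c) z := by
  induction h with
  | of c =>
    rw [Finset.sum_singleton, elimHom_of, elimHom_of, appendLetter_self, List.map_append,
      List.map_singleton, leftBracket_append_singleton]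
  | @lie S T x y hST hx hy ihx ihy =>
    rw [LieHom.map_lie, Finset.sum_union hST]
    have h1 : ∀ c ∈ S, elimHom (appendLetter u b c) ⁅x, y⁆ =
        ⁅elimHom (appendLetter u b c) x, elimHom u y⁆ := fun c hc => by
      rw [LieHom.map_lie, hy.elimHom_congr fun c' hc' => appendLetter_of_ne u b ?_]
      rintro rfl
      exact Finset.disjoint_left.1 hST hc hc'
    have h2 : ∀ c ∈ T, elimHom (appendLetter u b c) ⁅x, y⁆ =
        ⁅elimHom u x, elimHom (appendLetter u b c) y⁆ := fun c hc => by
      rw [LieHom.map_lie, hx.elimHom_congr fun c' hc' => appendLetter_of_ne u b ?_]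
      rintro rfl
      exact Finset.disjoint_left.1 hST hc' hc
    rw [Finset.sum_congr rfl h1, Finset.sum_congr rfl h2, ← sum_lie,
      ← lie_sum, ← ihx, ← ihy]
    rw [lie_lie, ← lie_skew (elimHom u y) ⁅elimHom u x, _⁆]
    abel

variable [DecidableEq β]

/-- The span of the images of bracketings under the homomorphisms `elimHom u`, where the letters
involved are those of `S`. -/
def elimSpan (S : Finset (κ ⊕ β)) : Submodule ℚ (FreeLieAlgebra ℚ (κ ⊕ β)) :=
  Submodule.span ℚ {w | ∃ (T : Finset κ) (u : κ → List β) (z : FreeLieAlgebra ℚ κ),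
    IsBracketing T z ∧ (∀ c, c ∈ T ↔ Sum.inl c ∈ S) ∧
      (∀ b, ∑ c ∈ T, (u c).count b = if Sum.inr b ∈ S then 1 else 0) ∧ w = elimHom u z}

theorem lie_mem_elimSpan {S S' : Finset (κ ⊕ β)} (hS : Disjoint S S')
    {w w' : FreeLieAlgebra ℚ (κ ⊕ β)} (hw : w ∈ elimSpan S) (hw' : w' ∈ elimSpan S') :
    ⁅w, w'⁆ ∈ elimSpan (S ∪ S') := by
  induction hw using Submodule.span_induction with
  | zero => rw [zero_lie]; exact zero_mem _
  | add w w' _ _ h h' => rw [add_lie]; exact add_mem h h'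
  | smul a w _ h => rw [smul_lie]; exact Submodule.smul_mem _ _ h
  | mem w hw =>
    induction hw' using Submodule.span_induction with
    | zero => rw [lie_zero]; exact zero_mem _
    | add w w' _ _ h h' => rw [lie_add]; exact add_mem h h'
    | smul a w _ h => rw [lie_smul]; exact Submodule.smul_mem _ _ h
    | mem w' hw' =>
      obtain ⟨T, u, z, hz, hT, hu, rfl⟩ := hw
      obtain ⟨T', u', z', hz', hT', hu', rfl⟩ := hw'
      have hTT : Disjoint T T' := Finset.disjoint_left.2 fun c hc hc' =>
        Finset.disjoint_left.1 hS ((hT c).1 hc) ((hT' c).1 hc')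
      have h1 : ∀ c ∈ T, (fun c => if c ∈ T then u c else u' c) c = u c := fun c hc => if_pos hc
      have h2 : ∀ c ∈ T', (fun c => if c ∈ T then u c else u' c) c = u' c := fun c hc =>
        if_neg (Finset.disjoint_right.1 hTT hc)
      refine Submodule.subset_span ⟨T ∪ T', fun c => if c ∈ T then u c else u' c, ⁅z, z'⁆,
        IsBracketing.lie hTT hz hz', fun c => ?_, fun b => ?_, ?_⟩
      · rw [Finset.mem_union, Finset.mem_union, hT, hT']
      · rw [Finset.sum_union hTT, Finset.sum_congr rfl fun c hc => by rw [h1 c hc],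
          Finset.sum_congr (s₁ := T') rfl fun c hc => by rw [h2 c hc], hu, hu']
        have : Sum.inr b ∈ S → Sum.inr b ∉ S' := fun h => Finset.disjoint_left.1 hS h
        by_cases hb : Sum.inr b ∈ S <;> by_cases hb' : Sum.inr b ∈ S' <;> simp_all
      · rw [LieHom.map_lie, hz.elimHom_congr h1, hz'.elimHom_congr h2]

/-- The spanning half of Lazard elimination, with the same two clauses as `mem_leftBracketSpan`:
letters of `β` are absorbed into the lists by `elimHom_lie`, and two factors with letters of `κ` are
combined by `lie_mem_elimSpan`. -/
theorem IsBracketing.mem_elimSpan {S : Finset (κ ⊕ β)} {x : FreeLieAlgebra ℚ (κ ⊕ β)}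
    (h : IsBracketing S x) : ((∃ c, Sum.inl c ∈ S) → x ∈ elimSpan S) ∧
      ((¬ ∃ c, Sum.inl c ∈ S) → ∀ S', Disjoint S' S →
        ∀ w ∈ elimSpan S', ⁅w, x⁆ ∈ elimSpan (S' ∪ S)) := by
  induction h with
  | of i =>
    refine ⟨fun h => ?_, fun h S' hS' w hw => ?_⟩
    · obtain ⟨c, hc⟩ := h
      obtain rfl := Finset.mem_singleton.1 hc
      refine Submodule.subset_span ⟨{c}, fun _ => [], FreeLieAlgebra.of ℚ c, IsBracketing.of c,
        by simp, by simp, ?_⟩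
      rw [elimHom_of]
      rfl
    · obtain ⟨c⟩ | ⟨b⟩ := i
      · exact absurd ⟨c, Finset.mem_singleton_self _⟩ h
      induction hw using Submodule.span_induction with
      | mem w hw =>
        obtain ⟨T, u, z, hz, hT, hu, rfl⟩ := hw
        rw [hz.elimHom_lie]
        refine sum_mem fun c hc => Submodule.subset_span ⟨T, appendLetter u b c, z, hz, ?_, ?_, rfl⟩
        · intro c
          simp [hT]
        · intro b'
          have h1 : ∀ c', (appendLetter u b c c').count b' =
              (u c').count b' + if c' = c then (if b = b' then 1 else 0) else 0 := fun c' => by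
            by_cases hc' : c' = c
            · rw [hc', appendLetter_self, List.count_append, List.count_singleton, if_pos rfl]
              simp
            · rw [appendLetter_of_ne u b hc', if_neg hc', add_zero]
          rw [Finset.sum_congr rfl fun c' _ => h1 c', Finset.sum_add_distrib, hu,
            Finset.sum_ite_eq', if_pos hc]
          have hb := Finset.disjoint_singleton_right.1 hS'
          by_cases hbb : b = b'
          · subst hbb
            simp [hb]
          · simp [hbb, Ne.symm hbb]
      | zero => rw [zero_lie]; exact zero_mem _
      | add w w' _ _ h h' => rw [add_lie]; exact add_mem h h'
      | smul a w _ h => rw [smul_lie]; exact Submodule.smul_mem _ _ h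
  | @lie S T x y hST _ _ ihx ihy =>
    refine ⟨fun h => ?_, fun h S' hS' w hw => ?_⟩
    · by_cases hS : ∃ c, Sum.inl c ∈ S
      · by_cases hT : ∃ c, Sum.inl c ∈ T
        · exact lie_mem_elimSpan hST (ihx.1 hS) (ihy.1 hT)
        · exact ihy.2 hT S hST _ (ihx.1 hS)
      · have hT : ∃ c, Sum.inl c ∈ T := by
          obtain ⟨c, hc⟩ := h
          exact ⟨c, (Finset.mem_union.1 hc).resolve_left fun h => hS ⟨c, h⟩⟩
        rw [← lie_skew, Finset.union_comm]
        exact neg_mem (ihx.2 hS T hST.symm _ (ihy.1 hT))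
    · have hS : ¬ ∃ c, Sum.inl c ∈ S := fun ⟨c, hc⟩ => h ⟨c, Finset.mem_union_left _ hc⟩
      have hT : ¬ ∃ c, Sum.inl c ∈ T := fun ⟨c, hc⟩ => h ⟨c, Finset.mem_union_right _ hc⟩
      rw [Finset.disjoint_union_right] at hS'
      have h1 := ihy.2 hT _ (Finset.disjoint_union_left.2 ⟨hS'.2, hST⟩) _
        (ihx.2 hS _ hS'.1 _ hw)
      have h2 := ihx.2 hS _ (Finset.disjoint_union_left.2 ⟨hS'.1, hST.symm⟩) _
        (ihy.2 hT _ hS'.2 _ hw)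
      rw [Finset.union_assoc] at h1 h2
      rw [Finset.union_comm T S] at h2
      have h3 : ⁅w, ⁅x, y⁆⁆ = ⁅⁅w, x⁆, y⁆ - ⁅⁅w, y⁆, x⁆ := by
        rw [leibniz_lie w x y, ← lie_skew x ⁅w, y⁆, sub_eq_add_neg]
      rw [h3]
      exact sub_mem h1 h2

end Elimination

/-- The families of lists indexed by `κ` in which each element of `β` occurs exactly once. -/
def Distribution (κ β : Type) : Type :=
  {u : κ → List β // (∀ c, (u c).Nodup) ∧ ∀ b, ∃! c, b ∈ u c}

section Distribution

variable {κ β : Type}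

theorem Distribution.ext {u u' : Distribution κ β} (h : ∀ c, u.1 c = u'.1 c) : u = u' :=
  Subtype.ext (funext h)

instance [Finite κ] [Finite β] : Finite (Distribution κ β) := by
  classical
  let := Fintype.ofFinite β
  exact Finite.of_injective (fun (u : Distribution κ β) (c : κ) =>
    (⟨u.1 c, u.2.1 c⟩ : {l : List β // l.Nodup})) fun u u' h =>
      Distribution.ext fun c => Subtype.mk.inj (congrFun h c)

theorem isDistribution_of_count [Fintype κ] [DecidableEq β] {u : κ → List β}
    (h : ∀ b, ∑ c, (u c).count b = 1) : (∀ c, (u c).Nodup) ∧ ∀ b, ∃! c, b ∈ u c := by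
  classical
  refine ⟨fun c => List.nodup_iff_count_le_one.2 fun b => ?_, fun b => ?_⟩
  · rw [← h b]
    exact Finset.single_le_sum (f := fun c => (u c).count b) (fun _ _ => Nat.zero_le _)
      (Finset.mem_univ c)
  · obtain ⟨c, -, hc⟩ : ∃ c ∈ Finset.univ, (u c).count b ≠ 0 := by
      by_contra! hne
      have := h b
      rw [Finset.sum_eq_zero hne] at this
      exact zero_ne_one this
    refine ⟨c, List.count_pos_iff.1 (Nat.pos_of_ne_zero hc), fun c' hc' => ?_⟩
    by_contra hne
    have h1 := h b
    rw [← Finset.add_sum_erase _ _ (Finset.mem_univ c), ← Finset.add_sum_erase _ _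
      (Finset.mem_erase.2 ⟨hne, Finset.mem_univ c'⟩)] at h1
    have h2 := List.count_pos_iff.2 hc'
    omega

theorem IsBracketing.elimHom [DecidableEq κ] [DecidableEq β] (u : Distribution κ β) {T : Finset κ}
    {z : FreeLieAlgebra ℚ κ} (h : IsBracketing T z) :
    IsBracketing (T.biUnion fun c => {Sum.inl c} ∪ ((u.1 c).map Sum.inr).toFinset)
      (elimHom u.1 z) := by
  induction h with
  | of c =>
    rw [Finset.singleton_biUnion, elimHom_of]
    refine (IsBracketing.of _).leftBracket ((u.2.1 c).map Sum.inr_injective) ?_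
    simp
  | lie h _ _ ihx ihy =>
    rw [LieHom.map_lie, Finset.union_biUnion]
    refine IsBracketing.lie ?_ ihx ihy
    rw [Finset.disjoint_left]
    intro a ha ha'
    rw [Finset.mem_biUnion] at ha ha'
    obtain ⟨c, hc, ha⟩ := ha
    obtain ⟨c', hc', ha'⟩ := ha'
    obtain rfl : c = c' := by
      obtain ⟨c''⟩ | ⟨b⟩ := a
      · have h1 : c'' = c := by simpa using ha
        have h2 : c'' = c' := by simpa using ha'
        rw [← h1, h2]
      · have h1 : b ∈ u.1 c := by simpa using ha
        have h2 : b ∈ u.1 c' := by simpa using ha'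
        exact (u.2.2 b).unique h1 h2
    exact Finset.disjoint_left.1 h hc hc'

theorem elimHom_mem (u : Distribution κ β) {z : FreeLieAlgebra ℚ κ} (hz : z ∈ multilinearLie κ) :
    elimHom u.1 z ∈ multilinearLie (κ ⊕ β) := by
  classical
  refine (multilinearLie_le (N := (multilinearLie (κ ⊕ β)).comap
    (elimHom u.1 : FreeLieAlgebra ℚ κ →ₗ[ℚ] FreeLieAlgebra ℚ (κ ⊕ β))) fun S y hS hy => ?_) hz
  refine (hy.elimHom u).mem_multilinearLie fun a => ?_
  rw [Finset.mem_biUnion]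
  obtain ⟨c⟩ | ⟨b⟩ := a
  · exact ⟨c, hS c, by simp⟩
  · obtain ⟨c, hc, -⟩ := u.2.2 b
    exact ⟨c, hS c, by simpa using hc⟩

/-- The map `elimHom u`, on the multilinear parts. -/
def elimLinear (u : Distribution κ β) : multilinearLie κ →ₗ[ℚ] multilinearLie (κ ⊕ β) :=
  (elimHom u.1 : FreeLieAlgebra ℚ κ →ₗ[ℚ] FreeLieAlgebra ℚ (κ ⊕ β)).restrict
    fun _ hz => elimHom_mem u hz

theorem coe_elimLinear (u : Distribution κ β) (z : multilinearLie κ) :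
    (elimLinear u z : FreeLieAlgebra ℚ (κ ⊕ β)) = elimHom u.1 z.1 := rfl

open scoped TensorProduct

/-- The decomposition of the multilinear part of the free Lie algebra on `κ ⊕ β`. -/
def elimTensor (κ β : Type) :
    ((Distribution κ β →₀ ℚ) ⊗[ℚ] multilinearLie κ) →ₗ[ℚ] multilinearLie (κ ⊕ β) :=
  TensorProduct.lift (Finsupp.lsum ℚ fun u => LinearMap.toSpanSingleton ℚ _ (elimLinear u))

theorem elimTensor_single (u : Distribution κ β) (z : multilinearLie κ) :
    elimTensor κ β (Finsupp.single u 1 ⊗ₜ z) = elimLinear u z := by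
  rw [elimTensor, TensorProduct.lift.tmul, Finsupp.lsum_single, LinearMap.toSpanSingleton_apply,
    one_smul]

theorem elimTensor_surjective [Finite κ] [Nonempty κ] : Function.Surjective (elimTensor κ β) := by
  classical
  let := Fintype.ofFinite κ
  rw [← LinearMap.range_eq_top]
  have h : multilinearLie (κ ⊕ β) ≤
      (LinearMap.range (elimTensor κ β)).map (multilinearLie (κ ⊕ β)).subtype := by
    refine multilinearLie_le fun S x hS hx => ?_
    refine (Submodule.span_le.2 ?_) (hx.mem_elimSpan.1 ⟨Classical.arbitrary κ, hS _⟩)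
    rintro _ ⟨T, u, z, hz, hT, hu, rfl⟩
    obtain rfl : T = Finset.univ := Finset.eq_univ_iff_forall.2 fun c => (hT c).2 (hS _)
    let u' : Distribution κ β := ⟨u, isDistribution_of_count fun b => by rw [hu, if_pos (hS _)]⟩
    refine ⟨elimLinear u' ⟨z, hz.mem_multilinearLie Finset.mem_univ⟩,
      ⟨Finsupp.single u' 1 ⊗ₜ ⟨z, hz.mem_multilinearLie Finset.mem_univ⟩, ?_⟩, rfl⟩
    rw [elimTensor_single]
  rw [eq_top_iff]
  rintro x -
  obtain ⟨y, hy, hxy⟩ := h x.2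
  rwa [← Subtype.ext hxy]

end Distribution

end
end PreLieHAL

/-! ### Injectivity of the elimination map, by counting enumerations, and its trace. -/

namespace PreLieHAL
open MvPowerSeries Equiv
noncomputable section

section Merge

variable {κ β : Type}

/-- Insert after each letter `c` of a list the list `u c`. -/
def mergeList (u : κ → List β) (l : List κ) : List (κ ⊕ β) :=
  l.flatMap fun c => Sum.inl c :: (u c).map Sum.inr

theorem mergeList_cons (u : κ → List β) (c : κ) (l : List κ) :
    mergeList u (c :: l) = Sum.inl c :: ((u c).map Sum.inr ++ mergeList u l) := rfl

/-- A nonempty merged list starts with a letter from `κ`, so the leading run of letters of `β` can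
be read off. -/
theorem map_inr_append_mergeList_inj {u u' : κ → List β} {l l' : List κ} (a a' : List β)
    (h : a.map Sum.inr ++ mergeList u l = a'.map Sum.inr ++ mergeList u' l') :
    a = a' ∧ mergeList u l = mergeList u' l' := by
  induction a generalizing a' with
  | nil =>
    cases a' with
    | nil => exact ⟨rfl, h⟩
    | cons b a' =>
      exfalso
      cases l with
      | nil => exact List.noConfusion rfl (heq_of_eq h)
      | cons c l => exact Sum.noConfusion rfl rfl (heq_of_eq (List.cons.inj h).1)
  | cons b a ih =>
    cases a' with
    | nil =>
      exfalso
      cases l' with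
      | nil => exact List.noConfusion rfl (heq_of_eq h)
      | cons c l => exact Sum.noConfusion rfl rfl (heq_of_eq (List.cons.inj h).1)
    | cons b' a' =>
      obtain ⟨h1, h2⟩ := List.cons.inj h
      obtain ⟨h3, h4⟩ := ih a' h2
      exact ⟨by rw [Sum.inr_injective h1, h3], h4⟩

theorem mergeList_inj {u u' : κ → List β} (l l' : List κ) (h : mergeList u l = mergeList u' l') :
    l = l' ∧ ∀ c ∈ l, u c = u' c := by
  induction l generalizing l' with
  | nil =>
    cases l' with
    | nil => exact ⟨rfl, by simp⟩
    | cons c l' => simp [mergeList] at h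
  | cons c l ih =>
    cases l' with
    | nil => simp [mergeList] at h
    | cons c' l' =>
      rw [mergeList_cons, mergeList_cons] at h
      obtain ⟨h1, h2⟩ := List.cons.inj h
      obtain rfl := Sum.inl_injective h1
      obtain ⟨h3, h4⟩ := map_inr_append_mergeList_inj _ _ h2
      obtain ⟨rfl, h5⟩ := ih l' h4
      exact ⟨rfl, List.forall_mem_cons.2 ⟨h3, h5⟩⟩

theorem mem_mergeList_inl (u : κ → List β) (l : List κ) (c : κ) :
    Sum.inl c ∈ mergeList u l ↔ c ∈ l := by
  simp [mergeList]

theorem mem_mergeList_inr (u : κ → List β) (l : List κ) (b : β) :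
    Sum.inr b ∈ mergeList u l ↔ ∃ c ∈ l, b ∈ u c := by
  simp [mergeList]

theorem nodup_mergeList (u : Distribution κ β) {l : List κ} (h : l.Nodup) :
    (mergeList u.1 l).Nodup := by
  induction l with
  | nil => exact List.nodup_nil
  | cons c l ih =>
    rw [List.nodup_cons] at h
    rw [mergeList_cons, List.nodup_cons, List.nodup_append]
    refine ⟨?_, (u.2.1 c).map Sum.inr_injective, ih h.2, ?_⟩
    · rw [List.mem_append, mem_mergeList_inl, not_or]
      exact ⟨by simp, h.1⟩
    · intro x hx y hy hxy
      obtain ⟨b, hb, rfl⟩ := List.mem_map.1 hx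
      rw [← hxy, mem_mergeList_inr] at hy
      obtain ⟨c', hc', hb'⟩ := hy
      rw [(u.2.2 b).unique hb' hb] at hc'
      exact h.1 hc'

/-- The enumeration of `κ ⊕ β` obtained from an enumeration of `κ` and a family of lists. -/
def mergeArrangement {c : κ} (x : Distribution κ β × Arrangement c) :
    Arrangement (Sum.inl c : κ ⊕ β) :=
  ⟨(x.1.1 c).map Sum.inr ++ mergeList x.1.1 x.2.1, by
    rw [← mergeList_cons]
    refine ⟨nodup_mergeList x.1 x.2.2.1, ?_⟩
    rintro (c' | b)
    · rw [mem_mergeList_inl]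
      exact x.2.2.2 c'
    · rw [mem_mergeList_inr]
      obtain ⟨c', hc', -⟩ := x.1.2.2 b
      exact ⟨c', x.2.2.2 c', hc'⟩⟩

theorem mergeArrangement_injective {c : κ} :
    Function.Injective (mergeArrangement : Distribution κ β × Arrangement c → _) := by
  rintro ⟨u, l⟩ ⟨u', l'⟩ h
  have h1 : mergeList u.1 (c :: l.1) = mergeList u'.1 (c :: l'.1) :=
    congrArg (fun x => Sum.inl c :: x) (Subtype.mk.inj h)
  obtain ⟨h2, h3⟩ := mergeList_inj _ _ h1
  exact Prod.ext (Distribution.ext fun c' => h3 c' (l.2.2 c'))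
    (Subtype.ext (List.cons.inj h2).2)

end Merge

section Trace

variable {κ β : Type}

open scoped TensorProduct

/-- Multilinear parts have dimension the number of `Arrangement`s, and merging a distribution with
an enumeration of `κ` is injective. So the source is no larger than the target, and surjectivity
does the rest. -/
theorem elimTensor_bijective [Finite κ] [Finite β] [Nonempty κ] :
    Function.Bijective (elimTensor κ β) := by
  let := Fintype.ofFinite (Distribution κ β)
  obtain ⟨c⟩ := ‹Nonempty κ›
  have : Nonempty κ := ⟨c⟩
  have hs : Function.Surjective (elimTensor κ β) := elimTensor_surjective
  have h1 : Module.finrank ℚ ((Distribution κ β →₀ ℚ) ⊗[ℚ] multilinearLie κ) =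
      Nat.card (Distribution κ β) * Module.finrank ℚ (multilinearLie κ) := by
    rw [Module.finrank_tensorProduct, Module.finrank_finsupp_self, Nat.card_eq_fintype_card]
  have h2 : Nat.card (Distribution κ β) * Nat.card (Arrangement c) ≤
      Nat.card (Arrangement (Sum.inl c : κ ⊕ β)) := by
    rw [← Nat.card_prod]
    exact Nat.card_le_card_of_injective _ mergeArrangement_injective
  have h3 : Module.finrank ℚ ((Distribution κ β →₀ ℚ) ⊗[ℚ] multilinearLie κ) ≤
      Module.finrank ℚ (multilinearLie (κ ⊕ β)) := by
    rw [h1]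
    exact ((Nat.mul_le_mul_left _ (finrank_multilinearLie_le c)).trans h2).trans
      (card_le_finrank_multilinearLie _)
  have h4 := h3.antisymm (LinearMap.finrank_le_finrank_of_surjective hs)
  exact ⟨(LinearMap.injective_iff_surjective_of_finrank_eq_finrank h4).2 hs, hs⟩

/-- The action of permutations of the indices and of the letters on families of lists. -/
def Distribution.relabel (τ : Perm κ) (ρ : Perm β) (u : Distribution κ β) : Distribution κ β :=
  ⟨fun c => (u.1 (τ.symm c)).map ρ, fun c => (u.2.1 _).map ρ.injective, fun b => by
    obtain ⟨c, hc, hu⟩ := u.2.2 (ρ.symm b)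
    have h : ∀ c', b ∈ (u.1 c').map ρ ↔ ρ.symm b ∈ u.1 c' := fun c' => by
      rw [← ρ.apply_symm_apply b, List.mem_map_of_injective ρ.injective, ρ.symm_apply_apply]
    refine ⟨τ c, ?_, fun c' hc' => ?_⟩
    · refine (h _).2 ?_
      rw [τ.symm_apply_apply]
      exact hc
    · rw [← hu _ ((h _).1 hc'), τ.apply_symm_apply]⟩

theorem Distribution.relabel_apply (τ : Perm κ) (ρ : Perm β) (u : Distribution κ β) (c : κ) :
    (u.relabel τ ρ).1 (τ c) = (u.1 c).map ρ := by
  change (u.1 (τ.symm (τ c))).map ρ = _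
  rw [τ.symm_apply_apply]

theorem mapLie_elimHom (τ : Perm κ) (ρ : Perm β) (u : Distribution κ β) (z : FreeLieAlgebra ℚ κ) :
    mapLie (Equiv.sumCongr τ ρ) (elimHom u.1 z) = elimHom (u.relabel τ ρ).1 (mapLie τ z) := by
  have h : (mapLie (Equiv.sumCongr τ ρ)).comp (elimHom u.1) =
      (elimHom (u.relabel τ ρ).1).comp (mapLie τ) := FreeLieAlgebra.hom_ext fun c => by
    rw [LieHom.comp_apply, LieHom.comp_apply, elimHom_of, mapLie_leftBracket, mapLie_of, mapLie_of,
      elimHom_of, Distribution.relabel_apply, List.map_map, List.map_map]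
    rfl
  exact LieHom.congr_fun h z

/-- Elimination is equivariant for permutations preserving `κ` and `β`, so the trace factors; on
distributions the action is by permutations and its trace counts fixed points. -/
theorem lieFun_sumCongr [Finite κ] [Finite β] [Nonempty κ] (τ : Perm κ) (ρ : Perm β) :
    lieFun (κ ⊕ β) (Equiv.sumCongr τ ρ) =
      Nat.card {u : Distribution κ β // u.relabel τ ρ = u} * lieFun κ τ := by
  let := Fintype.ofFinite (Distribution κ β)
  let e := LinearEquiv.ofBijective (elimTensor κ β) elimTensor_bijective
  have h0 : (multilinearLieEquiv (Equiv.sumCongr τ ρ)).toLinearMap ∘ₗ elimTensor κ β =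
      elimTensor κ β ∘ₗ TensorProduct.map (Finsupp.lmapDomain ℚ ℚ (Distribution.relabel τ ρ))
        (multilinearLieEquiv τ).toLinearMap := by
    refine TensorProduct.ext (Finsupp.lhom_ext' fun u => LinearMap.ext_ring
      (LinearMap.ext fun z => Subtype.ext ?_))
    change mapLie (Equiv.sumCongr τ ρ) (elimTensor κ β (Finsupp.single u 1 ⊗ₜ z)).1 =
      (elimTensor κ β (Finsupp.mapDomain (Distribution.relabel τ ρ) (Finsupp.single u 1) ⊗ₜ
        multilinearLieEquiv τ z)).1
    rw [Finsupp.mapDomain_single, elimTensor_single, elimTensor_single, coe_elimLinear,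
      coe_elimLinear, coe_multilinearLieEquiv, mapLie_elimHom]
  have h1 : (multilinearLieEquiv (Equiv.sumCongr τ ρ)).toLinearMap =
      e.conj (TensorProduct.map (Finsupp.lmapDomain ℚ ℚ (Distribution.relabel τ ρ))
        (multilinearLieEquiv τ).toLinearMap) := by
    refine LinearMap.ext fun x => ?_
    obtain ⟨y, rfl⟩ := e.surjective x
    rw [LinearEquiv.conj_apply_apply, e.symm_apply_apply]
    exact LinearMap.congr_fun h0 y
  rw [lieFun, h1, LinearMap.trace_conj', LinearMap.trace_tensorProduct', trace_lmapDomain, lieFun]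

end Trace

end
end PreLieHAL

namespace PreLieHAL
open MvPowerSeries Equiv
noncomputable section

/-! ### Families of lists fixed by a pair of permutations -/

/-- The number of enumerations of a set fixed by a permutation. -/
def listFun : ∀ α : Type, Perm α → ℚ := fun α σ =>
  Nat.card {l : List α // (l.Nodup ∧ ∀ a, a ∈ l) ∧ l.map σ = l}

theorem isClassFun_listFun : IsClassFun listFun := fun α β e σ => by
  rw [listFun, listFun, Nat.cast_inj]
  refine (Nat.card_congr ((Equiv.listEquivOfEquiv e).subtypeEquiv fun l =>
    and_congr (and_congr (List.nodup_map_iff e.injective).symm ?_) ?_)).symm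
  · rw [← e.forall_congr_right]
    exact forall_congr' fun a => (List.mem_map_of_injective e.injective).symm
  · change l.map σ = l ↔ (l.map e).map (e.permCongr σ) = l.map e
    have h : (l.map e).map (e.permCongr σ) = (l.map σ).map e := by
      rw [List.map_map, List.map_map]
      refine List.map_congr_left fun a _ => ?_
      simp
    rw [h, (List.map_injective_iff.2 e.injective).eq_iff]

theorem relabel_eq_iff {κ β : Type} (τ : Perm κ) (ρ : Perm β) (u : Distribution κ β) :
    u.relabel τ ρ = u ↔ ∀ c, u.1 (τ c) = (u.1 c).map ρ := by
  constructor
  · intro h c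
    conv_lhs => rw [← h]
    exact u.relabel_apply τ ρ c
  · intro h
    refine Distribution.ext fun c => ?_
    obtain ⟨c, rfl⟩ := τ.surjective c
    rw [Distribution.relabel_apply, h]

section Fixed

variable {κ β : Type} {τ : Perm κ} {ρ : Perm β} {d : ℕ+}

theorem map_perm_mul (σ σ' : Perm β) (l : List β) : l.map (σ * σ') = (l.map σ').map σ := by
  rw [List.map_map]
  rfl

theorem map_pow_eq_of_fixed (c : CyclicColoring ρ d) {l : List {b // c.1 b = 0}}
    (hl : l.map c.rootPerm = l) (n : ℕ) :
    (l.map Subtype.val).map (ρ ^ n) = (l.map Subtype.val).map (ρ ^ (n : ZMod d).val) := by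
  have h1 : (l.map Subtype.val).map (ρ ^ (d : ℕ)) = l.map Subtype.val := by
    conv_rhs => rw [← hl]
    rw [List.map_map, List.map_map]
    rfl
  have h2 : ∀ q : ℕ, (l.map Subtype.val).map (ρ ^ ((d : ℕ) * q)) = l.map Subtype.val := fun q => by
    induction q with
    | zero => exact List.map_id _
    | succ q ih =>
      rw [mul_add, mul_one, add_comm, pow_add, map_perm_mul, ih, h1]
  conv_lhs => rw [← Nat.mod_add_div n d, pow_add, map_perm_mul, h2]
  rw [ZMod.val_natCast]

theorem Distribution.apply_pow {u : Distribution κ β} (hu : ∀ c, u.1 (τ c) = (u.1 c).map ρ) (n : ℕ)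
    (c : κ) : u.1 ((τ ^ n) c) = (u.1 c).map (ρ ^ n) := by
  induction n with
  | zero => exact (List.map_id _).symm
  | succ n ih =>
    rw [pow_succ', Perm.mul_apply, hu, ih, pow_succ', map_perm_mul]

/-- The family of lists determined by the list at one index. -/
def listFamily (φ : κ ≃ ZMod d) (c : CyclicColoring ρ d) (l : List {b // c.1 b = 0}) (i : κ) :
    List β :=
  (l.map Subtype.val).map (ρ ^ (φ i).val)

theorem mem_listFamily (φ : κ ≃ ZMod d) (c : CyclicColoring ρ d) {l : List {b // c.1 b = 0}}
    (hl : ∀ b, b ∈ l) (i : κ) (b : β) : b ∈ listFamily φ c l i ↔ c.1 b = φ i := by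
  obtain ⟨b, rfl⟩ := (ρ ^ (φ i).val).surjective b
  rw [listFamily, List.mem_map_of_injective (Equiv.injective _), c.pow_apply,
    ZMod.natCast_zmod_val, add_eq_right, List.mem_map]
  exact ⟨fun ⟨b', _, hb⟩ => hb ▸ b'.2, fun h => ⟨⟨b, h⟩, hl _, rfl⟩⟩

/-- Here `τ` is a single cycle, so equivariance recovers all lists from the one at `φ.symm 0`. That
list enumerates the points of colour zero and must be fixed by the return map. -/
theorem card_fixed_compatible (φ : κ ≃ ZMod d) (hφ : ∀ i, φ (τ i) = φ i + 1)
    (c : CyclicColoring ρ d) :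
    Nat.card {u : {u : Distribution κ β // u.relabel τ ρ = u} // ∀ i, ∀ b ∈ u.1.1 i, c.1 b = φ i} =
      Nat.card {l : List {b // c.1 b = 0} // (l.Nodup ∧ ∀ b, b ∈ l) ∧ l.map c.rootPerm = l} := by
  have h1 : ∀ l : {l : List {b // c.1 b = 0} // (l.Nodup ∧ ∀ b, b ∈ l) ∧ l.map c.rootPerm = l},
      (∀ i, (listFamily φ c l.1 i).Nodup) ∧ ∀ b, ∃! i, b ∈ listFamily φ c l.1 i := fun l => by
    refine ⟨fun i => (l.2.1.1.map Subtype.val_injective).map (Equiv.injective _), fun b => ?_⟩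
    refine ⟨φ.symm (c.1 b), (mem_listFamily φ c l.2.1.2 _ b).2 (φ.apply_symm_apply _).symm,
      fun i hi => ?_⟩
    rw [(mem_listFamily φ c l.2.1.2 _ b).1 hi, φ.symm_apply_apply]
  have h2 : ∀ l : {l : List {b // c.1 b = 0} // (l.Nodup ∧ ∀ b, b ∈ l) ∧ l.map c.rootPerm = l},
      Distribution.relabel τ ρ ⟨_, h1 l⟩ = ⟨_, h1 l⟩ := fun l => by
    refine (relabel_eq_iff τ ρ _).2 fun i => ?_
    change listFamily φ c l.1 (τ i) = (listFamily φ c l.1 i).map ρ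
    have h1 : φ (τ i) = (((φ i).val + 1 : ℕ) : ZMod d) := by
      rw [hφ, Nat.cast_add, ZMod.natCast_zmod_val, Nat.cast_one]
    rw [listFamily, h1, ← map_pow_eq_of_fixed c l.2.2, listFamily, pow_succ', map_perm_mul]
  refine (Nat.card_congr (Equiv.ofBijective (fun l => ⟨⟨⟨_, h1 l⟩, h2 l⟩, fun i b hb =>
    (mem_listFamily φ c l.2.1.2 i b).1 hb⟩) ⟨?_, ?_⟩)).symm
  · intro l l' h
    have h1 : listFamily φ c l.1 = listFamily φ c l'.1 :=
      congrArg (fun u => u.1.1.1) h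
    have h2 := congrFun h1 (φ.symm 0)
    rw [listFamily, listFamily, φ.apply_symm_apply, ZMod.val_zero, pow_zero, Perm.coe_one,
      List.map_id, List.map_id] at h2
    exact Subtype.ext (List.map_injective_iff.2 Subtype.val_injective h2)
  · rintro ⟨⟨u, hu⟩, hc⟩
    rw [relabel_eq_iff] at hu
    have hpow : ∀ n : ℕ, ∀ i, φ ((τ ^ n) i) = φ i + n := fun n i =>
      CyclicColoring.pow_apply (σ := τ) ⟨φ, hφ⟩ n i
    obtain ⟨l, hl⟩ : ∃ l : List {b // c.1 b = 0}, l.map Subtype.val = u.1 (φ.symm 0) :=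
      CanLift.prf (u.1 (φ.symm 0)) fun b hb => by rw [hc _ b hb, φ.apply_symm_apply]
    have hd : (τ ^ (d : ℕ)) (φ.symm 0) = φ.symm 0 := φ.injective (by
      rw [hpow, ZMod.natCast_self, add_zero])
    refine ⟨⟨l, ⟨?_, fun b => ?_⟩, ?_⟩, ?_⟩
    · have := u.2.1 (φ.symm 0)
      rw [← hl] at this
      exact this.of_map _
    · obtain ⟨i, hi, -⟩ := u.2.2 b
      have h1 : i = φ.symm 0 := by rw [← b.2, hc i b hi, φ.symm_apply_apply]
      rw [h1, ← hl, List.mem_map_of_injective Subtype.val_injective] at hi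
      exact hi
    · refine List.map_injective_iff.2 Subtype.val_injective ?_
      have h1 := u.apply_pow hu d (φ.symm 0)
      rw [hd, ← hl, List.map_map] at h1
      rw [List.map_map]
      exact h1.symm
    · refine Subtype.ext (Subtype.ext (Distribution.ext fun i => ?_))
      change (l.map Subtype.val).map (ρ ^ (φ i).val) = u.1 i
      rw [hl, ← u.apply_pow hu]
      refine congrArg u.1 (φ.injective ?_)
      rw [hpow, φ.apply_symm_apply, zero_add, ZMod.natCast_zmod_val]

/-- A fixed distribution colours `b` by the position `φ i` of the list containing it, and `ρ` raises
this colour by one; distributions are sorted by this colouring. -/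
theorem card_fixed_distribution [Finite κ] [Finite β] (φ : κ ≃ ZMod d)
    (hφ : ∀ i, φ (τ i) = φ i + 1) :
    (Nat.card {u : Distribution κ β // u.relabel τ ρ = u} : ℚ) = adFun d listFun β ρ := by
  let := Fintype.ofFinite (CyclicColoring ρ d)
  rw [natCard_eq_sum_of_existsUnique
    (fun (u : {u : Distribution κ β // u.relabel τ ρ = u}) (c : CyclicColoring ρ d) =>
      ∀ i, ∀ b ∈ u.1.1 i, c.1 b = φ i), adFun, finsum_eq_sum_of_fintype, Nat.cast_sum]
  · refine Finset.sum_congr rfl fun c _ => ?_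
    rw [card_fixed_compatible φ hφ, listFun]
  · rintro ⟨u, hu⟩
    rw [relabel_eq_iff] at hu
    choose i hi hu' using u.2.2
    refine ⟨⟨fun b => φ (i b), fun b => ?_⟩, fun j b hb => ?_, fun c hc => ?_⟩
    · have h1 : i (ρ b) = τ (i b) := by
        refine (hu' (ρ b) _ ?_).symm
        change ρ b ∈ u.1 (τ (i b))
        rw [hu]
        exact List.mem_map_of_mem (hi b)
      change φ (i (ρ b)) = φ (i b) + 1
      rw [h1, hφ]
    · change φ (i b) = φ j
      rw [hu' b j hb]
    · exact Subtype.ext (funext fun b => hc _ b (hi b))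

end Fixed

theorem minimalPeriod_eq_natCard {κ : Type} {τ : Perm κ} {i₀ : κ} (h : ∀ i, τ.SameCycle i₀ i) :
    Function.minimalPeriod τ i₀ = Nat.card κ := by
  rw [← Nat.card_zmod (Function.minimalPeriod τ i₀)]
  choose j hj using h
  refine (Nat.card_congr (Equiv.ofBijective
    (fun i => (j i : ZMod (Function.minimalPeriod τ i₀))) ⟨fun i i' hii => ?_, fun z => ?_⟩)).symm
  · rw [← zpow_apply_eq_iff, hj, hj] at hii
    exact hii
  · obtain ⟨n, rfl⟩ := ZMod.intCast_surjective z
    refine ⟨(τ ^ n) i₀, ?_⟩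
    dsimp only
    rw [← zpow_apply_eq_iff, hj]

/-- A transitive permutation of a set with `d` elements is a cycle of length `d`. -/
theorem exists_equiv_zmod {κ : Type} {τ : Perm κ} (i₀ : κ) (h : ∀ i, τ.SameCycle i₀ i)
    {d : ℕ+} (hd : Nat.card κ = d) : ∃ φ : κ ≃ ZMod d, ∀ i, φ (τ i) = φ i + 1 := by
  have h0 : Function.minimalPeriod τ i₀ = d := by rw [minimalPeriod_eq_natCard h, hd]
  have hz : ∀ a b : ℤ, (τ ^ a) i₀ = (τ ^ b) i₀ ↔ (a : ZMod d) = b := fun a b => by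
    rw [zpow_apply_eq_iff, h0]
  choose j hj using h
  refine ⟨Equiv.ofBijective (fun i => (j i : ZMod d)) ⟨fun i i' hii => ?_, fun z => ?_⟩,
    fun i => ?_⟩
  · dsimp only at hii
    rwa [← hz, hj, hj] at hii
  · obtain ⟨n, rfl⟩ := ZMod.intCast_surjective z
    refine ⟨(τ ^ n) i₀, ?_⟩
    dsimp only
    rw [← hz, hj]
  · have h1 : (j (τ i) : ZMod d) = ((j i + 1 : ℤ) : ZMod d) := by
      rw [← hz, hj, add_comm, zpow_add, zpow_one, Perm.mul_apply, hj]
    exact h1.trans (by rw [Int.cast_add, Int.cast_one]; rfl)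

theorem lieFun_eq_mul {α : Type} [Fintype α] [DecidableEq α] {σ : Perm α} (s : Finset α)
    (hs : ∀ x, σ x ∈ s ↔ x ∈ s) {x : α} (hx : x ∈ s) (ht : ∀ y ∈ s, σ.SameCycle x y) {d : ℕ+}
    (hd : s.card = d) : lieFun α σ = lieFun {y // y ∈ s} (σ.subtypePerm hs) *
      adFun d listFun {y // y ∉ s} (σ.subtypePerm fun y => not_congr (hs y)) := by
  let e : {y // y ∈ s} ⊕ {y // y ∉ s} ≃ α := Equiv.sumCompl (fun y => y ∈ s)
  have h1 : σ = e.permCongr (Equiv.sumCongr (σ.subtypePerm hs)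
      (σ.subtypePerm fun y => not_congr (hs y))) := by
    ext y
    obtain ⟨y, rfl⟩ := e.surjective y
    rw [Equiv.permCongr_apply, e.symm_apply_apply]
    obtain y | y := y <;> rfl
  have : Nonempty {y // y ∈ s} := ⟨⟨x, hx⟩⟩
  obtain ⟨φ, hφ⟩ := exists_equiv_zmod (τ := σ.subtypePerm hs) (d := d) ⟨x, hx⟩
    (fun y => Perm.sameCycle_subtypePerm.2 (ht y y.2)) (by
      rw [Nat.card_eq_fintype_card, Fintype.card_coe, hd])
  conv_lhs => rw [h1]
  rw [isClassFun_lieFun, lieFun_sumCongr, card_fixed_distribution φ hφ, mul_comm]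

open scoped Classical in
/-- `d` times the character of the multilinear part of the free Lie algebras, restricted to the
cycles of length `d`. -/
def cycleLieFun (d : ℕ+) : ∀ α : Type, Perm α → ℚ := fun α σ =>
  if Nat.card α = d ∧ ∀ x y, σ.SameCycle x y then d * lieFun α σ else 0

theorem isClassFun_cycleLieFun (d : ℕ+) : IsClassFun (cycleLieFun d) := fun α β e σ => by
  classical
  have h : (∀ x y, (e.permCongr σ).SameCycle x y) ↔ ∀ x y, σ.SameCycle x y := by
    rw [← e.forall_congr_right]
    refine forall_congr' fun x => ?_
    rw [← e.forall_congr_right]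
    exact forall_congr' fun y => sameCycle_permCongr e σ x y
  exact if_congr (and_congr (by rw [Nat.card_congr e]) h) (by rw [isClassFun_lieFun]) rfl

/-- Mark a letter and apply `lieFun_eq_mul` to its orbit. An orbit of length `d` arises from `d`
letters, which is the factor `d` in `cycleLieFun`; stable subsets that are not orbits contribute
nothing. -/
theorem card_mul_lieFun {α : Type} [Fintype α] [DecidableEq α] (σ : Perm α) (D : Finset ℕ+)
    (hD : ∀ d : ℕ+, (d : ℕ) ≤ Nat.card α → d ∈ D) : Nat.card α * lieFun α σ =
      ∑ d ∈ D, prodFun (cycleLieFun d) (adFun d listFun) σ := by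
  classical
  let O : α → Finset α := fun x => Finset.univ.filter fun y => σ.SameCycle x y
  have hO : ∀ x y, y ∈ O x ↔ σ.SameCycle x y := fun x y => by simp [O]
  rw [Nat.card_eq_fintype_card, ← nsmul_eq_mul, ← Finset.card_univ, ← Finset.sum_const,
    ← Finset.sum_fiberwise Finset.univ O]
  simp only [prodFun]
  rw [Finset.sum_comm]
  refine Finset.sum_congr rfl fun s _ => ?_
  by_cases hs : ∃ x, O x = s
  · obtain ⟨x, rfl⟩ := hs
    have hst : ∀ y, σ y ∈ O x ↔ y ∈ O x := fun y => by rw [hO, hO, Perm.sameCycle_apply_right]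
    have hf : Finset.univ.filter (fun y => O y = O x) = O x := by
      ext y
      rw [Finset.mem_filter, hO]
      refine ⟨fun h => ?_, fun h => ⟨Finset.mem_univ _, ?_⟩⟩
      · rw [← hO, ← h.2, hO]
      · ext z
        rw [hO, hO]
        exact ⟨h.trans, h.symm.trans⟩
    have hx : x ∈ O x := (hO x x).2 (Perm.SameCycle.refl _ _)
    let d : ℕ+ := ⟨(O x).card, Finset.card_pos.2 ⟨x, hx⟩⟩
    rw [hf, Finset.sum_const, Finset.sum_eq_single d]
    · have ht : Nat.card {y // y ∈ O x} = (d : ℕ) ∧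
          ∀ y z, (σ.subtypePerm hst).SameCycle y z := by
        refine ⟨by rw [Nat.card_eq_fintype_card, Fintype.card_coe]; rfl, fun y z => ?_⟩
        rw [Perm.sameCycle_subtypePerm]
        exact ((hO x y).1 y.2).symm.trans ((hO x z).1 z.2)
      rw [dif_pos hst, cycleLieFun, if_pos ht, lieFun_eq_mul (O x) hst hx
        (fun y hy => (hO x y).1 hy) (d := d) rfl, nsmul_eq_mul, mul_assoc]
      rfl
    · intro d' _ hd'
      rw [dif_pos hst, cycleLieFun, if_neg, zero_mul]
      rintro ⟨h, -⟩
      refine hd' (PNat.coe_injective ?_)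
      rw [← h, Nat.card_eq_fintype_card, Fintype.card_coe]
      rfl
    · intro h
      refine absurd (hD d ?_) h
      rw [Nat.card_eq_fintype_card]
      exact Finset.card_le_univ _
  · rw [Finset.sum_eq_zero, Finset.sum_eq_zero]
    · intro d _
      split_ifs with hst
      · rw [cycleLieFun, if_neg, zero_mul]
        rintro ⟨h, ht⟩
        have : Nonempty {y // y ∈ s} := (Nat.card_pos_iff.1 (by rw [h]; exact d.pos)).1
        obtain ⟨x, hx⟩ := this
        refine hs ⟨x, ?_⟩
        ext y
        rw [hO]
        constructor
        · intro h
          obtain ⟨i, -, rfl⟩ := h.exists_pow_eq'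
          clear h
          induction i with
          | zero => exact hx
          | succ i ih => rw [pow_succ', Perm.mul_apply, hst]; exact ih
        · intro hy
          exact Perm.sameCycle_subtypePerm.1 (ht ⟨x, hx⟩ ⟨y, hy⟩)
      · rfl
    · intro x hx
      exact absurd ⟨x, (Finset.mem_filter.1 hx).2⟩ hs

end
end PreLieHAL

/-! ### The series `Lie` as plethystic inverse of `Comm`, up to suspension. -/

namespace PreLieHAL
open MvPowerSeries Equiv
noncomputable section

/-! ### The cycle index series of enumerations -/

theorem card_enumerations (α : Type) [Fintype α] :
    Nat.card {l : List α // l.Nodup ∧ ∀ a, a ∈ l} = (Fintype.card α).factorial := by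
  classical
  have hn : (Finset.univ : Finset α).toList.Nodup := Finset.nodup_toList _
  have h : ∀ l : List α, (l.Nodup ∧ ∀ a, a ∈ l) ↔
      l ∈ (Finset.univ : Finset α).toList.permutations.toFinset := fun l => by
    rw [List.mem_toFinset, List.mem_permutations]
    refine ⟨fun h => (List.perm_ext_iff_of_nodup h.1 hn).2 fun a => by simp [h.2 a],
      fun h => ⟨h.nodup_iff.2 hn, fun a => h.mem_iff.2 (by simp)⟩⟩
  rw [Nat.card_congr (Equiv.subtypeEquivRight h), Nat.card_eq_fintype_card, Fintype.card_coe,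
    List.toFinset_card_of_nodup (List.nodup_permutations _ hn), List.length_permutations,
    Finset.length_toList, Finset.card_univ]

-- A permutation fixing a list fixes each of its letters, hence every element.
open scoped Classical in
theorem listFun_eq {α : Type} [Fintype α] (σ : Perm α) :
    listFun α σ = if σ = 1 then ((Fintype.card α).factorial : ℚ) else 0 := by
  rw [listFun]
  split_ifs with h
  · subst h
    rw [Nat.cast_inj, ← card_enumerations α]
    exact Nat.card_congr (Equiv.subtypeEquivRight fun l => by simp)
  · have : IsEmpty {l : List α // (l.Nodup ∧ ∀ a, a ∈ l) ∧ l.map σ = l} := ⟨fun l => h (by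
      have h1 := l.2.2
      conv_rhs at h1 => rw [← List.map_id l.1]
      exact Equiv.ext fun a => (List.map_inj_left.1 h1) a (l.2.1.2 a))⟩
    rw [Nat.card_of_isEmpty, Nat.cast_zero]

open scoped Classical in
theorem coeff_cycleIndex_listFun (m : ℕ+ →₀ ℕ) :
    coeff m (cycleIndex listFun) = if ∃ n, m = Finsupp.single 1 n then 1 else 0 := by
  have h0 : ∀ n, degree (Finsupp.single 1 n) = n := fun n => by
    simp [degree, Finsupp.weight_single]
  have h1 : (∃ n, m = Finsupp.single 1 n) ↔ cyc (1 : Perm (Fin (degree m))) = m := by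
    rw [cyc_one, Nat.card_eq_fintype_card, Fintype.card_fin]
    refine ⟨?_, fun h => ⟨_, h.symm⟩⟩
    rintro ⟨n, rfl⟩
    rw [h0]
  rw [coeff_cycleIndex, wsum, Finset.sum_eq_single 1]
  · rw [listFun_eq, if_pos rfl, Fintype.card_fin]
    simp only [h1]
    split_ifs
    · exact inv_mul_cancel₀ (Nat.cast_ne_zero.2 (Nat.factorial_ne_zero _))
    · rw [mul_zero]
  · intro σ _ hσ
    rw [listFun_eq, if_neg hσ, ite_self]
  · exact fun h => absurd (Finset.mem_univ _) h

theorem cycleIndex_listFun_eq : cycleIndex listFun = 1 + p 1 * cycleIndex listFun := by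
  classical
  ext m
  rw [map_add, coeff_one, p, X, coeff_monomial_mul, one_mul, coeff_cycleIndex_listFun,
    coeff_cycleIndex_listFun]
  by_cases h0 : m = 0
  · subst h0
    rw [if_pos ⟨0, by simp⟩, if_pos rfl, if_neg (by simp), add_zero]
  · rw [if_neg h0, zero_add]
    by_cases h1 : Finsupp.single 1 1 ≤ m
    · rw [if_pos h1]
      refine if_congr ⟨?_, ?_⟩ rfl rfl
      · rintro ⟨n, rfl⟩
        exact ⟨n - 1, by rw [Finsupp.single_tsub]⟩
      · rintro ⟨n, hn⟩
        exact ⟨n + 1, by rw [Finsupp.single_add, ← hn, tsub_add_cancel_of_le h1]⟩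
    · rw [if_neg h1, if_neg]
      rintro ⟨n, rfl⟩
      refine h1 (Finsupp.single_le_single.2 (Nat.one_le_iff_ne_zero.2 ?_))
      rintro rfl
      exact h0 (Finsupp.single_zero _)

/-! ### The coefficients of `Lie` -/

/-- The coefficient of `p_d` in the cycle index series of `cycleLieFun d`. -/
def cycleCoeff (d : ℕ+) : ℚ := coeff (Finsupp.single d 1) (cycleIndex (cycleLieFun d))

theorem cyc_of_transitive {α : Type} [Finite α] {σ : Perm α} {d : ℕ+} (hd : Nat.card α = d)
    (h : ∀ x y, σ.SameCycle x y) : cyc σ = Finsupp.single d 1 := by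
  refine cyc_eq fun k => ?_
  rw [perCount]
  simp only [minimalPeriod_eq_natCard (h _), hd]
  rw [Finsupp.single_apply]
  split_ifs with hk
  · subst hk
    simp [hd]
  · rw [mul_zero, Nat.card_eq_zero]
    exact Or.inl ⟨fun x => hk (PNat.coe_injective x.2)⟩

theorem cycleIndex_cycleLieFun (d : ℕ+) :
    cycleIndex (cycleLieFun d) = monomial (Finsupp.single d 1) (cycleCoeff d) := by
  classical
  ext m
  rw [coeff_monomial]
  split_ifs with h
  · rw [h, cycleCoeff]
  · rw [coeff_cycleIndex, wsum, Finset.sum_eq_zero, mul_zero]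
    intro σ _
    split_ifs with hσ
    · rw [cycleLieFun, if_neg]
      rintro ⟨h1, h2⟩
      exact h (hσ.symm.trans (cyc_of_transitive h1 h2))
    · rfl

theorem coeff_psi_single (k d : ℕ+) (a : ℕ) (f : SymFun ℚ) :
    coeff (Finsupp.single (k * d) a) (psi k f) = coeff (Finsupp.single d a) f := by
  have h : Finsupp.single (k * d) a = (Finsupp.single d a).embDomain (mulLeftEmbedding k) := by
    rw [Finsupp.embDomain_single]
    rfl
  rw [h, psi, coeff_embDomain_rename]

theorem coeff_psi_ne_zero {k : ℕ+} {m : ℕ+ →₀ ℕ} {f : SymFun ℚ} (h : coeff m (psi k f) ≠ 0) :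
    ∃ y : ℕ+ →₀ ℕ, y.embDomain (mulLeftEmbedding k) = m ∧ coeff y f ≠ 0 := by
  by_cases hm : ∃ y : ℕ+ →₀ ℕ, y.embDomain (mulLeftEmbedding k) = m
  · obtain ⟨y, rfl⟩ := hm
    refine ⟨y, rfl, ?_⟩
    rwa [psi, coeff_embDomain_rename] at h
  · refine absurd ?_ h
    rw [psi, coeff_rename_eq_zero]
    rintro ⟨y, hy⟩
    exact hm ⟨y, by rw [Finsupp.embDomain_eq_mapDomain, hy]⟩

-- The first factor is a multiple of `p_d` and the second is the geometric series `1 / (1 - p_d)`.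
open scoped Classical in
theorem coeff_cycleIndex_mul_psi (d : ℕ+) (m : ℕ+ →₀ ℕ) :
    coeff m (cycleIndex (cycleLieFun d) * psi d (cycleIndex listFun)) =
      if ∃ a, a ≠ 0 ∧ m = Finsupp.single d a then cycleCoeff d else 0 := by
  classical
  rw [cycleIndex_cycleLieFun, coeff_monomial_mul]
  split_ifs with h1 h2 h2
  · obtain ⟨a, ha, rfl⟩ := h2
    have h3 : coeff (Finsupp.single (d * 1) (a - 1)) (psi d (cycleIndex listFun)) = 1 := by
      rw [coeff_psi_single, coeff_cycleIndex_listFun, if_pos ⟨_, rfl⟩]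
    rw [mul_one] at h3
    rw [← Finsupp.single_tsub, h3, mul_one]
  · by_contra h3
    obtain ⟨y, hy, hy0⟩ := coeff_psi_ne_zero (right_ne_zero_of_mul h3)
    rw [coeff_cycleIndex_listFun] at hy0
    obtain ⟨n, rfl⟩ := (ite_ne_right_iff.1 hy0).1
    refine h2 ⟨n + 1, Nat.succ_ne_zero n, ?_⟩
    rw [Finsupp.embDomain_single] at hy
    have h4 : mulLeftEmbedding d 1 = d := mul_one d
    rw [← tsub_add_cancel_of_le h1, ← hy, h4, ← Finsupp.single_add]
  · obtain ⟨a, ha, rfl⟩ := h2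
    exact absurd (Finsupp.single_le_single.2 (Nat.one_le_iff_ne_zero.2 ha)) h1
  · rfl

-- Summing `card_mul_lieFun` over permutations, the product formula turns the term of index `d` into
-- `cycleCoeff d` times `p_d / (1 - p_d)`.
open scoped Classical in
theorem coeff_euler_Lie (m : ℕ+ →₀ ℕ) (D : Finset ℕ+)
    (hD : ∀ d : ℕ+, (d : ℕ) ≤ degree m → d ∈ D) : coeff m (euler Lie) =
      ∑ d ∈ D, if ∃ a, a ≠ 0 ∧ m = Finsupp.single d a then cycleCoeff d else 0 := by
  refine mul_left_cancel₀ (Nat.cast_ne_zero.2 (Nat.factorial_ne_zero (degree m))) ?_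
  rw [Finset.mul_sum, Lie_eq_cycleIndex, euler_cycleIndex, factorial_mul_coeff_cycleIndex _ rfl,
    wsum]
  simp only [← coeff_cycleIndex_mul_psi, ← cycleIndex_adFun isClassFun_listFun,
    factorial_mul_coeff_cycleIndex_mul (isClassFun_cycleLieFun _) (isClassFun_listFun.adFun _)]
  rw [Finset.sum_comm]
  refine Finset.sum_congr rfl fun σ _ => ?_
  rw [card_mul_lieFun σ D (by simpa using hD)]
  split_ifs
  · rfl
  · rw [Finset.sum_const_zero]

theorem single_inj {d d' : ℕ+} {a a' : ℕ} (ha : a ≠ 0)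
    (h : Finsupp.single d a = Finsupp.single d' a') : d = d' ∧ a = a' := by
  rcases (Finsupp.single_eq_single_iff ..).1 h with h | h
  · exact h
  · exact absurd h.1 ha

theorem degree_single (d : ℕ+) (a : ℕ) : degree (Finsupp.single d a) = a * d := by
  simp [degree, Finsupp.weight_single]

theorem coeff_euler_Lie_single (d : ℕ+) {a : ℕ} (ha : a ≠ 0) :
    coeff (Finsupp.single d a) (euler Lie) = cycleCoeff d := by
  classical
  rw [coeff_euler_Lie _ (Finset.Iic (Nat.succPNat (degree (Finsupp.single d a)))),
    Finset.sum_eq_single d]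
  · rw [if_pos ⟨a, ha, rfl⟩]
  · intro d' _ hd'
    rw [if_neg]
    rintro ⟨a', -, h⟩
    exact hd' (single_inj ha h).1.symm
  · intro h
    rw [if_pos ⟨a, ha, rfl⟩]
    exfalso
    rw [Finset.mem_Iic, ← PNat.coe_le_coe, Nat.succPNat_coe, degree_single] at h
    have := Nat.le_mul_of_pos_left (d : ℕ) (Nat.pos_of_ne_zero ha)
    omega
  · intro d' hd'
    rw [Finset.mem_Iic, ← PNat.coe_le_coe, Nat.succPNat_coe]
    omega

theorem coeff_euler_Lie_ne_zero {m : ℕ+ →₀ ℕ} (h : coeff m (euler Lie) ≠ 0) :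
    ∃ d a, a ≠ 0 ∧ m = Finsupp.single d a := by
  classical
  by_contra hm
  refine h ?_
  rw [coeff_euler_Lie _ (Finset.Iic (Nat.succPNat (degree m)))]
  · exact Finset.sum_eq_zero fun d _ => if_neg fun h => hm ⟨d, h⟩
  · intro d' hd'
    rw [Finset.mem_Iic, ← PNat.coe_le_coe, Nat.succPNat_coe]
    omega

/-- The factorizations of `n` as a product of two positive integers. -/
def factorPairs (n : ℕ+) : Finset (ℕ+ × ℕ+) :=
  (Finset.Iic n ×ˢ Finset.Iic n).filter fun x => x.1 * x.2 = n

theorem mem_factorPairs {n : ℕ+} {x : ℕ+ × ℕ+} : x ∈ factorPairs n ↔ x.1 * x.2 = n := by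
  rw [factorPairs, Finset.mem_filter, Finset.mem_product, Finset.mem_Iic, Finset.mem_Iic,
    and_iff_right_iff_imp]
  rintro rfl
  simp only [← PNat.coe_le_coe, PNat.mul_coe]
  exact ⟨Nat.le_mul_of_pos_right _ x.2.pos, Nat.le_mul_of_pos_left _ x.1.pos⟩

/-- As `psi k` sends `p_d ^ a` to `p_{kd} ^ a`, each factorization `n = k d` contributes once. -/
theorem coeff_psiSum_euler_Lie_single (n : ℕ+) {a : ℕ} (ha : a ≠ 0) :
    coeff (Finsupp.single n a) (psiSum (euler Lie)) = ∑ x ∈ factorPairs n, cycleCoeff x.2 := by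
  classical
  rw [coeff_psiSum, finsum_eq_sum_of_support_subset (s := (factorPairs n).image Prod.fst),
    Finset.sum_image]
  · refine Finset.sum_congr rfl fun x hx => ?_
    rw [← mem_factorPairs.1 hx, coeff_psi_single, coeff_euler_Lie_single _ ha]
  · intro x hx y hy hxy
    have h1 := (mem_factorPairs.1 hx).trans (mem_factorPairs.1 hy).symm
    rw [show x.1 = y.1 from hxy] at h1
    exact Prod.ext hxy (mul_left_cancel h1)
  · intro k hk
    obtain ⟨y, hy, hy0⟩ := coeff_psi_ne_zero hk
    obtain ⟨d, a', ha', rfl⟩ := coeff_euler_Lie_ne_zero hy0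
    rw [Finsupp.embDomain_single] at hy
    rw [Finset.mem_coe, Finset.mem_image]
    exact ⟨(k, d), mem_factorPairs.2 (single_inj ha' hy).1, rfl⟩

theorem coeff_psiSum_euler_Lie_ne_zero {m : ℕ+ →₀ ℕ} (h : coeff m (psiSum (euler Lie)) ≠ 0) :
    ∃ d a, a ≠ 0 ∧ m = Finsupp.single d a := by
  obtain ⟨k, hk⟩ : ∃ k, coeff m (psi k (euler Lie)) ≠ 0 := by
    by_contra! hne
    exact h (finsum_eq_zero_of_forall_eq_zero hne)
  obtain ⟨y, rfl, hy0⟩ := coeff_psi_ne_zero hk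
  obtain ⟨d, a, ha, rfl⟩ := coeff_euler_Lie_ne_zero hy0
  rw [Finsupp.embDomain_single]
  exact ⟨_, a, ha, rfl⟩

/-- The sum of the coefficients of `euler Lie` in degree `n` is computed twice: from the character
of the multilinear part, and from the monomials `p_d ^ a` with `a d = n`. -/
theorem sum_lieFun (n : ℕ+) : (n : ℚ) * ∑ σ : Perm (Fin n), lieFun _ σ =
    ((n : ℕ).factorial : ℚ) * ∑ x ∈ factorPairs n, cycleCoeff x.2 := by
  classical
  -- A finite set of exponents of degree `n` that supports both sums.
  let S : Finset (ℕ+ →₀ ℕ) := Finset.univ.image (fun σ : Perm (Fin n) => cyc σ) ∪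
    (factorPairs n).image fun x => Finsupp.single x.2 (x.1 : ℕ)
  have hS : ∀ m ∈ S, degree m = n := fun m hm => by
    rcases Finset.mem_union.1 hm with hm | hm
    · obtain ⟨σ, -, rfl⟩ := Finset.mem_image.1 hm
      rw [degree_cyc, Nat.card_eq_fintype_card, Fintype.card_fin]
    · obtain ⟨x, hx, rfl⟩ := Finset.mem_image.1 hm
      rw [degree_single, ← mem_factorPairs.1 hx, PNat.mul_coe]
  have h1 : ∑ m ∈ S, wsum lieFun (Fin n) m = ∑ σ : Perm (Fin n), lieFun _ σ := by
    simp only [wsum]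
    rw [Finset.sum_comm]
    refine Finset.sum_congr rfl fun σ _ => ?_
    rw [Finset.sum_ite_eq, if_pos]
    exact Finset.mem_union_left _ (Finset.mem_image_of_mem _ (Finset.mem_univ σ))
  have h2 : ∑ x ∈ factorPairs n, cycleCoeff x.2 = ∑ m ∈ S, coeff m (euler Lie) := by
    rw [← Finset.sum_subset (Finset.subset_union_right : _ ⊆ S), Finset.sum_image]
    · exact Finset.sum_congr rfl fun x _ => (coeff_euler_Lie_single x.2 x.1.ne_zero).symm
    · intro x _ y _ hxy
      obtain ⟨h, h'⟩ := single_inj x.1.ne_zero hxy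
      exact Prod.ext (PNat.coe_injective h') h
    · intro m hm hm'
      by_contra h0
      obtain ⟨d, a, ha, rfl⟩ := coeff_euler_Lie_ne_zero h0
      refine hm' (Finset.mem_image.2 ⟨(⟨a, Nat.pos_of_ne_zero ha⟩, d), ?_, rfl⟩)
      rw [mem_factorPairs]
      have := hS _ hm
      rw [degree_single] at this
      exact PNat.coe_injective this
  rw [h2, ← h1, Finset.mul_sum, Finset.mul_sum]
  refine Finset.sum_congr rfl fun m hm => ?_
  rw [← factorial_mul_coeff_cycleIndex lieFun (hS m hm), coeff_euler, hS m hm, Lie_eq_cycleIndex]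
  ring

end
end PreLieHAL

namespace PreLieHAL
open MvPowerSeries Equiv
noncomputable section

/-! ### Invariants of the multilinear parts of free Lie algebras -/

theorem IsBracketing.mapLie_eq_self {α : Type} [DecidableEq α] {S : Finset α}
    {x : FreeLieAlgebra ℚ α} (h : IsBracketing S x) {f : α → α} (hf : ∀ i ∈ S, f i = i) :
    PreLieHAL.mapLie f x = x := by
  induction h with
  | of i => rw [mapLie_of, hf i (Finset.mem_singleton_self i)]
  | lie _ _ _ ihx ihy =>
    rw [LieHom.map_lie, ihx fun c hc => hf c (Finset.mem_union_left _ hc),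
      ihy fun c hc => hf c (Finset.mem_union_right _ hc)]

/-- A bracketing with at least two letters contains an innermost bracket of two generators;
exchanging these changes its sign and leaves the other letters alone. -/
theorem IsBracketing.eq_of_or_exists_swap {α : Type} [DecidableEq α] {S : Finset α}
    {x : FreeLieAlgebra ℚ α} (h : IsBracketing S x) :
    (∃ i, S = {i} ∧ x = FreeLieAlgebra.of ℚ i) ∨
      ∃ i ∈ S, ∃ j ∈ S, PreLieHAL.mapLie (Equiv.swap i j) x = -x := by
  induction h with
  | of i => exact Or.inl ⟨i, rfl, rfl⟩
  | @lie S T x y hST hx hy ihx ihy =>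
    right
    rcases ihx with ⟨i, rfl, rfl⟩ | ⟨i, hi, j, hj, hij⟩
    · rcases ihy with ⟨j, rfl, rfl⟩ | ⟨j, hj, k, hk, hjk⟩
      · refine ⟨i, by simp, j, by simp, ?_⟩
        rw [LieHom.map_lie, mapLie_of, mapLie_of, Equiv.swap_apply_left, Equiv.swap_apply_right,
          lie_skew]
      · refine ⟨j, Finset.mem_union_right _ hj, k, Finset.mem_union_right _ hk, ?_⟩
        rw [LieHom.map_lie, hjk, hx.mapLie_eq_self, lie_neg]
        intro l hl
        exact Equiv.swap_apply_of_ne_of_ne (fun h => Finset.disjoint_left.1 hST (h ▸ hl) hj)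
          fun h => Finset.disjoint_left.1 hST (h ▸ hl) hk
    · refine ⟨i, Finset.mem_union_left _ hi, j, Finset.mem_union_left _ hj, ?_⟩
      rw [LieHom.map_lie, hij, hy.mapLie_eq_self, neg_lie]
      intro l hl
      exact Equiv.swap_apply_of_ne_of_ne (fun h => Finset.disjoint_left.1 hST hi (h ▸ hl))
        fun h => Finset.disjoint_left.1 hST hj (h ▸ hl)

/-- The sum of the group action kills every bracketing, whose sign some transposition reverses.
Hence this operator is zero on the multilinear part, and so is its trace. -/
theorem sum_lieFun_eq_zero {α : Type} [Fintype α] [DecidableEq α] (h : 1 < Fintype.card α) :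
    ∑ σ : Perm α, lieFun α σ = 0 := by
  have h0 : multilinearLie α ≤ LinearMap.ker (∑ σ : Perm α,
      (mapLie σ : FreeLieAlgebra ℚ α →ₗ[ℚ] FreeLieAlgebra ℚ α)) := by
    refine multilinearLie_le fun S x hS hx => ?_
    rw [LinearMap.mem_ker, LinearMap.sum_apply]
    change ∑ σ : Perm α, mapLie σ x = 0
    rcases hx.eq_of_or_exists_swap with ⟨i, rfl, -⟩ | ⟨i, -, j, -, hij⟩
    · obtain ⟨j, hj⟩ := Fintype.exists_ne_of_one_lt_card h i
      exact absurd (Finset.mem_singleton.1 (hS j)) hj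
    · have h1 : ∑ σ : Perm α, mapLie σ x = ∑ σ : Perm α, mapLie (σ * Equiv.swap i j : Perm α) x :=
        (Equiv.sum_comp (Equiv.mulRight (Equiv.swap i j)) fun σ : Perm α => mapLie σ x).symm
      have h2 : ∀ σ : Perm α, mapLie (σ * Equiv.swap i j : Perm α) x = -mapLie σ x := fun σ => by
        rw [Perm.coe_mul, ← mapLie_mapLie, hij, map_neg]
      simp only [h2, Finset.sum_neg_distrib] at h1
      have h3 : (2 : ℚ) • ∑ σ : Perm α, mapLie σ x = 0 := by
        rw [two_smul]
        exact add_eq_zero_iff_eq_neg.2 h1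
      exact (smul_eq_zero.1 h3).resolve_left two_ne_zero
  simp only [lieFun]
  rw [← map_sum]
  have h1 : ∑ σ : Perm α, (multilinearLieEquiv σ).toLinearMap = 0 := by
    refine LinearMap.ext fun x => Subtype.ext ?_
    have := LinearMap.mem_ker.1 (h0 x.2)
    rw [LinearMap.sum_apply] at this
    rw [LinearMap.sum_apply, Submodule.coe_sum]
    exact this
  rw [h1, map_zero]

theorem sum_lieFun_one : ∑ σ : Perm (Fin 1), lieFun _ σ = 1 := by
  rw [Fintype.sum_unique]
  have h1 : (multilinearLieEquiv (default : Perm (Fin 1))).toLinearMap = LinearMap.id := by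
    refine LinearMap.ext fun x => Subtype.ext ?_
    have h2 : ((default : Perm (Fin 1)) : Fin 1 → Fin 1) = id := Subsingleton.elim _ _
    change mapLie (default : Perm (Fin 1)) x.1 = x.1
    rw [h2, mapLie_id]
  have : Unique (Arrangement (0 : Fin 1)) :=
    { default := ⟨[], by simp, fun a => by simp [Subsingleton.elim a 0]⟩
      uniq := fun l => by
        obtain ⟨l, hl, -⟩ := l
        refine Subtype.ext ?_
        cases l with
        | nil => rfl
        | cons a l =>
          exfalso
          rw [Subsingleton.elim a 0] at hl
          simp at hl }
  have h2 := finrank_multilinearLie_le (0 : Fin 1)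
  have h3 := card_le_finrank_multilinearLie (0 : Fin 1)
  rw [Nat.card_unique] at h2 h3
  rw [lieFun, h1, LinearMap.trace_id, h2.antisymm h3, Nat.cast_one]

/-- By `sum_lieFun`, the left side is a multiple of the sum of the character over the group, known
from the absence of invariants. This is the recursion of the Möbius function, whose values are not
needed. -/
theorem sum_cycleCoeff (n : ℕ+) :
    ∑ x ∈ factorPairs n, cycleCoeff x.2 = if n = 1 then 1 else 0 := by
  have hn : ((n : ℕ).factorial : ℚ) ≠ 0 := Nat.cast_ne_zero.2 (Nat.factorial_ne_zero _)
  refine mul_left_cancel₀ hn ?_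
  rw [← sum_lieFun]
  split_ifs with h
  · subst h
    rw [PNat.one_coe, sum_lieFun_one]
    simp
  · rw [sum_lieFun_eq_zero, mul_zero, mul_zero]
    rw [Fintype.card_fin]
    have := n.pos
    have h1 : (n : ℕ) ≠ 1 := fun h1 => h (PNat.coe_injective h1)
    omega

/-- The coefficient of `p_n ^ a` in the sum is a divisor sum of `cycleCoeff`, so only the powers of
`p_1` survive. -/
theorem psiSum_euler_Lie : 1 + psiSum (euler Lie) = cycleIndex listFun := by
  classical
  ext m
  rw [map_add, coeff_one, coeff_cycleIndex_listFun]
  by_cases hm : ∃ d a, a ≠ 0 ∧ m = Finsupp.single d a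
  · obtain ⟨d, a, ha, rfl⟩ := hm
    rw [if_neg (by simpa using ha), zero_add, coeff_psiSum_euler_Lie_single d ha, sum_cycleCoeff]
    refine if_congr ⟨?_, ?_⟩ rfl rfl
    · rintro rfl
      exact ⟨a, rfl⟩
    · rintro ⟨n, hn⟩
      exact (single_inj ha hn).1
  · have h1 : coeff m (psiSum (euler Lie)) = 0 := by
      by_contra h
      exact hm (coeff_psiSum_euler_Lie_ne_zero h)
    rw [h1, add_zero]
    refine if_congr ⟨?_, ?_⟩ rfl rfl
    · rintro rfl
      exact ⟨0, by simp⟩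
    · rintro ⟨n, rfl⟩
      by_contra h
      refine hm ⟨1, n, ?_, rfl⟩
      rintro rfl
      exact h (Finsupp.single_zero _)

theorem constantCoeff_Lie : constantCoeff Lie = 0 := by
  have h : coeff 0 (cycleIndex lieFun) = 0 := by
    have hd : degree 0 = 0 := map_zero _
    have : IsEmpty (Fin (degree 0)) := by rw [hd]; infer_instance
    have h1 : ∀ σ : Perm (Fin (degree 0)), lieFun _ σ = 0 := fun σ => by
      have h2 : (multilinearLieEquiv σ).toLinearMap = 0 := by
        refine LinearMap.ext fun x => ?_
        have h3 := (Submodule.mem_bot ℚ).1 (multilinearLie_eq_bot.le x.2)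
        rw [show x = 0 from Subtype.ext h3, map_zero, map_zero]
      rw [lieFun, h2, map_zero]
    rw [coeff_cycleIndex, wsum]
    simp only [h1, ite_self, Finset.sum_const_zero, mul_zero]
  rw [← coeff_zero_eq_constantCoeff_apply, Lie_eq_cycleIndex, h]

/-- Suspending `p_1 / (1 - p_1)` gives `p_1 / (1 + p_1)`, the logarithmic Euler derivative of `1 +
p_1`; hence `1 + p_1` is the plethystic exponential of `Σ Lie`. -/
theorem plethysm_Comm_suspension_Lie_eq_p_one : plethysm Comm (suspension Lie) = p 1 := by
  have h0 := constantCoeff_suspension constantCoeff_Lie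
  have h1 : euler (suspension Lie) = suspension (euler Lie) := by
    rw [suspension_eq, suspension_eq, map_neg, negVars_euler]
  have h2 : negVars (psiSum (euler Lie)) = -p 1 - p 1 * negVars (psiSum (euler Lie)) := by
    have h3 := congrArg negVars cycleIndex_listFun_eq
    rw [← psiSum_euler_Lie] at h3
    simp only [map_add, map_mul, map_one, negVars_p] at h3
    linear_combination h3
  have h3 : (1 : SymFun ℚ) + p 1 = plethysticExp (suspension Lie) := by
    refine eq_plethysticExp h0 ?_ ?_
    · rw [map_add, constantCoeff_X, add_zero, map_one]
    · rw [h1, psiSum_suspension, suspension_eq, map_add, euler_p, Derivation.map_one_eq_zero]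
      rw [PNat.one_coe, Nat.cast_one, one_smul]
      linear_combination h2
  rw [← one_add_plethysm_Comm h0] at h3
  exact (add_left_cancel h3).symm

end
end PreLieHAL

theorem mainTheorem8 :
    plethysm Comm (suspension PreLie)
        = p 1 - (p 1 * MvPowerSeries.pderiv ℚ 1 HALbar - HALbar) ∧
      ∀ G : SymFun ℚ, MvPowerSeries.constantCoeff G = 0 →
        (plethysm Lie G = PreLie ↔ suspension G = plethysm Comm (suspension PreLie)) := by
  have hL := plethysm_Comm_suspension_Lie_eq_p_one
  exact ⟨plethysm_Comm_eq constantCoeff_Lie hL (constantCoeff_suspension constantCoeff_PreLie)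
      (suspension_mul_plethysticExp constantCoeff_PreLie PreLie_eq_p_mul_plethysticExp),
    fun G hG => plethysm_Lie_eq_iff constantCoeff_Lie hL constantCoeff_PreLie hG⟩
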